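/- Let $(M,\omega)$ be a symplectic manifold (smooth, finite-dimensional, without boundary, Hausdorff, $\sigma$-compact), and let $C^\infty(M)$ be the algebra of smooth complex-valued functions on $M$ with the Poisson bracket $\{\cdot,\cdot\}$ induced by $\omega$ (extended $\mathbb{C}$-bilinearly). A star product on $M$ is an associative product on $C^\infty(M)[[\nu]]$ with unit $1$ of the form \[ f\star g=\sum_{r\ge 0}\nu^r C_r(f,g), \] extended $\mathbb{C}[[\nu]]$-bilinearly, where the $C_r$ are bidifferential operators on $M$, $C_0(f,g)=fg$, and $C_1(f,g)-C_1(g,f)=\{f,g\}$. It is natural if for every $r\ge 1$ the operator $C_r$ is of order at most $r$ in both arguments. Write $L_f h=f\star h$ and $R_g h=h\star g$. A formal differential operator $X=X_0+\nu X_1+\dots$ on $M$ is natural if $X_r$ is of order at most $r$ for every $r\ge 0$; natural operators form an algebra $\mathfrak N$ under composition. Let $\mathcal I\subset C^\infty(M\times M)$ be the vanishing ideal of the diagonal and let $C^\infty(M\times M,M)=C^\infty(M\times M)/\bigcap_{r\ge1}\mathcal I^r$ be the space of jets along the diagonal; for $f=\sum\nu^if_i$ and $g=\sum\nu^jg_j$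 in $C^\infty(M)[[\nu]]$ let $f\otimes g=\sum\nu^{i+j}f_i\otimes g_j$, where $(f_i\otimes g_j)(x,y)=f_i(x)g_j(y)$, and denote by the same symbol its class in $C^\infty(M\times M,M)[[\nu]]$. Theorem. Let $\star$ be a natural star product on a symplectic manifold $M$. (1) There is a unique sequence of bidifferential operators $D_r$, $r\ge0$, on $M\times M$, with $D_r$ of order at most $r$ in both arguments, such that the product $F\odot G=\sum_r\nu^rD_r(F,G)$ satisfies $(f\otimes g)\odot(u\otimes v)=(f\star u)\otimes(v\star g)$ for all $f,g,u,v\in C^\infty(M)$. It induces a product, also denoted by $\odot$, on $C^\infty(M\times M,M)[[\nu]]$. Set $\mathbb B=(C^\infty(M\times M,M)[[\nu]],\odot)$. (2) There is a unique sequence of linear maps $T_n$, $n\ge0$, from $C^\infty(M\times M,M)$ to the linear operators on $C^\infty(M)$ such that $\sum_n\nu^nT_n(f\otimes g)=L_fR_g$ for all $f,g\in C^\infty(M)$ and such that for all $n$ and all $h\in C^\infty(M)$ there is $k$ for which the value of $T_n(F)h$ at any $x\in M$ depends only on the $k$-jet of $F$ at $(x,x)$. For $F=\sum_j\nu^jF_j\in\mathbb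 B$ put $N_F=\sum_{i,j}\nu^{i+j}T_i(F_j)$; in other words, $F\mapsto N_Fh$ is the extension of the formal bidifferential operator $(f,g)\mapsto f\star h\star g$ to $C^\infty(M\times M,M)[[\nu]]$. (3) The mapping $F\mapsto N_F$ is an isomorphism of unital $\mathbb C[[\nu]]$-algebras from $\mathbb B$ onto $\mathfrak N$: it is a $\mathbb C[[\nu]]$-linear bijection of $\mathbb B$ onto $\mathfrak N$ with $N_{F\odot G}=N_FN_G$ and $N_1=1$. Moreover $N_{f\otimes g}=L_fR_g$ for all $f,g\in C^\infty(M)[[\nu]]$. -/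

import Mathlib

open scoped Manifold ContDiff PowerSeries

noncomputable section

namespace StarProduct

/-! ### Smooth complex-valued functions and differential operators -/

section Smooth

variable {E : Type*} [NormedAddCommGroup E] [NormedSpace ℝ E]
  {H : Type*} [TopologicalSpace H] (I : ModelWithCorners ℝ E H)
  (M : Type*) [TopologicalSpace M] [ChartedSpace H M]

/-- The algebra `C^∞(M)` of smooth complex-valued functions on `M`. -/
def SmoothFn : Subalgebra ℂ (M → ℂ) where
  carrier := {f | ContMDiff I 𝓘(ℝ, ℂ) ∞ f}
  mul_mem' {f g} hf hg := by
    have hm : ContMDiff 𝓘(ℝ, ℂ × ℂ) 𝓘(ℝ, ℂ) ∞ (fun p : ℂ × ℂ => p.1 * p.2) :=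
      (contDiff_fst.mul contDiff_snd).contMDiff
    exact hm.comp (ContMDiff.prodMk_space hf hg)
  add_mem' {f g} hf hg := ContMDiff.add hf hg
  algebraMap_mem' c := contMDiff_const

variable {M}

/-- The ideal of the smooth functions that vanish at the point `x`. -/
def pointIdeal (x : M) : Ideal (SmoothFn I M) where
  carrier := {f | (f : M → ℂ) x = 0}
  add_mem' {f g} hf hg := by
    simp only [Set.mem_ofPred_eq] at hf hg ⊢
    simp [hf, hg]
  zero_mem' := rfl
  smul_mem' c f hf := by
    simp only [Set.mem_ofPred_eq] at hf ⊢
    simp [hf]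

/-- `D` is a differential operator on `M` of order at most `k`: the value of `D f` at `x` depends
only on the `k`-jet of `f` at `x`. -/
def IsDiffOp (k : ℕ) (D : Module.End ℂ (SmoothFn I M)) : Prop :=
  ∀ x : M, ∀ f ∈ pointIdeal I x ^ (k + 1), (D f : M → ℂ) x = 0

/-- `B` is a bidifferential operator on `M` of order at most `k` in each of its arguments. -/
def IsBidiffOp (k : ℕ) (B : SmoothFn I M →ₗ[ℂ] SmoothFn I M →ₗ[ℂ] SmoothFn I M) : Prop :=
  (∀ f, IsDiffOp I k (B f)) ∧ ∀ g, IsDiffOp I k (B.flip g)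

variable {I}

/-- The commutator of an operator with the multiplication by a function. -/
def commMul (D : Module.End ℂ (SmoothFn I M)) (a : SmoothFn I M) :
    Module.End ℂ (SmoothFn I M) :=
  D * LinearMap.mulLeft ℂ a - LinearMap.mulLeft ℂ a * D

lemma commMul_apply (D : Module.End ℂ (SmoothFn I M)) (a f : SmoothFn I M) :
    commMul D a f = D (a * f) - a * D f := rfl

lemma commMul_eval (D : Module.End ℂ (SmoothFn I M)) (a f : SmoothFn I M) (x : M) :
    (commMul D a f : M → ℂ) x =
      (D ((a - algebraMap ℂ (SmoothFn I M) ((a : M → ℂ) x)) * f) : M → ℂ) x := by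
  have h : (a - algebraMap ℂ (SmoothFn I M) ((a : M → ℂ) x)) * f
      = a * f - ((a : M → ℂ) x) • f := by
    rw [sub_mul, Algebra.smul_def]
  rw [h, map_sub, map_smul, commMul_apply]
  simp

lemma sub_const_mem (a : SmoothFn I M) (x : M) :
    a - algebraMap ℂ (SmoothFn I M) ((a : M → ℂ) x) ∈ pointIdeal I x :=
  sub_self ((a : M → ℂ) x)

lemma IsDiffOp.commMul_zero {D : Module.End ℂ (SmoothFn I M)} (hD : IsDiffOp I 0 D)
    (a f : SmoothFn I M) : commMul D a f = 0 := by
  ext x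
  rw [commMul_eval]
  exact hD x _ (by simpa using Ideal.mul_mem_right f _ (sub_const_mem a x))

lemma IsDiffOp.commMul_succ {k : ℕ} {D : Module.End ℂ (SmoothFn I M)} (hD : IsDiffOp I (k + 1) D)
    (a : SmoothFn I M) : IsDiffOp I k (commMul D a) := by
  intro x f hf
  rw [commMul_eval]
  refine hD x _ ?_
  rw [pow_succ']
  exact Ideal.mul_mem_mul (sub_const_mem a x) hf

lemma IsDiffOp.map_pow (x : M) : ∀ (k : ℕ) {D : Module.End ℂ (SmoothFn I M)}, IsDiffOp I k D →
    ∀ (j : ℕ), ∀ f ∈ pointIdeal I x ^ (k + j), D f ∈ pointIdeal I x ^ j := by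
  intro k
  induction k with
  | zero =>
    intro D hD j f hf
    have h : ∀ a, D a = a * D 1 := by
      intro a
      have := hD.commMul_zero a 1
      rw [commMul_apply, mul_one, sub_eq_zero] at this
      exact this
    rw [h]
    rw [zero_add] at hf
    exact Ideal.mul_mem_right _ _ hf
  | succ k ih =>
    intro D hD j
    induction j with
    | zero => intro f _; simp
    | succ j ihj =>
      intro f hf
      have hf' : f ∈ pointIdeal I x * pointIdeal I x ^ (k + 1 + j) := by
        rw [← pow_succ']
        exact hf
      refine Submodule.mul_induction_on hf' ?_ ?_
      · intro a ha b hb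
        have h1 : D (a * b) = commMul D a b + a * D b := by
          rw [commMul_apply]
          ring
        rw [h1]
        refine Ideal.add_mem _ (ih (hD.commMul_succ a) (j + 1) b ?_) ?_
        · have h2 : k + (j + 1) = k + 1 + j := by omega
          rw [h2]
          exact hb
        · rw [pow_succ']
          exact Ideal.mul_mem_mul ha (ihj b hb)
      · intro a b ha hb
        rw [map_add]
        exact Ideal.add_mem _ ha hb

lemma IsDiffOp.comp {k l : ℕ} {D D' : Module.End ℂ (SmoothFn I M)} (hD : IsDiffOp I k D)
    (hD' : IsDiffOp I l D') : IsDiffOp I (k + l) (D * D') := by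
  intro x f hf
  refine hD x _ (hD'.map_pow x l (k + 1) f ?_)
  have h : l + (k + 1) = k + l + 1 := by omega
  rw [h]
  exact hf

lemma IsDiffOp.sum {k : ℕ} {ι : Type*} (s : Finset ι) {D : ι → Module.End ℂ (SmoothFn I M)}
    (hD : ∀ i ∈ s, IsDiffOp I k (D i)) : IsDiffOp I k (∑ i ∈ s, D i) := by
  intro x f hf
  simp only [LinearMap.sum_apply, AddSubmonoidClass.coe_finsetSum, Finset.sum_apply]
  exact Finset.sum_eq_zero fun i hi => hD i hi x f hf

variable (I M)

/-- The algebra `𝔑` of natural operators on `M`: the formal differential operators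
`X = X₀ + ν X₁ + ν² X₂ + …` such that `X_r` is of order at most `r`. The product is the
composition of formal operators. -/
def NaturalOps : Subalgebra ℂ (Module.End ℂ (SmoothFn I M))⟦X⟧ where
  carrier := {X | ∀ r, IsDiffOp I r (PowerSeries.coeff r X)}
  mul_mem' {X Y} hX hY r := by
    rw [PowerSeries.coeff_mul]
    refine IsDiffOp.sum _ fun p hp => ?_
    rw [← Finset.HasAntidiagonal.mem_antidiagonal.mp hp]
    exact (hX p.1).comp (hY p.2)
  add_mem' {X Y} hX hY r x f hf := by
    have h1 := hX r x f hf
    have h2 := hY r x f hf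
    simp [h1, h2]
  algebraMap_mem' c r x f hf := by
    have hf0 : (f : M → ℂ) x = 0 := by
      have h : f ∈ pointIdeal I x := Ideal.pow_le_self (Nat.succ_ne_zero r) hf
      exact h
    by_cases hr : r = 0
    · subst hr
      simp [PowerSeries.algebraMap_apply, Module.algebraMap_end_apply, hf0]
    · simp [PowerSeries.algebraMap_apply, PowerSeries.coeff_C, hr]

end Smooth

/-! ### Symplectic manifolds -/

section Symplectic

variable (E : Type*) [NormedAddCommGroup E] [NormedSpace ℝ E]
  (M : Type*) [TopologicalSpace M] [ChartedSpace E M]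

/-- The expression of a field of alternating 2-forms on `M` in the chart at `x₀`. -/
def chartForm {E : Type*} [NormedAddCommGroup E] [NormedSpace ℝ E]
    {M : Type*} [TopologicalSpace M] [ChartedSpace E M]
    (Ω : ∀ x : M, TangentSpace 𝓘(ℝ, E) x [⋀^Fin 2]→L[ℝ] ℝ) (x₀ : M) :
    E → E [⋀^Fin 2]→L[ℝ] ℝ := fun y =>
  (Ω ((extChartAt 𝓘(ℝ, E) x₀).symm y)).compContinuousLinearMap
    (mfderiv 𝓘(ℝ, E) 𝓘(ℝ, E) (extChartAt 𝓘(ℝ, E) x₀).symm y)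

/-- A symplectic form on `M`: a smooth closed nondegenerate 2-form. -/
structure SymplecticForm where
  form : ∀ x : M, TangentSpace 𝓘(ℝ, E) x [⋀^Fin 2]→L[ℝ] ℝ
  smooth : ∀ x₀ : M, ContDiffOn ℝ ∞ (chartForm form x₀) (extChartAt 𝓘(ℝ, E) x₀).target
  closed : ∀ x₀ : M, ∀ y ∈ (extChartAt 𝓘(ℝ, E) x₀).target, extDeriv (chartForm form x₀) y = 0
  nondegenerate : ∀ (x : M) (v : TangentSpace 𝓘(ℝ, E) x), (∀ w, form x ![v, w] = 0) → v = 0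

variable {E M}

namespace SymplecticForm

/-- The linear map `v ↦ Ω(v, ·)` from the tangent space to the cotangent space. -/
def flat (Ω : SymplecticForm E M) (x : M) :
    TangentSpace 𝓘(ℝ, E) x →ₗ[ℝ] Module.Dual ℝ (TangentSpace 𝓘(ℝ, E) x) :=
  LinearMap.mk₂ ℝ (fun v w => Ω.form x ![v, w])
    (fun v v' w => (Ω.form x).toMultilinearMap.cons_add ![w] v v')
    (fun c v w => (Ω.form x).toMultilinearMap.cons_smul ![w] c v)
    (fun v w w' => by
      have h := (Ω.form x).toMultilinearMap.map_update_add ![v, w] 1 w w'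
      have e : ∀ u, Function.update ![v, w] 1 u = ![v, u] := fun u => by
        ext i
        fin_cases i <;> rfl
      rw [e, e, e] at h
      exact h)
    (fun c v w => by
      have h := (Ω.form x).toMultilinearMap.map_update_smul ![v, w] 1 c w
      have e : ∀ u, Function.update ![v, w] 1 u = ![v, u] := fun u => by
        ext i
        fin_cases i <;> rfl
      rw [e, e] at h
      exact h)

lemma flat_injective (Ω : SymplecticForm E M) (x : M) : Function.Injective (Ω.flat x) := by
  rw [← LinearMap.ker_eq_bot, LinearMap.ker_eq_bot']
  intro v hv
  exact Ω.nondegenerate x v fun w => LinearMap.congr_fun hv w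

variable [FiniteDimensional ℝ E]

instance (x : M) : FiniteDimensional ℝ (TangentSpace 𝓘(ℝ, E) x) :=
  inferInstanceAs (FiniteDimensional ℝ E)

/-- The inverse of `flat`: the vector `v = Ω.sharp x α` is determined by `Ω(v, ·) = α`. -/
def sharp (Ω : SymplecticForm E M) (x : M) :
    Module.Dual ℝ (TangentSpace 𝓘(ℝ, E) x) ≃ₗ[ℝ] TangentSpace 𝓘(ℝ, E) x :=
  (LinearMap.linearEquivOfInjective (Ω.flat x) (Ω.flat_injective x)
    Subspace.dual_finrank_eq.symm).symm

/-- The value at `x` of the Poisson bracket `{f, g} = Ω(X_f, X_g) = df(X_g)`, where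
`Ω(X_g, ·) = dg`, for complex-valued `f` and `g`. It is the complex bilinear extension of the
bracket of real functions: `X_g` is the complex vector `♯(d Re g) + i ♯(d Im g)`. -/
def bracket (Ω : SymplecticForm E M) (f g : M → ℂ) (x : M) : ℂ :=
  let df : TangentSpace 𝓘(ℝ, E) x →L[ℝ] ℂ := mfderiv 𝓘(ℝ, E) 𝓘(ℝ, ℂ) f x
  let dg : TangentSpace 𝓘(ℝ, E) x →L[ℝ] ℂ := mfderiv 𝓘(ℝ, E) 𝓘(ℝ, ℂ) g x
  df (Ω.sharp x (Complex.reCLM.comp dg).toLinearMap) +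
    Complex.I * df (Ω.sharp x (Complex.imCLM.comp dg).toLinearMap)

end SymplecticForm

end Symplectic

/-! ### Formal series -/

/-- The extension of a formal family `T = T₀ + ν T₁ + …` of linear maps to formal series:
`T(F) = ∑ ν^(i+j) T_i(F_j)`. -/
def formalLin {U W : Type*} [Semiring U] [Semiring W] [Module ℂ U] [Module ℂ W]
    (T : ℕ → U →ₗ[ℂ] W) (F : U⟦X⟧) : W⟦X⟧ :=
  PowerSeries.mk fun n => ∑ p ∈ Finset.HasAntidiagonal.antidiagonal n, T p.1 (PowerSeries.coeff p.2 F)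

/-- The extension of a formal family `B = B₀ + ν B₁ + …` of bilinear maps to formal series:
`B(F, G) = ∑ ν^(i+j+k) B_i(F_j, G_k)`. -/
def formalBilin {U V W : Type*} [Semiring U] [Semiring V] [Semiring W]
    [Module ℂ U] [Module ℂ V] [Module ℂ W]
    (B : ℕ → U →ₗ[ℂ] V →ₗ[ℂ] W) (F : U⟦X⟧) (G : V⟦X⟧) : W⟦X⟧ :=
  PowerSeries.mk fun n => ∑ p ∈ Finset.HasAntidiagonal.antidiagonal n, ∑ q ∈ Finset.HasAntidiagonal.antidiagonal p.2,
    B p.1 (PowerSeries.coeff q.1 F) (PowerSeries.coeff q.2 G)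

/-- A formal complex number `c ∈ ℂ[[ν]]` as an element of `R[[ν]]`. -/
def formalConst (R : Type*) [Semiring R] [Algebra ℂ R] (c : ℂ⟦X⟧) : R⟦X⟧ :=
  PowerSeries.map (algebraMap ℂ R) c

/-! ### Star products -/

section Star

variable {E : Type*} [NormedAddCommGroup E] [NormedSpace ℝ E]
  {M : Type*} [TopologicalSpace M] [ChartedSpace E M]

/-- `f ⋆ g = ∑ ν^r C_r(f, g)` is a star product on the symplectic manifold `(M, Ω)`. -/
structure IsStarProduct [FiniteDimensional ℝ E] (Ω : SymplecticForm E M)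
    (C : ℕ → SmoothFn 𝓘(ℝ, E) M →ₗ[ℂ] SmoothFn 𝓘(ℝ, E) M →ₗ[ℂ] SmoothFn 𝓘(ℝ, E) M) :
    Prop where
  bidiff : ∀ r, ∃ k, IsBidiffOp 𝓘(ℝ, E) k (C r)
  zero : ∀ f g, C 0 f g = f * g
  one : ∀ (f g : SmoothFn 𝓘(ℝ, E) M) (x : M),
    ((C 1 f g - C 1 g f : SmoothFn 𝓘(ℝ, E) M) : M → ℂ) x = Ω.bracket f g x
  assoc : ∀ f g h : (SmoothFn 𝓘(ℝ, E) M)⟦X⟧,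
    formalBilin C (formalBilin C f g) h = formalBilin C f (formalBilin C g h)
  mul_one : ∀ f : (SmoothFn 𝓘(ℝ, E) M)⟦X⟧, formalBilin C f 1 = f
  one_mul : ∀ f : (SmoothFn 𝓘(ℝ, E) M)⟦X⟧, formalBilin C 1 f = f

/-- A star product is natural if `C_r` is of order at most `r` in both arguments. -/
def IsNatural
    (C : ℕ → SmoothFn 𝓘(ℝ, E) M →ₗ[ℂ] SmoothFn 𝓘(ℝ, E) M →ₗ[ℂ] SmoothFn 𝓘(ℝ, E) M) : Prop :=
  ∀ r, 1 ≤ r → IsBidiffOp 𝓘(ℝ, E) r (C r)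

/-- The formal operator `L_f h = f ⋆ h`. -/
def opL (C : ℕ → SmoothFn 𝓘(ℝ, E) M →ₗ[ℂ] SmoothFn 𝓘(ℝ, E) M →ₗ[ℂ] SmoothFn 𝓘(ℝ, E) M)
    (f : (SmoothFn 𝓘(ℝ, E) M)⟦X⟧) : (Module.End ℂ (SmoothFn 𝓘(ℝ, E) M))⟦X⟧ :=
  formalLin C f

/-- The formal operator `R_g h = h ⋆ g`. -/
def opR (C : ℕ → SmoothFn 𝓘(ℝ, E) M →ₗ[ℂ] SmoothFn 𝓘(ℝ, E) M →ₗ[ℂ] SmoothFn 𝓘(ℝ, E) M)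
    (g : (SmoothFn 𝓘(ℝ, E) M)⟦X⟧) : (Module.End ℂ (SmoothFn 𝓘(ℝ, E) M))⟦X⟧ :=
  formalLin (fun r => (C r).flip) g

/-! ### Functions on the formal neighbourhood of the diagonal -/

/-- The function `(f ⊗ g)(x, y) = f(x) g(y)` on `M × M`. -/
def tensor (f g : SmoothFn 𝓘(ℝ, E) M) :
    SmoothFn (𝓘(ℝ, E).prod 𝓘(ℝ, E)) (M × M) :=
  ⟨fun p => (f : M → ℂ) p.1 * (g : M → ℂ) p.2,
    (SmoothFn (𝓘(ℝ, E).prod 𝓘(ℝ, E)) (M × M)).mul_mem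
      (x := fun p => (f : M → ℂ) p.1) (y := fun p => (g : M → ℂ) p.2)
      (ContMDiff.comp (I' := 𝓘(ℝ, E)) f.2 contMDiff_fst)
      (ContMDiff.comp (I' := 𝓘(ℝ, E)) g.2 contMDiff_snd)⟩

variable (E M)

/-- The vanishing ideal of the diagonal in `C^∞(M × M)`. -/
def diagIdeal : Ideal (SmoothFn (𝓘(ℝ, E).prod 𝓘(ℝ, E)) (M × M)) :=
  ⨅ x : M, pointIdeal (𝓘(ℝ, E).prod 𝓘(ℝ, E)) (x, x)

/-- The algebra `C^∞(M × M, M) = C^∞(M × M) / ⋂ᵣ 𝓘^r` of jets of infinite order along the diagonal,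
where `𝓘` is the vanishing ideal of the diagonal. -/
abbrev DiagJets : Type _ :=
  SmoothFn (𝓘(ℝ, E).prod 𝓘(ℝ, E)) (M × M) ⧸ ⨅ r : ℕ, diagIdeal E M ^ (r + 1)

variable {E M}

/-- The jet of a function along the diagonal. -/
def diagJet (F : SmoothFn (𝓘(ℝ, E).prod 𝓘(ℝ, E)) (M × M)) : DiagJets E M :=
  Ideal.Quotient.mk _ F

/-- The factorizable element `f ⊗ g` of `C^∞(M × M, M)[[ν]]`, for formal functions `f` and `g`. -/
def jetTensor (f g : (SmoothFn 𝓘(ℝ, E) M)⟦X⟧) : (DiagJets E M)⟦X⟧ :=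
  PowerSeries.mk fun n => ∑ p ∈ Finset.HasAntidiagonal.antidiagonal n,
    diagJet (tensor (PowerSeries.coeff p.1 f) (PowerSeries.coeff p.2 g))

/-- `D = D₀ + ν D₁ + …` is the formal bidifferential operator `⋆ ⊗ ⋆^opp` on `M × M`: `D_r` is a
bidifferential operator of order at most `r` in both arguments, and
`(f ⊗ g) ⊙ (u ⊗ v) = (f ⋆ u) ⊗ (v ⋆ g)`. -/
structure IsTensorOpp
    (C : ℕ → SmoothFn 𝓘(ℝ, E) M →ₗ[ℂ] SmoothFn 𝓘(ℝ, E) M →ₗ[ℂ] SmoothFn 𝓘(ℝ, E) M)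
    (D : ℕ → SmoothFn (𝓘(ℝ, E).prod 𝓘(ℝ, E)) (M × M) →ₗ[ℂ]
      SmoothFn (𝓘(ℝ, E).prod 𝓘(ℝ, E)) (M × M) →ₗ[ℂ]
      SmoothFn (𝓘(ℝ, E).prod 𝓘(ℝ, E)) (M × M)) : Prop where
  bidiff : ∀ r, IsBidiffOp (𝓘(ℝ, E).prod 𝓘(ℝ, E)) r (D r)
  tensor : ∀ (r : ℕ) (f g u v : SmoothFn 𝓘(ℝ, E) M),
    D r (tensor f g) (tensor u v) =
      ∑ p ∈ Finset.HasAntidiagonal.antidiagonal r, tensor (C p.1 f u) (C p.2 v g)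

/-- `P = P₀ + ν P₁ + …` is the formal product on `C^∞(M × M, M)` induced by `⋆ ⊗ ⋆^opp`. -/
def IsJetProduct
    (C : ℕ → SmoothFn 𝓘(ℝ, E) M →ₗ[ℂ] SmoothFn 𝓘(ℝ, E) M →ₗ[ℂ] SmoothFn 𝓘(ℝ, E) M)
    (P : ℕ → DiagJets E M →ₗ[ℂ] DiagJets E M →ₗ[ℂ] DiagJets E M) : Prop :=
  ∃ D, IsTensorOpp C D ∧ ∀ r F G, P r (diagJet F) (diagJet G) = diagJet (D r F G)

/-- `T = T₀ + ν T₁ + …` is the formal map `F ↦ N_F` on `C^∞(M × M, M)`: for every function `h` the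
map `F ↦ N_F h` is the map `C^∞(M × M, M) → C^∞(M)[[ν]]` defined by the formal bidifferential
operator `(f, g) ↦ f ⋆ h ⋆ g`. That is, the value of `T_n(F) h` at `x` depends only on a jet of
finite order of `F` at `(x, x)`, and `T_n(f ⊗ g)` is the coefficient of `L_f R_g` at `ν^n`. -/
structure IsOperatorMap
    (C : ℕ → SmoothFn 𝓘(ℝ, E) M →ₗ[ℂ] SmoothFn 𝓘(ℝ, E) M →ₗ[ℂ] SmoothFn 𝓘(ℝ, E) M)
    (T : ℕ → DiagJets E M →ₗ[ℂ] Module.End ℂ (SmoothFn 𝓘(ℝ, E) M)) : Prop where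
  diff : ∀ (n : ℕ) (h : SmoothFn 𝓘(ℝ, E) M), ∃ k : ℕ, ∀ x : M,
    ∀ F ∈ pointIdeal (𝓘(ℝ, E).prod 𝓘(ℝ, E)) (x, x) ^ (k + 1),
      (T n (diagJet F) h : M → ℂ) x = 0
  tensor : ∀ (n : ℕ) (f g : SmoothFn 𝓘(ℝ, E) M),
    T n (diagJet (tensor f g)) =
      PowerSeries.coeff n (opL C (PowerSeries.C f) * opR C (PowerSeries.C g))

end Star

end StarProduct

end

open StarProduct

namespace StarProduct

open Filter Topology MeasureTheory

/-! ### Parametric integrals and the Hadamard quotient in a vector space -/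

section Hadamard

universe u

theorem hasFDerivAt_unitIntegral {X F : Type u} [NormedAddCommGroup X] [NormedSpace ℝ X]
    [FiniteDimensional ℝ X] [NormedAddCommGroup F] [NormedSpace ℝ F] [CompleteSpace F]
    {f : X × ℝ → F} (hf : ContDiff ℝ ∞ f) (x₀ : X) :
    HasFDerivAt (fun x => ∫ s in (0 : ℝ)..1, f (x, s))
      (∫ s in (0 : ℝ)..1, (fderiv ℝ f (x₀, s)).comp (ContinuousLinearMap.inl ℝ X ℝ)) x₀ := by
  have hd : Continuous fun p : X × ℝ =>
      (fderiv ℝ f p).comp (ContinuousLinearMap.inl ℝ X ℝ) :=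
    (hf.continuous_fderiv (by simp)).clm_comp continuous_const
  have hK : IsCompact (Metric.closedBall x₀ 1 ×ˢ Set.Icc (0 : ℝ) 1) :=
    (isCompact_closedBall x₀ 1).prod isCompact_Icc
  obtain ⟨B, hB⟩ := hK.exists_bound_of_continuousOn hd.continuousOn
  refine (intervalIntegral.hasFDerivAt_integral_of_dominated_of_fderiv_le (𝕜 := ℝ)
    (s := Metric.closedBall x₀ 1) (bound := fun _ => B)
    (F' := fun x s => (fderiv ℝ f (x, s)).comp (ContinuousLinearMap.inl ℝ X ℝ))
    (Metric.closedBall_mem_nhds x₀ one_pos) ?_ ?_ ?_ ?_ ?_ ?_)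
  · exact Eventually.of_forall fun x =>
      (hf.continuous.comp (by fun_prop : Continuous fun s : ℝ => (x, s))).aestronglyMeasurable
  · exact (hf.continuous.comp
      (by fun_prop : Continuous fun s : ℝ => (x₀, s))).intervalIntegrable _ _
  · exact (hd.comp (by fun_prop : Continuous fun s : ℝ => (x₀, s))).aestronglyMeasurable
  · refine Eventually.of_forall fun s hs x hx => hB (x, s) ⟨hx, ?_⟩
    rw [Set.uIoc_of_le zero_le_one] at hs
    exact ⟨hs.1.le, hs.2⟩
  · exact intervalIntegrable_const
  · refine Eventually.of_forall fun s _ x _ => ?_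
    exact ((hf.differentiable (by simp)) (x, s)).hasFDerivAt.comp x (hasFDerivAt_prodMk_left x s)

theorem contDiff_unitIntegral_nat (n : ℕ) {X : Type u} [NormedAddCommGroup X] [NormedSpace ℝ X]
    [FiniteDimensional ℝ X] : ∀ {F : Type u} [NormedAddCommGroup F] [NormedSpace ℝ F]
    [CompleteSpace F] {f : X × ℝ → F}, ContDiff ℝ ∞ f →
    ContDiff ℝ n (fun x => ∫ s in (0 : ℝ)..1, f (x, s)) := by
  induction n with
  | zero =>
    intro F _ _ _ f hf
    rw [Nat.cast_zero, contDiff_zero]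
    exact continuous_iff_continuousAt.2 fun x => (hasFDerivAt_unitIntegral hf x).continuousAt
  | succ n ih =>
    intro F _ _ _ f hf
    rw [Nat.cast_succ, contDiff_succ_iff_fderiv]
    refine ⟨fun x => (hasFDerivAt_unitIntegral hf x).differentiableAt, by simp, ?_⟩
    rw [show fderiv ℝ (fun x => ∫ s in (0 : ℝ)..1, f (x, s)) = fun x => ∫ s in (0 : ℝ)..1,
      (fderiv ℝ f (x, s)).comp (ContinuousLinearMap.inl ℝ X ℝ) from
        funext fun x => (hasFDerivAt_unitIntegral hf x).fderiv]
    exact ih (f := fun p => (fderiv ℝ f p).comp (ContinuousLinearMap.inl ℝ X ℝ))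
      ((hf.fderiv_right (by simp)).clm_comp contDiff_const)

theorem contDiff_unitIntegral {X F : Type u} [NormedAddCommGroup X] [NormedSpace ℝ X]
    [FiniteDimensional ℝ X] [NormedAddCommGroup F] [NormedSpace ℝ F] [CompleteSpace F]
    {f : X × ℝ → F} (hf : ContDiff ℝ ∞ f) :
    ContDiff ℝ ∞ (fun x => ∫ s in (0 : ℝ)..1, f (x, s)) :=
  contDiff_infty.2 fun n => contDiff_unitIntegral_nat n hf

/-- The Hadamard quotient of a smooth function. -/
theorem exists_hadamard_quotient {X : Type u} [NormedAddCommGroup X] [NormedSpace ℝ X]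
    [FiniteDimensional ℝ X] {f : X → ℂ} (hf : ContDiff ℝ ∞ f) :
    ∃ K : X × X → X →L[ℝ] ℂ, ContDiff ℝ ∞ K ∧ ∀ x y, f y = f x + K (x, y) (y - x) := by
  have hg : ContDiff ℝ ∞ fun p : (X × X) × ℝ => fderiv ℝ f (p.1.1 + p.2 • (p.1.2 - p.1.1)) :=
    (hf.fderiv_right (by simp)).comp (by fun_prop)
  refine ⟨fun p => ∫ s in (0 : ℝ)..1, fderiv ℝ f (p.1 + s • (p.2 - p.1)),
    contDiff_unitIntegral hg, fun x y => ?_⟩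
  have hc : Continuous fun s : ℝ => fderiv ℝ f (x + s • (y - x)) :=
    (hf.continuous_fderiv (by simp)).comp (by fun_prop)
  have h1 : ∀ s : ℝ, HasDerivAt (fun s : ℝ => f (x + s • (y - x)))
      (fderiv ℝ f (x + s • (y - x)) (y - x)) s := by
    intro s
    have h2 : HasDerivAt (fun s : ℝ => x + s • (y - x)) (y - x) s := by
      simpa using ((hasDerivAt_id s).smul_const (y - x)).const_add x
    exact ((hf.differentiable (by simp)) _).hasFDerivAt.comp_hasDerivAt s h2
  have h3 := intervalIntegral.integral_eq_sub_of_hasDerivAt (a := 0) (b := 1) (fun s _ => h1 s)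
    ((hc.clm_apply continuous_const).intervalIntegrable _ _)
  rw [← ContinuousLinearMap.intervalIntegral_apply (hc.intervalIntegrable _ _)] at h3
  simp only [one_smul, zero_smul, add_zero, add_sub_cancel] at h3
  show f y = f x + (∫ s in (0 : ℝ)..1, fderiv ℝ f (x + s • (y - x))) (y - x)
  rw [h3]
  ring

end Hadamard

end StarProduct

namespace StarProduct

open Filter Topology

set_option linter.unusedSectionVars false

/-! ### Local constructions on a manifold -/

section Local

variable {E : Type*} [NormedAddCommGroup E] [NormedSpace ℝ E]
  {H : Type*} [TopologicalSpace H] {I : ModelWithCorners ℝ E H}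
  {N : Type*} [TopologicalSpace N] [ChartedSpace H N]

@[simp] lemma mem_pointIdeal {x : N} {f : SmoothFn I N} : f ∈ pointIdeal I x ↔ f.1 x = 0 := Iff.rfl

lemma sub_smul_one_mem (f : SmoothFn I N) (x : N) : f - f.1 x • (1 : SmoothFn I N) ∈ pointIdeal I x := by
  simp

variable [FiniteDimensional ℝ E] [IsManifold I ∞ N] [T2Space N]

lemma exists_contMDiff_eventuallyEq {F : Type*} [NormedAddCommGroup F] [NormedSpace ℝ F]
    {f : N → F} {x : N} (hf : ∀ᶠ y in 𝓝 x, ContMDiffAt I 𝓘(ℝ, F) ∞ f y) :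
    ∃ g : N → F, ContMDiff I 𝓘(ℝ, F) ∞ g ∧ g =ᶠ[𝓝 x] f := by
  obtain ⟨b, -, hb⟩ := (SmoothBumpFunction.nhds_basis_tsupport (I := I) x).mem_iff.1 hf
  refine ⟨fun y => b y • f y, contMDiff_of_tsupport fun y hy => ?_, ?_⟩
  · exact b.contMDiffAt.smul (hb (tsupport_smul_subset_left _ _ hy))
  · filter_upwards [b.eventuallyEq_one] with y hy
    simp [hy]

lemma exists_bump {x : N} {U : Set N} (hU : U ∈ 𝓝 x) :
    ∃ b : SmoothFn I N, (∀ᶠ y in 𝓝 x, b.1 y = 1) ∧ ∀ y ∉ U, b.1 y = 0 := by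
  obtain ⟨b, -, hb⟩ := (SmoothBumpFunction.nhds_basis_tsupport (I := I) x).mem_iff.1 hU
  refine ⟨⟨fun y => (b y : ℂ),
    (Complex.ofRealCLM.contDiff (n := ∞)).contMDiff.comp b.contMDiff⟩, ?_, fun y hy => ?_⟩
  · filter_upwards [b.eventuallyEq_one] with y hy
    simp [hy]
  · have : b y = 0 := image_eq_zero_of_notMem_tsupport fun h => hy (hb h)
    simp [this]

lemma mem_pow_of_eventually_eq_zero {x : N} {f : SmoothFn I N} (hf : ∀ᶠ y in 𝓝 x, f.1 y = 0)
    (k : ℕ) : f ∈ pointIdeal I x ^ k := by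
  obtain ⟨b, hb, hb'⟩ := exists_bump (I := I) hf
  have h1 : f * (1 - b) = f := by
    ext y
    by_cases hy : f.1 y = 0
    · simp [hy]
    · simp [hb' y hy]
  have h2 : ∀ j, f * (1 - b) ^ j = f := by
    intro j
    induction j with
    | zero => simp
    | succ j ih => rw [pow_succ, ← mul_assoc, ih, h1]
  rw [← h2 k]
  refine Ideal.mul_mem_left _ _ (Ideal.pow_mem_pow ?_ k)
  simp [hb.self_of_nhds]

lemma mem_pow_of_eventuallyEq {x : N} {f g : SmoothFn I N} (h : f.1 =ᶠ[𝓝 x] g.1) {k : ℕ}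
    (hg : g ∈ pointIdeal I x ^ k) : f ∈ pointIdeal I x ^ k := by
  have h1 : f - g ∈ pointIdeal I x ^ k := mem_pow_of_eventually_eq_zero (by
    filter_upwards [h] with y hy
    simp [hy]) k
  simpa using Ideal.add_mem _ h1 hg

lemma exists_eventually_inverse {x : N} {d : SmoothFn I N} (hd : d.1 x ≠ 0) :
    ∃ u : SmoothFn I N, ∀ᶠ y in 𝓝 x, u.1 y * d.1 y = 1 := by
  have hne : ∀ᶠ y in 𝓝 x, d.1 y ≠ 0 := (ContMDiff.continuous d.2).continuousAt.eventually_ne hd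
  obtain ⟨g, hg, hgd⟩ := exists_contMDiff_eventuallyEq (I := I) (F := ℂ) (x := x)
    (f := fun y => (d.1 y)⁻¹) (by
      filter_upwards [hne] with y hy
      have h1 : ContDiffAt ℝ ∞ (fun z : ℂ => z⁻¹) (d.1 y) := contDiffAt_inv ℝ hy
      exact h1.contMDiffAt.comp y (ContMDiff.contMDiffAt d.2))
  refine ⟨⟨g, hg⟩, ?_⟩
  filter_upwards [hgd, hne] with y h1 h2
  show g y * d.1 y = 1
  rw [h1, inv_mul_cancel₀ h2]

variable (I) in
lemma exists_chart_extension (x : N) :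
    ∃ Ξ : N → E, ContMDiff I 𝓘(ℝ, E) ∞ Ξ ∧ Ξ =ᶠ[𝓝 x] extChartAt I x := by
  refine exists_contMDiff_eventuallyEq ?_
  filter_upwards [(chartAt H x).open_source.mem_nhds (mem_chart_source H x)] with y hy
  exact contMDiffAt_extChartAt' hy

variable (I) in
/-- Smooth functions on a manifold are, near a point, restrictions of smooth functions of the
coordinates; the neighbourhood does not depend on the function. -/
lemma exists_coordinate_lift [I.Boundaryless] (x : N) :
    ∃ U : Set N, IsOpen U ∧ x ∈ U ∧ U ⊆ (extChartAt I x).source ∧ ∀ G : SmoothFn I N,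
      ∃ g : SmoothFn 𝓘(ℝ, E) E, HasCompactSupport g.1 ∧
        (∀ y ∈ U, G.1 y = g.1 (extChartAt I x y)) ∧
        ∀ e, (∀ᶠ e' in 𝓝 e, g.1 e' = 0) ∨ (e ∈ (extChartAt I x).target ∧
          ∃ c : SmoothFn 𝓘(ℝ, E) E,
          ∀ᶠ e' in 𝓝 e, g.1 e' = c.1 e' * G.1 ((extChartAt I x).symm e')) := by
  have ht : IsOpen (extChartAt I x).target := isOpen_extChartAt_target x
  obtain ⟨r, hr, hrt⟩ := Metric.isOpen_iff.1 ht _ (mem_extChartAt_target (I := I) x)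
  let β : ContDiffBump (extChartAt I x x) := ⟨r / 4, r / 2, by positivity, by linarith⟩
  have hβt : tsupport β ⊆ (extChartAt I x).target := by
    rw [β.tsupport_eq]
    exact (Metric.closedBall_subset_ball (show r / 2 < r by linarith)).trans hrt
  refine ⟨(extChartAt I x).source ∩ extChartAt I x ⁻¹' Metric.ball (extChartAt I x x) (r / 4),
    (continuousOn_extChartAt x).isOpen_inter_preimage (isOpen_extChartAt_source x)
      Metric.isOpen_ball, ⟨mem_extChartAt_source x, by simpa using hr⟩,
      Set.inter_subset_left, fun G => ?_⟩
  have hs : ∀ e ∈ (extChartAt I x).target,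
      ContDiffAt ℝ ∞ (fun e => G.1 ((extChartAt I x).symm e)) e := fun e he => by
    rw [← contMDiffAt_iff_contDiffAt]
    exact (ContMDiff.contMDiffAt G.2).comp e
      ((contMDiffOn_extChartAt_symm x).contMDiffAt (ht.mem_nhds he))
  have hg : ContMDiff 𝓘(ℝ, E) 𝓘(ℝ, ℂ) ∞
      (fun e => β e • G.1 ((extChartAt I x).symm e)) := by
    refine contMDiff_of_tsupport fun e he => ?_
    exact (β.contDiff.contDiffAt.smul
      (hs e (hβt (tsupport_smul_subset_left _ _ he)))).contMDiffAt
  refine ⟨⟨_, hg⟩, ?_, fun y hy => ?_, fun e => ?_⟩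
  · exact β.hasCompactSupport.smul_right
  · show G.1 y = β (extChartAt I x y) • G.1 ((extChartAt I x).symm (extChartAt I x y))
    rw [(extChartAt I x).left_inv hy.1, β.one_of_mem_closedBall
      (Metric.ball_subset_closedBall hy.2), one_smul]
  · by_cases he : e ∈ (extChartAt I x).target
    · refine Or.inr ⟨he, ⟨fun e => (β e : ℂ), ?_⟩, Eventually.of_forall fun e' => ?_⟩
      · exact (Complex.ofRealCLM.contDiff.comp β.contDiff).contMDiff
      · exact Complex.real_smul
    · left
      filter_upwards [(isClosed_tsupport β).isOpen_compl.mem_nhds fun h => he (hβt h)] with e' he'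
      show β e' • G.1 ((extChartAt I x).symm e') = 0
      rw [image_eq_zero_of_notMem_tsupport he', zero_smul]

end Local

section Hadamard

universe u
variable {E : Type u} [NormedAddCommGroup E] [NormedSpace ℝ E] [FiniteDimensional ℝ E]
  {H : Type*} [TopologicalSpace H] {I : ModelWithCorners ℝ E H} [I.Boundaryless]
  {N : Type*} [TopologicalSpace N] [ChartedSpace H N] [IsManifold I ∞ N] [T2Space N]
  {E' : Type u} [NormedAddCommGroup E'] [NormedSpace ℝ E'] [FiniteDimensional ℝ E']
  {H' : Type*} [TopologicalSpace H'] {I' : ModelWithCorners ℝ E' H'} [I'.Boundaryless]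
  {P : Type*} [TopologicalSpace P] [ChartedSpace H' P] [IsManifold I' ∞ P] [T2Space P]

/-- Hadamard's lemma with parameters, around the graph of a map. -/
lemma hadamard {ψ : P → N} (hψ : ContMDiff I' I ∞ ψ) (p : P) {Ξ : N → E}
    (hΞ : ContMDiff I 𝓘(ℝ, E) ∞ Ξ) (hΞψ : Ξ =ᶠ[𝓝 (ψ p)] extChartAt I (ψ p)) :
    ∃ U ∈ 𝓝 p, ∃ V ∈ 𝓝 (ψ p), (∀ q ∈ U, ψ q ∈ V) ∧ ∀ G : SmoothFn (I'.prod I) (P × N),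
      ∃ K : E → SmoothFn (I'.prod I) (P × N), ∀ q ∈ U, ∀ z ∈ V, ∃ κ : E →ₗ[ℝ] ℂ,
        (∀ e, κ e = (K e).1 (q, z)) ∧ G.1 (q, z) = G.1 (q, ψ q) + κ (Ξ z - Ξ (ψ q)) := by
  obtain ⟨Θ, hΘ, hΘp⟩ := exists_chart_extension I' p
  obtain ⟨W, hW, hpW, -, hlift⟩ := exists_coordinate_lift (I'.prod I) (p, ψ p)
  obtain ⟨U₁, hU₁, V₁, hV₁, hUV⟩ := mem_nhds_prod_iff.1 (hW.mem_nhds hpW)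
  refine ⟨U₁ ∩ {q | Θ q = extChartAt I' p q} ∩ ψ ⁻¹' (V₁ ∩ {z | Ξ z = extChartAt I (ψ p) z}),
    ?_, V₁ ∩ {z | Ξ z = extChartAt I (ψ p) z}, inter_mem hV₁ hΞψ, fun q hq => hq.2, fun G => ?_⟩
  · exact inter_mem (inter_mem hU₁ hΘp)
      (hψ.continuous.continuousAt.preimage_mem_nhds (inter_mem hV₁ hΞψ))
  obtain ⟨g, -, hg, -⟩ := hlift G
  obtain ⟨K, hK, hKg⟩ := exists_hadamard_quotient (X := E' × E) (f := g.1)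
    (contMDiff_iff_contDiff.1 g.2)
  have hsm : ContMDiff (I'.prod I) 𝓘(ℝ, (E' × E) × (E' × E)) ∞
      (fun x : P × N => ((Θ x.1, Ξ (ψ x.1)), (Θ x.1, Ξ x.2))) := by
    have h1 : ContMDiff (I'.prod I) 𝓘(ℝ, E') ∞ (fun x : P × N => Θ x.1) := hΘ.comp contMDiff_fst
    have h2 : ContMDiff (I'.prod I) 𝓘(ℝ, E) ∞ (fun x : P × N => Ξ (ψ x.1)) :=
      hΞ.comp (hψ.comp contMDiff_fst)
    have h3 : ContMDiff (I'.prod I) 𝓘(ℝ, E) ∞ (fun x : P × N => Ξ x.2) := hΞ.comp contMDiff_snd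
    exact (h1.prodMk_space h2).prodMk_space (h1.prodMk_space h3)
  refine ⟨fun e => ⟨fun x => K ((Θ x.1, Ξ (ψ x.1)), (Θ x.1, Ξ x.2)) (0, e), ?_⟩, ?_⟩
  · exact ((hK.clm_apply contDiff_const).contMDiff (f := fun y => K y (0, e))).comp hsm
  · intro q hq z hz
    refine ⟨(K ((Θ q, Ξ (ψ q)), (Θ q, Ξ z))).toLinearMap ∘ₗ LinearMap.inr ℝ E' E,
      fun e => rfl, ?_⟩
    have h1 : ∀ z ∈ V₁ ∩ {z | Ξ z = extChartAt I (ψ p) z}, G.1 (q, z) = g.1 (Θ q, Ξ z) := by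
      intro z hz
      rw [hg (q, z) (hUV ⟨hq.1.1, hz.1⟩), extChartAt_prod, hz.2, hq.1.2]
      rfl
    rw [h1 z hz, h1 _ hq.2, hKg (Θ q, Ξ (ψ q)) (Θ q, Ξ z)]
    simp

end Hadamard

end StarProduct

namespace StarProduct

open Filter Topology

/-! ### Pullbacks and operators along a map -/

section Along

variable {E : Type*} [NormedAddCommGroup E] [NormedSpace ℝ E]
  {H : Type*} [TopologicalSpace H] {I : ModelWithCorners ℝ E H}
  {N : Type*} [TopologicalSpace N] [ChartedSpace H N]
  {E' : Type*} [NormedAddCommGroup E'] [NormedSpace ℝ E']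
  {H' : Type*} [TopologicalSpace H'] {I' : ModelWithCorners ℝ E' H'}
  {P : Type*} [TopologicalSpace P] [ChartedSpace H' P]

/-- The pullback of smooth functions by a smooth map. -/
def pull {φ : P → N} (hφ : ContMDiff I' I ∞ φ) : SmoothFn I N →ₐ[ℂ] SmoothFn I' P where
  toFun f := ⟨fun w => f.1 (φ w), ContMDiff.comp (I' := I) f.2 hφ⟩
  map_one' := rfl
  map_mul' _ _ := rfl
  map_zero' := rfl
  map_add' _ _ := rfl
  commutes' _ := rfl

@[simp] lemma pull_apply {φ : P → N} (hφ : ContMDiff I' I ∞ φ) (f : SmoothFn I N) (w : P) :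
    (pull hφ f).1 w = f.1 (φ w) := rfl

lemma map_pull_pointIdeal {φ : P → N} (hφ : ContMDiff I' I ∞ φ) (w : P) :
    (pointIdeal I (φ w)).map (pull hφ) ≤ pointIdeal I' w :=
  Ideal.map_le_iff_le_comap.2 fun _ hf => hf

lemma pull_mem_pow {φ : P → N} (hφ : ContMDiff I' I ∞ φ) (w : P) {k : ℕ} {f : SmoothFn I N}
    (hf : f ∈ pointIdeal I (φ w) ^ k) : pull hφ f ∈ pointIdeal I' w ^ k := by
  have h1 := Ideal.mem_map_of_mem (pull hφ) hf
  rw [Ideal.map_pow] at h1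
  exact Ideal.pow_right_mono (map_pull_pointIdeal hφ w) k h1

/-- An operator along the map `φ` of order less than `k`. -/
def OrdLTAlong (φ : P → N) (k : ℕ) (D : SmoothFn I N →ₗ[ℂ] SmoothFn I' P) : Prop :=
  ∀ w : P, ∀ f ∈ pointIdeal I (φ w) ^ k, (D f).1 w = 0

/-- The commutator of an operator along a map with the multiplication by a function. -/
def commAlong {φ : P → N} (hφ : ContMDiff I' I ∞ φ) (D : SmoothFn I N →ₗ[ℂ] SmoothFn I' P)
    (a : SmoothFn I N) : SmoothFn I N →ₗ[ℂ] SmoothFn I' P :=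
  D ∘ₗ LinearMap.mulLeft ℂ a - LinearMap.mulLeft ℂ (pull hφ a) ∘ₗ D

lemma commAlong_apply {φ : P → N} (hφ : ContMDiff I' I ∞ φ)
    (D : SmoothFn I N →ₗ[ℂ] SmoothFn I' P) (a f : SmoothFn I N) :
    commAlong hφ D a f = D (a * f) - pull hφ a * D f := rfl

lemma OrdLTAlong.commAlong {φ : P → N} (hφ : ContMDiff I' I ∞ φ) {k : ℕ}
    {D : SmoothFn I N →ₗ[ℂ] SmoothFn I' P} (hD : OrdLTAlong φ (k + 1) D) (a : SmoothFn I N) :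
    OrdLTAlong φ k (commAlong hφ D a) := by
  intro w f hf
  have h := hD w ((a - a.1 (φ w) • 1) * f) (by
    rw [pow_succ']
    exact Ideal.mul_mem_mul (sub_smul_one_mem a _) hf)
  rw [sub_mul, smul_one_mul, map_sub, map_smul] at h
  rw [commAlong_apply]
  simpa using h

lemma OrdLTAlong.eq_zero {φ : P → N} {D : SmoothFn I N →ₗ[ℂ] SmoothFn I' P}
    (hD : OrdLTAlong φ 0 D) : D = 0 := by
  ext f w
  exact hD w f (by simp)

lemma OrdLTAlong.mem_pow {φ : P → N} (hφ : ContMDiff I' I ∞ φ) {J : Ideal (SmoothFn I N)}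
    {J' : Ideal (SmoothFn I' P)} (hJ : ∀ f ∈ J, pull hφ f ∈ J') (k : ℕ) :
    ∀ {D : SmoothFn I N →ₗ[ℂ] SmoothFn I' P}, OrdLTAlong φ (k + 1) D →
    ∀ (j : ℕ), ∀ f ∈ J ^ (k + j), D f ∈ J' ^ j := by
  induction k with
  | zero =>
    intro D hD j f hf
    have h1 : D f = pull hφ f * D 1 := by
      have h := LinearMap.congr_fun (hD.commAlong hφ f).eq_zero 1
      rwa [commAlong_apply, mul_one, LinearMap.zero_apply, sub_eq_zero] at h
    rw [h1]
    refine Ideal.mul_mem_right _ _ ?_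
    rw [zero_add] at hf
    have h2 := Ideal.mem_map_of_mem (pull hφ) hf
    rw [Ideal.map_pow] at h2
    exact Ideal.pow_right_mono (Ideal.map_le_iff_le_comap.2 hJ) j h2
  | succ k ih =>
    intro D hD j
    induction j with
    | zero => intro f _; simp
    | succ j ihj =>
      intro f hf
      have hf' : f ∈ J * J ^ (k + 1 + j) := by
        rw [← pow_succ']
        exact hf
      refine Submodule.mul_induction_on hf' ?_ ?_
      · intro a ha b hb
        have h1 : D (a * b) = StarProduct.commAlong hφ D a b + pull hφ a * D b := by
          rw [commAlong_apply]
          ring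
        rw [h1]
        refine Ideal.add_mem _ (ih (hD.commAlong hφ a) (j + 1) b ?_) ?_
        · rwa [show k + (j + 1) = k + 1 + j by omega]
        · rw [pow_succ']
          exact Ideal.mul_mem_mul (hJ a ha) (ihj b hb)
      · intro a b ha hb
        rw [map_add]
        exact Ideal.add_mem _ ha hb

end Along

/-! ### The order of an operator -/

section Order

variable {E : Type*} [NormedAddCommGroup E] [NormedSpace ℝ E]
  {H : Type*} [TopologicalSpace H] {I : ModelWithCorners ℝ E H}
  {N : Type*} [TopologicalSpace N] [ChartedSpace H N]

/-- The operator `D` is of order less than `k` at the point `x`. -/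
def OrdLTAt (x : N) (k : ℕ) (D : Module.End ℂ (SmoothFn I N)) : Prop :=
  ∀ f ∈ pointIdeal I x ^ k, (D f).1 x = 0

/-- The operator `D` is of order less than `k`. -/
def OrdLT (k : ℕ) (D : Module.End ℂ (SmoothFn I N)) : Prop := ∀ x, OrdLTAt x k D

lemma isDiffOp_iff {k : ℕ} {D : Module.End ℂ (SmoothFn I N)} :
    IsDiffOp I k D ↔ OrdLT (k + 1) D := Iff.rfl

section

variable {x : N} {k l a b : ℕ} {D D' : Module.End ℂ (SmoothFn I N)}

lemma OrdLTAt.mono (hD : OrdLTAt x k D) (h : k ≤ l) : OrdLTAt x l D :=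
  fun f hf => hD f (Ideal.pow_le_pow_right h hf)

lemma OrdLT.mono (hD : OrdLT k D) (h : k ≤ l) : OrdLT l D := fun x => (hD x).mono h

lemma OrdLTAt.zero : OrdLTAt (I := I) x k 0 := fun _ _ => rfl

lemma OrdLTAt.add (hD : OrdLTAt x k D) (hD' : OrdLTAt x k D') : OrdLTAt x k (D + D') :=
  fun f hf => by simp [hD f hf, hD' f hf]

lemma OrdLTAt.neg (hD : OrdLTAt x k D) : OrdLTAt x k (-D) :=
  fun f hf => by simp [hD f hf]

lemma OrdLTAt.sub (hD : OrdLTAt x k D) (hD' : OrdLTAt x k D') : OrdLTAt x k (D - D') :=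
  fun f hf => by simp [hD f hf, hD' f hf]

lemma OrdLTAt.of_sub (h : OrdLTAt x k (D - D')) (hD' : OrdLTAt x k D') : OrdLTAt x k D :=
  fun f hf => by
    have h1 := h f hf
    simp only [LinearMap.sub_apply, AddSubgroupClass.coe_sub, Pi.sub_apply, hD' f hf,
      sub_zero] at h1
    exact h1

lemma OrdLTAt.smul (hD : OrdLTAt x k D) (c : ℂ) : OrdLTAt x k (c • D) :=
  fun f hf => by simp [hD f hf]

lemma OrdLTAt.sum {ι : Type*} (s : Finset ι) {D : ι → Module.End ℂ (SmoothFn I N)}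
    (hD : ∀ i ∈ s, OrdLTAt x k (D i)) : OrdLTAt x k (∑ i ∈ s, D i) := by
  intro f hf
  simp only [LinearMap.sum_apply, AddSubmonoidClass.coe_finsetSum, Finset.sum_apply]
  exact Finset.sum_eq_zero fun i hi => hD i hi f hf

lemma OrdLT.zero : OrdLT (I := I) (N := N) k 0 := fun _ => OrdLTAt.zero

lemma OrdLT.add (hD : OrdLT k D) (hD' : OrdLT k D') : OrdLT k (D + D') :=
  fun x => (hD x).add (hD' x)

lemma OrdLT.neg (hD : OrdLT k D) : OrdLT k (-D) := fun x => (hD x).neg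

lemma OrdLT.sub (hD : OrdLT k D) (hD' : OrdLT k D') : OrdLT k (D - D') :=
  fun x => (hD x).sub (hD' x)

lemma OrdLT.of_sub (h : OrdLT k (D - D')) (hD' : OrdLT k D') : OrdLT k D :=
  fun x => (h x).of_sub (hD' x)

lemma OrdLT.smul (hD : OrdLT k D) (c : ℂ) : OrdLT k (c • D) := fun x => (hD x).smul c

lemma OrdLT.sum {ι : Type*} (s : Finset ι) {D : ι → Module.End ℂ (SmoothFn I N)}
    (hD : ∀ i ∈ s, OrdLT k (D i)) : OrdLT k (∑ i ∈ s, D i) :=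
  fun x => OrdLTAt.sum s fun i hi => hD i hi x

lemma OrdLT.eq_zero (hD : OrdLT 0 D) : D = 0 := OrdLTAlong.eq_zero (φ := id) hD

lemma OrdLT.mem_pow (hD : OrdLT (k + 1) D) (J : Ideal (SmoothFn I N)) (j : ℕ) {f : SmoothFn I N}
    (hf : f ∈ J ^ (k + j)) : D f ∈ J ^ j :=
  OrdLTAlong.mem_pow (contMDiff_id (I := I)) (fun _ hf => hf) k hD j f hf

lemma OrdLTAt.mul (hD : OrdLTAt x a D) (hD' : OrdLT (b + 1) D') :
    OrdLTAt x (a + b) (D * D') := fun f hf =>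
  hD _ (hD'.mem_pow _ a (by rwa [add_comm] at hf))

lemma OrdLT.mul (hD : OrdLT a D) (hD' : OrdLT (b + 1) D') : OrdLT (a + b) (D * D') :=
  fun x => (hD x).mul hD'

lemma OrdLT.mul' (hD : OrdLT (a + 1) D) (hD' : OrdLT b D') : OrdLT (a + b) (D * D') := by
  cases b with
  | zero => rw [hD'.eq_zero, mul_zero]; exact OrdLT.zero
  | succ b => exact (hD.mul hD').mono (by omega)

lemma OrdLT.commMul (hD : OrdLT (k + 1) D) (u : SmoothFn I N) : OrdLT k (commMul D u) :=
  OrdLTAlong.commAlong (contMDiff_id (I := I)) (φ := id) hD u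

lemma ordLT_succ_of_commMul (h : ∀ u, OrdLT k (StarProduct.commMul D u)) : OrdLT (k + 1) D := by
  intro x f hf
  rw [pow_succ'] at hf
  refine Submodule.mul_induction_on hf (fun a ha b hb => ?_) fun a b ha hb => ?_
  · have h1 := h a x b hb
    rw [commMul_apply] at h1
    have h2 : a.1 x = 0 := ha
    simpa [h2] using h1
  · rw [map_add]
    show (D a).1 x + (D b).1 x = 0
    rw [ha, hb, add_zero]

lemma ordLT_mulLeft (u : SmoothFn I N) : OrdLT 1 (LinearMap.mulLeft ℂ u) := by
  intro x f hf
  rw [pow_one] at hf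
  have : f.1 x = 0 := hf
  simp [this]

lemma OrdLT.eq_mulLeft (hD : OrdLT 1 D) : D = LinearMap.mulLeft ℂ (D 1) := by
  ext1 f
  have h := LinearMap.congr_fun (hD.commMul f).eq_zero 1
  rw [commMul_apply, mul_one, LinearMap.zero_apply, sub_eq_zero] at h
  rw [h, LinearMap.mulLeft_apply, mul_comm]

lemma OrdLT.commutator_zero (hD : OrdLT (a + 1) D) (hD' : OrdLT 1 D') :
    OrdLT a (D * D' - D' * D) := by
  rw [hD'.eq_mulLeft]
  exact hD.commMul _

/-- The commutator of operators of orders `a` and `b` is of order less than `a + b`. -/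
lemma OrdLT.commutator (hD : OrdLT (a + 1) D) (hD' : OrdLT (b + 1) D') :
    OrdLT (a + b) (D * D' - D' * D) := by
  induction hn : a + b generalizing a b D D' with
  | zero =>
    obtain ⟨rfl, rfl⟩ : a = 0 ∧ b = 0 := by omega
    exact hD.commutator_zero hD'
  | succ n ih =>
    rcases Nat.eq_zero_or_pos b with rfl | hb
    · exact (hD.commutator_zero hD').mono (by omega)
    rcases Nat.eq_zero_or_pos a with rfl | ha
    · intro x f hf
      have h := ((hD'.commutator_zero hD).mono (show b ≤ n + 1 by omega)) x f hf
      simp only [LinearMap.sub_apply, Module.End.mul_apply, AddSubgroupClass.coe_sub,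
        Pi.sub_apply] at h ⊢
      rw [← neg_sub, h, neg_zero]
    obtain ⟨a, rfl⟩ := Nat.exists_eq_succ_of_ne_zero ha.ne'
    obtain ⟨b, rfl⟩ := Nat.exists_eq_succ_of_ne_zero hb.ne'
    refine ordLT_succ_of_commMul fun u => ?_
    have h1 := ih (hD.commMul u) hD' (by omega)
    have h2 := ih hD (hD'.commMul u) (by omega)
    convert h1.add h2 using 1
    ext1 f
    simp only [StarProduct.commMul, LinearMap.sub_apply, LinearMap.add_apply,
      Module.End.mul_apply, map_sub]
    abel

/-- An operator of order at most one that kills the constants is a derivation. -/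
lemma OrdLT.leibniz (hD : OrdLT 2 D) (h1 : D 1 = 0) (f g : SmoothFn I N) :
    D (f * g) = D f * g + f * D g := by
  have h := LinearMap.congr_fun (hD.commMul f).eq_mulLeft g
  rw [LinearMap.mulLeft_apply, commMul_apply, commMul_apply, mul_one, h1, mul_zero, sub_zero] at h
  rw [← h]
  ring

end

end Order

/-- An operator that is the identity on `J / J²` is the multiplication by `n` on `J^n / J^(n+1)` if
it is a derivation (up to an ideal `K`). -/
lemma euler_sub_mem {R : Type*} [CommRing R] {J K : Ideal R} {e : R → R}
    (hadd : ∀ a b, e (a + b) = e a + e b) (hmul : ∀ a b, e (a * b) = e a * b + a * e b)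
    (h1 : ∀ a ∈ J, e a - a ∈ J ^ 2 ⊔ K) (n : ℕ) :
    ∀ a ∈ J ^ n, e a - n • a ∈ J ^ (n + 1) ⊔ K ∨ n = 0 := by
  induction n with
  | zero => intro a _; right; rfl
  | succ n ih =>
    intro a ha
    left
    rcases Nat.eq_zero_or_pos n with rfl | hn
    · simpa using h1 a (by simpa using ha)
    rw [pow_succ'] at ha
    refine Submodule.mul_induction_on ha (fun a ha b hb => ?_) fun a b ha hb => ?_
    · have h2 : e (a * b) - (n + 1) • (a * b) = (e a - a) * b + a * (e b - n • b) := by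
        rw [hmul]
        simp only [nsmul_eq_mul]
        push_cast
        ring
      rw [h2]
      refine Ideal.add_mem _ ?_ ?_
      · have h3 : (e a - a) * b ∈ (J ^ 2 ⊔ K) * J ^ n := Ideal.mul_mem_mul (h1 a ha) hb
        rw [Ideal.sup_mul, ← pow_add, show 2 + n = n + 1 + 1 by omega] at h3
        exact (sup_le_sup le_rfl Ideal.mul_le_left : J ^ (n + 1 + 1) ⊔ K * J ^ n ≤ _) h3
      · have h3 : a * (e b - n • b) ∈ J * (J ^ (n + 1) ⊔ K) :=
          Ideal.mul_mem_mul ha ((ih b hb).resolve_right hn.ne')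
        rw [Ideal.mul_sup, ← pow_succ'] at h3
        exact (sup_le_sup le_rfl Ideal.mul_le_right : J ^ (n + 1 + 1) ⊔ J * K ≤ _) h3
    · have h2 : e (a + b) - (n + 1) • (a + b) = (e a - (n + 1) • a) + (e b - (n + 1) • b) := by
        rw [hadd, smul_add]
        ring
      rw [h2]
      exact Ideal.add_mem _ ha hb

end StarProduct

namespace StarProduct

open Filter Topology

set_option linter.unusedSectionVars false

lemma sup_pow_le_pow_sup_pow {R : Type*} [CommSemiring R] (I J : Ideal R) (n m : ℕ) :
    (I ⊔ J) ^ (n + m + 1) ≤ I ^ (n + 1) ⊔ J ^ (m + 1) := by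
  rw [← Ideal.add_eq_sup, ← Ideal.add_eq_sup, add_pow, Ideal.sum_eq_sup]
  refine Finset.sup_le fun i hi => ?_
  by_cases hn : n + 1 ≤ i
  · exact (Ideal.mul_le_left.trans (Ideal.mul_le_left.trans
      ((Ideal.pow_le_pow_right hn).trans le_sup_left)))
  · refine (Ideal.mul_le_left.trans (Ideal.mul_le_right.trans
      ((Ideal.pow_le_pow_right ?_).trans le_sup_right)))
    lia

section Coordinates

universe u
variable {E : Type u} [NormedAddCommGroup E] [NormedSpace ℝ E] [FiniteDimensional ℝ E]
  {H : Type*} [TopologicalSpace H] {I : ModelWithCorners ℝ E H}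
  {N : Type*} [TopologicalSpace N] [ChartedSpace H N]
  {E' : Type u} [NormedAddCommGroup E'] [NormedSpace ℝ E'] [FiniteDimensional ℝ E']
  {H' : Type*} [TopologicalSpace H'] {I' : ModelWithCorners ℝ E' H'}
  {P : Type*} [TopologicalSpace P] [ChartedSpace H' P]
  {ι : Type*} [Fintype ι] (b : Module.Basis ι ℝ E)

/-- The coordinates, with respect to a basis, of a smooth map into a vector space. -/
noncomputable def coordFn {Ξ : N → E} (hΞ : ContMDiff I 𝓘(ℝ, E) ∞ Ξ) (i : ι) : SmoothFn I N :=
  ⟨fun z => (b.coord i (Ξ z) : ℂ), by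
    have h : ContDiff ℝ ∞ fun e : E => ((b.coord i).toContinuousLinearMap e : ℂ) :=
      Complex.ofRealCLM.contDiff.comp (ContinuousLinearMap.contDiff _)
    exact ContMDiff.comp (I' := 𝓘(ℝ, E)) h.contMDiff hΞ⟩

@[simp] lemma coordFn_apply {Ξ : N → E} (hΞ : ContMDiff I 𝓘(ℝ, E) ∞ Ξ) (i : ι) (z : N) :
    (coordFn b hΞ i).1 z = (b.coord i (Ξ z) : ℂ) := rfl

/-- The restriction of a function on a product to a fibre of the first projection. -/
noncomputable def slice (q : P) : SmoothFn (I'.prod I) (P × N) →ₐ[ℂ] SmoothFn I N :=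
  pull (φ := fun z => (q, z)) (contMDiff_const.prodMk contMDiff_id)

@[simp] lemma slice_apply (q : P) (G : SmoothFn (I'.prod I) (P × N)) (z : N) :
    (slice q G).1 z = G.1 (q, z) := rfl

/-- The function `(q, z) ↦ u q * v z`. -/
noncomputable def extTensor (u : SmoothFn I' P) (v : SmoothFn I N) : SmoothFn (I'.prod I) (P × N) :=
  pull contMDiff_fst u * pull contMDiff_snd v

@[simp] lemma extTensor_apply (u : SmoothFn I' P) (v : SmoothFn I N) (x : P × N) :
    (extTensor u v).1 x = u.1 x.1 * v.1 x.2 := rfl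

variable [IsManifold I ∞ N] [T2Space N] [IsManifold I' ∞ P] [T2Space P]
  [I.Boundaryless] [I'.Boundaryless]

lemma hadamard_coord {ψ : P → N} (hψ : ContMDiff I' I ∞ ψ) (p : P) {Ξ : N → E}
    (hΞ : ContMDiff I 𝓘(ℝ, E) ∞ Ξ) (hΞψ : Ξ =ᶠ[𝓝 (ψ p)] extChartAt I (ψ p)) :
    ∃ U ∈ 𝓝 p, ∃ V ∈ 𝓝 (ψ p), (∀ q ∈ U, ψ q ∈ V) ∧ ∀ G : SmoothFn (I'.prod I) (P × N),
      ∃ K : ι → SmoothFn (I'.prod I) (P × N), ∀ q ∈ U, ∀ z ∈ V,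
        G.1 (q, z) = G.1 (q, ψ q) +
          ∑ i, ((coordFn b hΞ i).1 z - (coordFn b hΞ i).1 (ψ q)) * (K i).1 (q, z) := by
  obtain ⟨U, hU, V, hV, hUV, h⟩ := hadamard hψ p hΞ hΞψ
  refine ⟨U, hU, V, hV, hUV, fun G => ?_⟩
  obtain ⟨K, hK⟩ := h G
  refine ⟨fun i => K (b i), fun q hq z hz => ?_⟩
  obtain ⟨κ, hκ, hG⟩ := hK q hq z hz
  rw [hG, ← b.sum_repr (Ξ z - Ξ (ψ q)), map_sum]
  congr 1
  refine Finset.sum_congr rfl fun i _ => ?_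
  rw [map_smul, hκ, Complex.real_smul]
  simp

/-- Near a point every smooth function has a first order expansion in the coordinates. -/
lemma hadamard_near (x : N) {Ξ : N → E}
    (hΞ : ContMDiff I 𝓘(ℝ, E) ∞ Ξ) (hΞx : Ξ =ᶠ[𝓝 x] extChartAt I x) :
    ∀ᶠ y in 𝓝 x, ∀ f : SmoothFn I N, ∃ g : ι → SmoothFn I N, ∀ᶠ z in 𝓝 y,
      f.1 z = f.1 y + ∑ i, ((coordFn b hΞ i).1 z - (coordFn b hΞ i).1 y) * (g i).1 z := by
  obtain ⟨U, hU, V, hV, -, h⟩ := hadamard_coord (I := I) (I' := I) b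
    (contMDiff_id (I := I)) x hΞ hΞx
  filter_upwards [hU, eventually_mem_nhds_iff.2 hV] with y hyU hyV f
  obtain ⟨K, hK⟩ := h (pull contMDiff_snd f)
  refine ⟨fun i => slice y (K i), ?_⟩
  filter_upwards [hyV] with z hz
  exact hK y hyU z hz

/-- A functional that depends on a finite jet, applied to the fibres of a function on a product,
gives a smooth function. -/
lemma contMDiff_functional_slice (y : N) (k : ℕ) : ∀ ℓ : SmoothFn I N →ₗ[ℂ] ℂ,
    (∀ f ∈ pointIdeal I y ^ k, ℓ f = 0) → ∀ G : SmoothFn (I'.prod I) (P × N),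
      ContMDiff I' 𝓘(ℝ, ℂ) ∞ fun q => ℓ (slice q G) := by
  induction k with
  | zero =>
    intro ℓ hℓ G
    have : ∀ q, ℓ (slice q G) = 0 := fun q => hℓ _ (by simp)
    simp only [this]
    exact contMDiff_const
  | succ k ih =>
    intro ℓ hℓ G p
    obtain ⟨Ξ, hΞ, hΞy⟩ := exists_chart_extension I y
    let b := Module.finBasis ℝ E
    obtain ⟨U, hU, V, hV, -, h⟩ := hadamard_coord (I' := I') b
      (contMDiff_const (c := y)) p hΞ hΞy
    obtain ⟨K, hK⟩ := h G
    let θ : Fin (Module.finrank ℝ E) → SmoothFn I N := fun i =>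
      coordFn b hΞ i - (coordFn b hΞ i).1 y • 1
    have h1 : ContMDiff I' 𝓘(ℝ, ℂ) ∞ fun q => G.1 (q, y) * ℓ 1 +
        ∑ i, (ℓ ∘ₗ LinearMap.mulLeft ℂ (θ i)) (slice q (K i)) := by
      have h2 : ContMDiff I' 𝓘(ℝ, ℂ) ∞ fun q => G.1 (q, y) * ℓ 1 :=
        (pull (φ := fun q : P => (q, y)) (contMDiff_id.prodMk contMDiff_const) G *
          algebraMap ℂ (SmoothFn I' P) (ℓ 1)).2
      refine h2.add ?_
      refine contMDiff_finsetSum fun i _ => ih _ (fun f hf => ?_) (K i)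
      refine hℓ _ ?_
      rw [pow_succ']
      exact Ideal.mul_mem_mul (sub_smul_one_mem _ y) hf
    refine h1.contMDiffAt.congr_of_eventuallyEq ?_
    filter_upwards [hU] with q hq
    have h3 : slice q G - (G.1 (q, y) • 1 + ∑ i, θ i * slice q (K i)) ∈
        pointIdeal I y ^ (k + 1) := by
      refine mem_pow_of_eventually_eq_zero ?_ _
      filter_upwards [hV] with z hz
      have h4 := hK q hq z hz
      simp [θ, h4]
    have h4 := hℓ _ h3
    rw [map_sub, sub_eq_zero] at h4
    rw [h4, map_add, map_smul, map_sum]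
    rfl

/-- The vanishing ideal of a point of a product is generated by the functions of one variable. -/
lemma pointIdeal_prod_le (p : P) (z : N) : pointIdeal (I'.prod I) (p, z) ≤
    (pointIdeal I' p).map (pull (contMDiff_fst (I := I') (J := I))) ⊔
      (pointIdeal I z).map (pull (contMDiff_snd (I := I') (J := I))) := by
  intro G hG
  obtain ⟨Ξ, hΞ, hΞy⟩ := exists_chart_extension I z
  let b := Module.finBasis ℝ E
  obtain ⟨U, hU, V, hV, -, h⟩ := hadamard_coord (I' := I') b
      (contMDiff_const (c := z)) p hΞ hΞy
  obtain ⟨K, hK⟩ := h G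
  obtain ⟨β, hβ, hβ'⟩ := exists_bump (I := I') hU
  obtain ⟨γ, hγ, hγ'⟩ := exists_bump (I := I) hV
  set J := (pointIdeal I' p).map (pull (contMDiff_fst (I := I') (J := I))) ⊔
      (pointIdeal I z).map (pull (contMDiff_snd (I := I') (J := I))) with hJ
  have m1 : ∀ f ∈ pointIdeal I' p, pull (contMDiff_fst (I := I') (J := I)) f ∈ J := fun f hf =>
    Ideal.mem_sup_left (Ideal.mem_map_of_mem _ hf)
  have m2 : ∀ f ∈ pointIdeal I z, pull (contMDiff_snd (I := I') (J := I)) f ∈ J := fun f hf =>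
    Ideal.mem_sup_right (Ideal.mem_map_of_mem _ hf)
  let Gz := pull (φ := fun q : P => (q, z)) (contMDiff_id.prodMk contMDiff_const) G
  let θ : Fin (Module.finrank ℝ E) → SmoothFn I N := fun i =>
      coordFn b hΞ i - (coordFn b hΞ i).1 z • 1
  have h1 : G = (extTensor β γ * pull contMDiff_fst Gz +
      ∑ i, pull contMDiff_snd (θ i) * (extTensor β γ * K i)) +
      ((1 - pull contMDiff_fst β) * G + pull contMDiff_fst β * ((1 - pull contMDiff_snd γ) * G)) := by
    ext ⟨q, w⟩
    by_cases hq : q ∈ U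
    · by_cases hw : w ∈ V
      · have h2 := hK q hq w hw
        simp only [Subalgebra.coe_add, Subalgebra.coe_mul, Subalgebra.coe_sub, Subalgebra.coe_one,
          Pi.add_apply, Pi.mul_apply, Pi.sub_apply, Pi.one_apply, extTensor_apply, pull_apply,
          AddSubmonoidClass.coe_finsetSum, Finset.sum_apply]
        have h3 : ∑ i, (θ i).1 w * (β.1 q * γ.1 w * (K i).1 (q, w)) =
            β.1 q * γ.1 w * (G.1 (q, w) - G.1 (q, z)) := by
          rw [h2, add_sub_cancel_left, Finset.mul_sum]
          refine Finset.sum_congr rfl fun i _ => ?_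
          simp only [θ, Subalgebra.coe_sub, Subalgebra.coe_smul, Subalgebra.coe_one,
            Pi.sub_apply, Pi.smul_apply, Pi.one_apply, smul_eq_mul, mul_one]
          ring
        rw [h3]
        show _ = β.1 q * γ.1 w * G.1 (q, z) + _ + _
        ring
      · simp [hγ' w hw]
        ring
    · simp [hβ' q hq]
  rw [h1]
  refine Ideal.add_mem _ (Ideal.add_mem _ (Ideal.mul_mem_left _ _ (m1 _ hG))
    (Ideal.sum_mem _ fun i _ => Ideal.mul_mem_right _ _ (m2 _ (sub_smul_one_mem _ z))))
    (Ideal.add_mem _ (Ideal.mul_mem_right _ _ ?_) (Ideal.mul_mem_left _ _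
      (Ideal.mul_mem_right _ _ ?_)))
  · rw [← map_one (pull contMDiff_fst), ← map_sub]
    exact m1 _ (by simp [hβ.self_of_nhds])
  · rw [← map_one (pull contMDiff_snd), ← map_sub]
    exact m2 _ (by simp [hγ.self_of_nhds])

lemma exists_fg_sup_pow (y : N) (k : ℕ) : ∃ W : Submodule ℂ (SmoothFn I N),
    W.FG ∧ ∀ f, ∃ w ∈ W, f - w ∈ pointIdeal I y ^ k := by
  induction k with
  | zero => exact ⟨⊥, Submodule.fg_bot, fun f => ⟨0, by simp⟩⟩
  | succ k ih =>
    obtain ⟨W, hW, h⟩ := ih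
    obtain ⟨Ξ, hΞ, hΞy⟩ := exists_chart_extension I y
    let b := Module.finBasis ℝ E
    have hh := (hadamard_near b y hΞ hΞy).self_of_nhds
    let θ : Fin (Module.finrank ℝ E) → SmoothFn I N := fun i =>
      coordFn b hΞ i - (coordFn b hΞ i).1 y • 1
    refine ⟨Submodule.span ℂ {1} ⊔ ⨆ i, W.map (LinearMap.mulLeft ℂ (θ i)),
      (Submodule.fg_span_singleton _).sup (Submodule.fg_iSup _ fun i => hW.map _), fun f => ?_⟩
    obtain ⟨g, hg⟩ := hh f
    choose w hwW hw using fun i => h (g i)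
    refine ⟨f.1 y • 1 + ∑ i, θ i * w i, ?_, ?_⟩
    · refine Submodule.add_mem _ (Submodule.mem_sup_left
        (Submodule.smul_mem _ _ (Submodule.mem_span_singleton_self _))) ?_
      refine Submodule.sum_mem _ fun i _ => Submodule.mem_sup_right ?_
      exact Submodule.mem_iSup_of_mem i ⟨w i, hwW i, rfl⟩
    · have h1 : f - (f.1 y • 1 + ∑ i, θ i * w i) =
          (f - (f.1 y • 1 + ∑ i, θ i * g i)) + ∑ i, θ i * (g i - w i) := by
        simp only [mul_sub, Finset.sum_sub_distrib]
        ring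
      rw [h1]
      refine Ideal.add_mem _ (mem_pow_of_eventually_eq_zero ?_ _) (Ideal.sum_mem _ fun i _ => ?_)
      · filter_upwards [hg] with z hz
        simp [θ, hz]
      · rw [pow_succ']
        exact Ideal.mul_mem_mul (sub_smul_one_mem _ y) (hw i)

/-- A bilinear functional that depends on finite jets of its arguments at `p` and `z` extends to a
functional on the functions of two variables that depends on a finite jet at `(p, z)`. -/
lemma exists_functional_extension {p : P} {z : N} {a c : ℕ}
    (lam : SmoothFn I' P →ₗ[ℂ] SmoothFn I N →ₗ[ℂ] ℂ)
    (h1 : ∀ u ∈ pointIdeal I' p ^ (a + 1), ∀ v, lam u v = 0)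
    (h2 : ∀ u, ∀ v ∈ pointIdeal I z ^ (c + 1), lam u v = 0) :
    ∃ L : SmoothFn (I'.prod I) (P × N) →ₗ[ℂ] ℂ, (∀ u v, L (extTensor u v) = lam u v) ∧
      ∀ G ∈ pointIdeal (I'.prod I) (p, z) ^ (a + c + 1), L G = 0 := by
  let Q := SmoothFn I N ⧸ (pointIdeal I z ^ (c + 1)).restrictScalars ℂ
  let π : SmoothFn I N →ₗ[ℂ] Q := Submodule.mkQ _
  have hfin : Module.Finite ℂ Q := by
    obtain ⟨W, hW, h⟩ := exists_fg_sup_pow (I := I) z (c + 1)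
    refine ⟨?_⟩
    have : W.map π = ⊤ := by
      rw [eq_top_iff]
      rintro q -
      obtain ⟨f, rfl⟩ := Submodule.mkQ_surjective _ q
      obtain ⟨w, hw, hfw⟩ := h f
      exact ⟨w, hw, ((Submodule.Quotient.eq _).2 hfw).symm⟩
    rw [← this]
    exact hW.map _
  let B := Module.finBasis ℂ Q
  choose s hs using fun k => Submodule.mkQ_surjective _ (B k)
  have hker : ∀ k, ∀ f ∈ pointIdeal I z ^ (c + 1), (B.coord k ∘ₗ π) f = 0 := by
    intro k f hf
    have : π f = 0 := (Submodule.Quotient.mk_eq_zero _).2 hf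
    rw [LinearMap.comp_apply, this, map_zero]
  let σ : Fin (Module.finrank ℂ Q) → SmoothFn (I'.prod I) (P × N) →ₗ[ℂ] SmoothFn I' P := fun k =>
    { toFun := fun G => ⟨fun q => (B.coord k ∘ₗ π) (slice q G),
        contMDiff_functional_slice z (c + 1) _ (hker k) G⟩
      map_add' := fun F G => by ext q; simp
      map_smul' := fun r G => by ext q; simp }
  have hσ : ∀ k G q, (σ k G).1 q = (B.coord k ∘ₗ π) (slice q G) := fun _ _ _ => rfl
  refine ⟨∑ k, (lam.flip (s k)) ∘ₗ σ k, fun u v => ?_, fun G hG => ?_⟩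
  · have h3 : ∀ k, σ k (extTensor u v) = (B.coord k (π v)) • u := by
      intro k
      ext q
      have : slice q (extTensor u v) = u.1 q • v := by
        ext w
        simp
      rw [hσ, this, map_smul]
      simp [mul_comm]
    have h4 : v - ∑ k, B.coord k (π v) • s k ∈ pointIdeal I z ^ (c + 1) := by
      refine (Submodule.Quotient.eq ((pointIdeal I z ^ (c + 1)).restrictScalars ℂ)).1 ?_
      show π v = π _
      rw [map_sum]
      simp only [map_smul]
      conv_lhs => rw [← B.sum_repr (π v)]
      exact Finset.sum_congr rfl fun k _ => by rw [← hs k]; rfl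
    have h5 := h2 u _ h4
    rw [map_sub, sub_eq_zero] at h5
    rw [h5]
    simp [h3, LinearMap.sum_apply]
  · have h3 := Ideal.pow_right_mono (pointIdeal_prod_le (I := I) (I' := I') p z) _ hG
    have h4 := sup_pow_le_pow_sup_pow _ _ a c h3
    rw [← Ideal.map_pow, ← Ideal.map_pow] at h4
    obtain ⟨G₁, hG₁, G₂, hG₂, rfl⟩ := Submodule.mem_sup.1 h4
    rw [LinearMap.sum_apply]
    refine Finset.sum_eq_zero fun k _ => ?_
    have h5 : σ k G₂ = 0 := by
      ext q
      rw [hσ]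
      refine hker k _ ?_
      exact (Ideal.map_le_iff_le_comap.2 fun f hf => hf :
        Ideal.map (pull (contMDiff_snd (I := I') (J := I))) (pointIdeal I z ^ (c + 1)) ≤
          Ideal.comap (slice q) (pointIdeal I z ^ (c + 1))) hG₂
    have h6 : ∀ g, σ k (g * G₁) ∈ pointIdeal I' p ^ (a + 1) := by
      refine Submodule.span_induction ?_ ?_ ?_ ?_ hG₁
      · rintro _ ⟨f, hf, rfl⟩ g
        have : σ k (g * pull contMDiff_fst f) = f * σ k g := by
          ext q
          have h7 : slice q (g * pull (contMDiff_fst (I := I') (J := I)) f) =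
              f.1 q • slice q g := by
            ext w
            simp [mul_comm]
          rw [hσ, h7, map_smul]
          rfl
        exact this ▸ Ideal.mul_mem_right _ _ hf
      · intro g
        rw [mul_zero, map_zero]
        exact Ideal.zero_mem _
      · intro f f' _ _ hf hf' g
        rw [mul_add, map_add]
        exact Ideal.add_mem _ (hf g) (hf' g)
      · intro r f _ hf g
        rw [smul_eq_mul, ← mul_assoc]
        exact hf _
    have h7 := h6 1
    rw [one_mul] at h7
    rw [LinearMap.comp_apply, map_add, h5, add_zero]
    exact h1 _ h7 _

end Coordinates

end StarProduct

namespace StarProduct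

open Filter Topology

set_option linter.unusedSectionVars false

/-! ### Jets of functions in a generating subspace -/

section Frames

universe u
variable {E : Type u} [NormedAddCommGroup E] [NormedSpace ℝ E] [FiniteDimensional ℝ E]
  {H : Type*} [TopologicalSpace H] {I : ModelWithCorners ℝ E H}
  {N : Type*} [TopologicalSpace N] [ChartedSpace H N]
  [IsManifold I ∞ N] [T2Space N] [I.Boundaryless]
  {E' : Type*} [NormedAddCommGroup E'] [NormedSpace ℝ E']
  {H' : Type*} [TopologicalSpace H'] {I' : ModelWithCorners ℝ E' H'}
  {P : Type*} [TopologicalSpace P] [ChartedSpace H' P]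

variable (I) in
/-- The subspace `S` contains the constants and is stable under the multiplication by local
coordinates around every point. -/
structure ContainsCoords (S : Submodule ℂ (SmoothFn I N)) : Prop where
  one_mem : 1 ∈ S
  coords : ∀ z : N, ∃ (Ξ : N → E) (hΞ : ContMDiff I 𝓘(ℝ, E) ∞ Ξ) (ι : Type) (_ : Fintype ι)
    (b : Module.Basis ι ℝ E), Ξ =ᶠ[𝓝 z] extChartAt I z ∧ ∀ i, ∀ s ∈ S, coordFn b hΞ i * s ∈ S

variable {S : Submodule ℂ (SmoothFn I N)}

/-- The jets of a function, with parameters, are those of a combination of elements of `S` with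
smooth coefficients. -/
lemma ContainsCoords.exists_frame (hS : ContainsCoords I S) (k : ℕ) (z₀ : N) :
    ∀ G : SmoothFn (I.prod I) (N × N),
    ∃ F ∈ Submodule.span ℂ {F : SmoothFn (I.prod I) (N × N) | ∃ c, ∃ s ∈ S, F = extTensor c s},
      ∀ᶠ z : N in 𝓝 z₀, (slice z G - slice z F : SmoothFn I N) ∈ pointIdeal I z ^ k := by
  set Q := Submodule.span ℂ {F : SmoothFn (I.prod I) (N × N) | ∃ c, ∃ s ∈ S, F = extTensor c s}
  induction k with
  | zero => exact fun G => ⟨0, Submodule.zero_mem _, by simp⟩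
  | succ k ih =>
    intro G
    obtain ⟨Ξ, hΞ, ι, _, b, hΞz, hb⟩ := hS.coords z₀
    obtain ⟨U, hU, V, hV, -, h⟩ := hadamard_coord (I := I) (I' := I) b
      (contMDiff_id (I := I)) z₀ hΞ hΞz
    obtain ⟨K, hK⟩ := h G
    choose F hF hFK using fun i => ih (K i)
    have hc : ∀ i, ∀ F ∈ Q, (pull contMDiff_snd (coordFn b hΞ i) -
        pull contMDiff_fst (coordFn b hΞ i)) * F ∈ Q := by
      intro i F hF
      refine Submodule.span_induction ?_ ?_ ?_ ?_ hF
      · rintro _ ⟨c, s, hs, rfl⟩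
        have : (pull contMDiff_snd (coordFn b hΞ i) - pull contMDiff_fst (coordFn b hΞ i)) *
            extTensor c s = extTensor c (coordFn b hΞ i * s) - extTensor (coordFn b hΞ i * c) s := by
          simp only [extTensor, map_mul]
          ring
        rw [this]
        exact Submodule.sub_mem _ (Submodule.subset_span ⟨_, _, hb i s hs, rfl⟩)
          (Submodule.subset_span ⟨_, _, hs, rfl⟩)
      · rw [mul_zero]
        exact Submodule.zero_mem _
      · intro f g _ _ hf hg
        rw [mul_add]
        exact Submodule.add_mem _ hf hg
      · intro r f _ hf
        rw [mul_smul_comm]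
        exact Submodule.smul_mem _ _ hf
    refine ⟨extTensor (pull (φ := fun z => (z, z)) (contMDiff_id.prodMk contMDiff_id) G) 1 +
      ∑ i, (pull contMDiff_snd (coordFn b hΞ i) - pull contMDiff_fst (coordFn b hΞ i)) * F i,
      Submodule.add_mem _ (Submodule.subset_span ⟨_, _, hS.one_mem, rfl⟩)
        (Submodule.sum_mem _ fun i _ => hc i _ (hF i)), ?_⟩
    filter_upwards [hU, eventually_mem_nhds_iff.2 hV, eventually_all.2 hFK] with z hzU hzV hz
    set θ : ι → SmoothFn I N := fun i => coordFn b hΞ i - (coordFn b hΞ i).1 z • 1 with hθ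
    have h1 : slice z G - slice z (extTensor
        (pull (φ := fun z => (z, z)) (contMDiff_id.prodMk contMDiff_id) G) 1 +
        ∑ i, (pull contMDiff_snd (coordFn b hΞ i) - pull contMDiff_fst (coordFn b hΞ i)) * F i) =
        (slice z G - (G.1 (z, z) • 1 + ∑ i, θ i * slice z (K i))) +
          ∑ i, θ i * (slice z (K i) - slice z (F i)) := by
      ext w
      simp only [hθ, Subalgebra.coe_add, Subalgebra.coe_mul, Subalgebra.coe_sub, Subalgebra.coe_one,
        Pi.add_apply, Pi.mul_apply, Pi.sub_apply, Pi.one_apply, extTensor_apply, pull_apply,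
        AddSubmonoidClass.coe_finsetSum, Finset.sum_apply, slice_apply, Subalgebra.coe_smul,
        Pi.smul_apply, smul_eq_mul, mul_one, mul_sub, Finset.sum_sub_distrib]
      ring
    rw [h1]
    refine Ideal.add_mem _ (mem_pow_of_eventually_eq_zero ?_ _) (Ideal.sum_mem _ fun i _ => ?_)
    · filter_upwards [hzV] with w hw
      have h2 := hK z hzU w hw
      simp [hθ, h2]
    · rw [pow_succ']
      exact Ideal.mul_mem_mul (sub_smul_one_mem _ z) (hz i)

/-- Every jet is the jet of an element of `S`. -/
lemma ContainsCoords.dense (hS : ContainsCoords I S) (k : ℕ) (z : N) (F : SmoothFn I N) :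
    ∃ s ∈ S, F - s ∈ pointIdeal I z ^ k := by
  obtain ⟨G, hG, h⟩ := hS.exists_frame k z (pull contMDiff_snd F)
  refine ⟨slice z G, ?_, h.self_of_nhds⟩
  refine Submodule.span_induction ?_ ?_ ?_ ?_ hG
  · rintro _ ⟨c, s, hs, rfl⟩
    have : slice z (extTensor c s) = c.1 z • s := by
      ext w
      simp
    exact this ▸ S.smul_mem _ hs
  · rw [map_zero]
    exact S.zero_mem
  · intro f g _ _ hf hg
    rw [map_add]
    exact S.add_mem hf hg
  · intro r f _ hf
    rw [map_smul]
    exact S.smul_mem _ hf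

/-- A family of functionals depending on finite jets that is smooth on `S` is smooth. -/
lemma ContainsCoords.contMDiff_functional (hS : ContainsCoords I S) {φ : P → N}
    (hφ : ContMDiff I' I ∞ φ) (k : ℕ) (L : P → SmoothFn I N →ₗ[ℂ] ℂ)
    (hL : ∀ w, ∀ F ∈ pointIdeal I (φ w) ^ k, L w F = 0)
    (hLS : ∀ s ∈ S, ContMDiff I' 𝓘(ℝ, ℂ) ∞ fun w => L w s) (F : SmoothFn I N) :
    ContMDiff I' 𝓘(ℝ, ℂ) ∞ fun w => L w F := by
  intro w₀
  obtain ⟨G, hG, h⟩ := hS.exists_frame k (φ w₀) (pull contMDiff_snd F)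
  have h1 : ContMDiff I' 𝓘(ℝ, ℂ) ∞ fun w => L w (slice (φ w) G) := by
    refine Submodule.span_induction ?_ ?_ ?_ ?_ hG
    · rintro _ ⟨c, s, hs, rfl⟩
      have : ∀ w, L w (slice (φ w) (extTensor c s)) = (pull hφ c).1 w * L w s := by
        intro w
        have : slice (φ w) (extTensor c s) = c.1 (φ w) • s := by
          ext w
          simp
        rw [this, map_smul]
        rfl
      simp only [this]
      exact (pull hφ c * ⟨_, hLS s hs⟩ : SmoothFn I' P).2
    · simp only [map_zero]
      exact contMDiff_const
    · intro f g _ _ hf hg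
      simp only [map_add]
      exact hf.add hg
    · intro r f _ hf
      simp only [map_smul]
      exact (r • ⟨_, hf⟩ : SmoothFn I' P).2
  refine h1.contMDiffAt.congr_of_eventuallyEq ?_
  filter_upwards [hφ.continuous.continuousAt.eventually h] with w hw
  have h2 := hL w _ hw
  rw [map_sub, sub_eq_zero] at h2
  exact h2

end Frames

/-! ### Functions of two variables and their tensors -/

section Tensor

universe u
variable {E : Type u} [NormedAddCommGroup E] [NormedSpace ℝ E]
  {M : Type*} [TopologicalSpace M] [ChartedSpace E M]

variable (E M) in
/-- The smooth functions on `M`. -/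
noncomputable abbrev Fn := SmoothFn 𝓘(ℝ, E) M

variable (E M) in
/-- The smooth functions on `M × M`. -/
noncomputable abbrev Fn₂ := SmoothFn (𝓘(ℝ, E).prod 𝓘(ℝ, E)) (M × M)

variable (E) in
/-- The vanishing ideal of a point of `M × M`. -/
noncomputable abbrev pointIdeal₂ (z : M × M) : Ideal (Fn₂ E M) := pointIdeal (𝓘(ℝ, E).prod 𝓘(ℝ, E)) z

@[simp] lemma tensor_apply (f g : Fn E M) (x : M × M) : (tensor f g).1 x = f.1 x.1 * g.1 x.2 := rfl

/-- The tensor product of functions as a bilinear map. -/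
noncomputable def tensorₗ : Fn E M →ₗ[ℂ] Fn E M →ₗ[ℂ] Fn₂ E M :=
  LinearMap.mk₂ ℂ tensor
    (fun f f' g => by ext z; simp [add_mul]) (fun c f g => by ext z; simp [mul_assoc])
    (fun f g g' => by ext z; simp [mul_add]) (fun c f g => by ext z; simp [mul_left_comm])

@[simp] lemma tensorₗ_apply (f g : Fn E M) : tensorₗ f g = tensor f g := rfl

lemma tensor_mul_tensor (f g u v : Fn E M) :
    tensor f g * tensor u v = tensor (f * u) (g * v) := by
  ext z
  simp only [Subalgebra.coe_mul, Pi.mul_apply, tensor_apply]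
  ring

lemma tensor_one_one : tensor (1 : Fn E M) 1 = 1 := by
  ext z
  simp

variable (E M) in
/-- The span of the tensors. -/
noncomputable def tensorSpan : Submodule ℂ (Fn₂ E M) := Submodule.span ℂ {F | ∃ f g, F = tensor f g}

lemma tensor_mem_tensorSpan (f g : Fn E M) : tensor f g ∈ tensorSpan E M :=
  Submodule.subset_span ⟨f, g, rfl⟩

lemma tensor_mul_mem_tensorSpan (f g : Fn E M) {F : Fn₂ E M} (hF : F ∈ tensorSpan E M) :
    tensor f g * F ∈ tensorSpan E M := by
  refine Submodule.span_induction ?_ ?_ ?_ ?_ hF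
  · rintro _ ⟨u, v, rfl⟩
    rw [tensor_mul_tensor]
    exact tensor_mem_tensorSpan _ _
  · rw [mul_zero]
    exact Submodule.zero_mem _
  · intro F G _ _ hF hG
    rw [mul_add]
    exact Submodule.add_mem _ hF hG
  · intro r F _ hF
    rw [mul_smul_comm]
    exact Submodule.smul_mem _ _ hF

variable [FiniteDimensional ℝ E] [IsManifold 𝓘(ℝ, E) ∞ M] [T2Space M]

lemma containsCoords_tensorSpan :
    ContainsCoords (𝓘(ℝ, E).prod 𝓘(ℝ, E)) (tensorSpan E M) where
  one_mem := tensor_one_one (E := E) (M := M) ▸ tensor_mem_tensorSpan _ _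
  coords := by
    rintro ⟨x, y⟩
    obtain ⟨Ξ, hΞ, hΞx⟩ := exists_chart_extension 𝓘(ℝ, E) x
    obtain ⟨Θ, hΘ, hΘy⟩ := exists_chart_extension 𝓘(ℝ, E) y
    let b := Module.finBasis ℝ E
    have h1 : ContMDiff (𝓘(ℝ, E).prod 𝓘(ℝ, E)) 𝓘(ℝ, E) ∞ (fun z : M × M => Ξ z.1) :=
      hΞ.comp contMDiff_fst
    have h2 : ContMDiff (𝓘(ℝ, E).prod 𝓘(ℝ, E)) 𝓘(ℝ, E) ∞ (fun z : M × M => Θ z.2) :=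
      hΘ.comp contMDiff_snd
    refine ⟨fun z => (Ξ z.1, Θ z.2), h1.prodMk_space h2, _, inferInstance, b.prod b, ?_, ?_⟩
    · rw [nhds_prod_eq]
      filter_upwards [hΞx.prod_mk hΘy] with z hz
      rw [extChartAt_prod, hz.1, hz.2]
      rfl
    · rintro (i | i) s hs
      · have : coordFn (b.prod b) (h1.prodMk_space h2) (Sum.inl i) = tensor (coordFn b hΞ i) 1 := by
          ext z
          simp
        exact this ▸ tensor_mul_mem_tensorSpan _ _ hs
      · have : coordFn (b.prod b) (h1.prodMk_space h2) (Sum.inr i) = tensor 1 (coordFn b hΘ i) := by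
          ext z
          simp
        exact this ▸ tensor_mul_mem_tensorSpan _ _ hs

/-- Two linear maps that agree on tensors and depend on finite jets agree. -/
lemma functional_eq_of_tensor {V : Type*} [AddCommGroup V] [Module ℂ V] (L L' : Fn₂ E M →ₗ[ℂ] V)
    (z : M × M) (k : ℕ) (hL : ∀ F ∈ pointIdeal₂ E z ^ k, L F = 0)
    (hL' : ∀ F ∈ pointIdeal₂ E z ^ k, L' F = 0)
    (h : ∀ f g, L (tensor f g) = L' (tensor f g)) : L = L' := by
  ext F
  obtain ⟨s, hs, hFs⟩ := containsCoords_tensorSpan.dense k z F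
  have h1 := hL _ hFs
  have h2 := hL' _ hFs
  rw [map_sub, sub_eq_zero] at h1 h2
  rw [h1, h2]
  refine Submodule.span_induction ?_ ?_ ?_ ?_ hs
  · rintro _ ⟨u, v, rfl⟩
    exact h u v
  · simp
  · intro F G _ _ hF hG
    simp [hF, hG]
  · intro r F _ hF
    simp [hF]

variable {E' : Type*} [NormedAddCommGroup E'] [NormedSpace ℝ E']
  {H' : Type*} [TopologicalSpace H'] {I' : ModelWithCorners ℝ E' H'}
  {P : Type*} [TopologicalSpace P] [ChartedSpace H' P]

/-- Two operators along a map that agree on tensors agree. -/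
lemma OrdLTAlong.eq_of_tensor {φ : P → M × M} {k k' : ℕ} {D D' : Fn₂ E M →ₗ[ℂ] SmoothFn I' P}
    (hD : OrdLTAlong φ k D) (hD' : OrdLTAlong φ k' D')
    (h : ∀ f g, D (tensor f g) = D' (tensor f g)) : D = D' := by
  ext F w
  let ev : SmoothFn I' P →ₗ[ℂ] ℂ := ⟨⟨fun f => f.1 w, fun _ _ => rfl⟩, fun _ _ => rfl⟩
  refine LinearMap.congr_fun (functional_eq_of_tensor (ev ∘ₗ D) (ev ∘ₗ D') (φ w) (max k k')
    (fun F hF => hD w F (Ideal.pow_le_pow_right (le_max_left _ _) hF))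
    (fun F hF => hD' w F (Ideal.pow_le_pow_right (le_max_right _ _) hF)) fun f g => ?_) F
  simp [h]

/-- A bilinear map that is a differential operator in both arguments extends to the functions of
two variables. -/
lemma exists_tensor_extension {φ : P → M × M} (hφ : ContMDiff I' (𝓘(ℝ, E).prod 𝓘(ℝ, E)) ∞ φ)
    (a c : ℕ) (B : Fn E M →ₗ[ℂ] Fn E M →ₗ[ℂ] SmoothFn I' P)
    (h1 : ∀ w, ∀ u ∈ pointIdeal 𝓘(ℝ, E) (φ w).1 ^ (a + 1), ∀ v, (B u v).1 w = 0)
    (h2 : ∀ w, ∀ u, ∀ v ∈ pointIdeal 𝓘(ℝ, E) (φ w).2 ^ (c + 1), (B u v).1 w = 0) :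
    ∃ D : Fn₂ E M →ₗ[ℂ] SmoothFn I' P, (∀ u v, D (tensor u v) = B u v) ∧
      OrdLTAlong φ (a + c + 1) D := by
  let ev : P → SmoothFn I' P →ₗ[ℂ] ℂ := fun w => ⟨⟨fun f => f.1 w, fun _ _ => rfl⟩, fun _ _ => rfl⟩
  choose L hL hL' using fun w => exists_functional_extension (I := 𝓘(ℝ, E)) (I' := 𝓘(ℝ, E))
    (B.compr₂ (ev w)) (h1 w) (h2 w)
  have hsm := containsCoords_tensorSpan.contMDiff_functional hφ (a + c + 1) L hL' (by
    intro s hs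
    refine Submodule.span_induction ?_ ?_ ?_ ?_ hs
    · rintro _ ⟨u, v, rfl⟩
      have : ∀ w, L w (tensor u v) = (B u v).1 w := fun w => hL w u v
      simp only [this]
      exact (B u v).2
    · simp only [map_zero]
      exact contMDiff_const
    · intro f g _ _ hf hg
      simp only [map_add]
      exact hf.add hg
    · intro r f _ hf
      simp only [map_smul]
      exact (r • ⟨_, hf⟩ : SmoothFn I' P).2)
  refine ⟨⟨⟨fun F => ⟨fun w => L w F, hsm F⟩, fun F G => ?_⟩, fun r F => ?_⟩, fun u v => ?_,
    fun w F hF => hL' w F hF⟩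
  · ext w
    simp
  · ext w
    simp
  · ext w
    exact hL w u v

end Tensor

end StarProduct

namespace StarProduct

open Filter Topology Finset

set_option linter.unusedSectionVars false

/-! ### Sums over antidiagonals and formal series of operators -/

section Formal

lemma sum_antidiagonal_assoc {W : Type*} [AddCommMonoid W] (n : ℕ) (f : ℕ → ℕ → ℕ → W) :
    ∑ p ∈ antidiagonal n, ∑ q ∈ antidiagonal p.1, f q.1 q.2 p.2 =
      ∑ p ∈ antidiagonal n, ∑ q ∈ antidiagonal p.2, f p.1 q.1 q.2 := by
  rw [sum_sigma', sum_sigma']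
  refine sum_nbij' (fun x => ⟨(x.2.1, x.2.2 + x.1.2), (x.2.2, x.1.2)⟩)
    (fun x => ⟨(x.1.1 + x.2.1, x.2.2), (x.1.1, x.2.1)⟩) ?_ ?_ ?_ ?_ ?_ <;>
  · rintro ⟨⟨a, b⟩, ⟨c, d⟩⟩ h
    simp only [mem_sigma, HasAntidiagonal.mem_antidiagonal] at h ⊢
    try grind

lemma sum_antidiagonal_middle {W : Type*} [AddCommMonoid W] (n : ℕ) (f : ℕ → ℕ → ℕ → ℕ → W) :
    ∑ p ∈ antidiagonal n, ∑ q ∈ antidiagonal p.1, ∑ r ∈ antidiagonal p.2, f q.1 q.2 r.1 r.2 =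
      ∑ p ∈ antidiagonal n, ∑ q ∈ antidiagonal p.1, ∑ r ∈ antidiagonal p.2,
        f q.1 r.1 q.2 r.2 := by
  simp_rw [sum_sigma']
  refine sum_nbij' (fun x => ⟨(x.2.1.1 + x.2.2.1, x.2.1.2 + x.2.2.2), ⟨(x.2.1.1, x.2.2.1),
    (x.2.1.2, x.2.2.2)⟩⟩) (fun x => ⟨(x.2.1.1 + x.2.2.1, x.2.1.2 + x.2.2.2),
    ⟨(x.2.1.1, x.2.2.1), (x.2.1.2, x.2.2.2)⟩⟩) ?_ ?_ ?_ ?_ ?_ <;>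
  · rintro ⟨⟨a, b⟩, ⟨⟨c, d⟩, ⟨e, g⟩⟩⟩ h
    simp only [mem_sigma, HasAntidiagonal.mem_antidiagonal] at h ⊢
    try grind

/-- The action of a formal series of operators on formal series. -/
noncomputable def formalAct {U : Type*} [CommRing U] [Algebra ℂ U] (Y : (Module.End ℂ U)⟦X⟧)
    (F : U⟦X⟧) : U⟦X⟧ :=
  PowerSeries.mk fun n => ∑ p ∈ antidiagonal n, (PowerSeries.coeff p.1 Y) (PowerSeries.coeff p.2 F)

section

variable {U : Type*} [CommRing U] [Algebra ℂ U]

lemma formalAct_mul (Y Z : (Module.End ℂ U)⟦X⟧) (F : U⟦X⟧) :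
    formalAct (Y * Z) F = formalAct Y (formalAct Z F) := by
  ext n
  simp only [formalAct, PowerSeries.coeff_mk, PowerSeries.coeff_mul, LinearMap.sum_apply,
    Module.End.mul_apply, map_sum]
  exact sum_antidiagonal_assoc n fun a b c =>
    (PowerSeries.coeff a Y) ((PowerSeries.coeff b Z) (PowerSeries.coeff c F))

lemma coeff_formalAct_C (Y : (Module.End ℂ U)⟦X⟧) (n : ℕ) (f : U) :
    PowerSeries.coeff n (formalAct Y (PowerSeries.C f)) = PowerSeries.coeff n Y f := by
  rw [formalAct, PowerSeries.coeff_mk, sum_eq_single (n, 0)]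
  · simp
  · rintro ⟨a, b⟩ h hne
    have : b ≠ 0 := by
      rintro rfl
      simp_all
    simp [PowerSeries.coeff_C, this]
  · simp

lemma eq_of_formalAct {Y Z : (Module.End ℂ U)⟦X⟧} (h : ∀ F, formalAct Y F = formalAct Z F) :
    Y = Z := by
  ext n f
  rw [← coeff_formalAct_C, h, coeff_formalAct_C]

lemma formalAct_formalLin (B : ℕ → U →ₗ[ℂ] U →ₗ[ℂ] U) (F G : U⟦X⟧) :
    formalAct (formalLin B F) G = formalBilin B F G := by
  ext n
  simp only [formalAct, formalLin, formalBilin, PowerSeries.coeff_mk, LinearMap.sum_apply]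
  exact sum_antidiagonal_assoc n fun a b c =>
    (B a (PowerSeries.coeff b F)) (PowerSeries.coeff c G)

lemma formalBilin_flip (B : ℕ → U →ₗ[ℂ] U →ₗ[ℂ] U) (F G : U⟦X⟧) :
    formalBilin (fun r => (B r).flip) F G = formalBilin B G F := by
  ext n
  simp only [formalBilin, PowerSeries.coeff_mk, LinearMap.flip_apply]
  refine sum_congr rfl fun p _ => ?_
  rw [← Finset.Nat.sum_antidiagonal_swap]
  rfl

lemma coeff_formalLin_C {W : Type*} [Semiring W] [Module ℂ W] (T : ℕ → U →ₗ[ℂ] W) (n : ℕ) (f : U) :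
    PowerSeries.coeff n (formalLin T (PowerSeries.C f)) = T n f := by
  rw [formalLin, PowerSeries.coeff_mk, sum_eq_single (n, 0)]
  · simp
  · rintro ⟨a, b⟩ h hne
    have : b ≠ 0 := by
      rintro rfl
      simp_all
    simp [PowerSeries.coeff_C, this]
  · simp

lemma coeff_formalBilin_C (B : ℕ → U →ₗ[ℂ] U →ₗ[ℂ] U) (n : ℕ) (f g : U) :
    PowerSeries.coeff n (formalBilin B (PowerSeries.C f) (PowerSeries.C g)) = B n f g := by
  rw [← formalAct_formalLin, coeff_formalAct_C, coeff_formalLin_C]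

lemma formalLin_add {W : Type*} [Semiring W] [Module ℂ W] (T : ℕ → U →ₗ[ℂ] W) (F G : U⟦X⟧) :
    formalLin T (F + G) = formalLin T F + formalLin T G := by
  ext n
  simp [formalLin, sum_add_distrib]

end

end Formal

/-! ### The operators of left and right multiplication -/

section Star

variable {E : Type*} [NormedAddCommGroup E] [NormedSpace ℝ E] [FiniteDimensional ℝ E]
  {M : Type*} [TopologicalSpace M] [ChartedSpace E M] {Ω : SymplecticForm E M}
  {C : ℕ → Fn E M →ₗ[ℂ] Fn E M →ₗ[ℂ] Fn E M}

lemma formalAct_opL (f h : (Fn E M)⟦X⟧) : formalAct (opL C f) h = formalBilin C f h :=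
  formalAct_formalLin C f h

lemma formalAct_opR (g h : (Fn E M)⟦X⟧) : formalAct (opR C g) h = formalBilin C h g := by
  rw [opR, formalAct_formalLin, formalBilin_flip]

lemma IsStarProduct.opL_mul (hC : IsStarProduct Ω C) (f g : (Fn E M)⟦X⟧) :
    opL C (formalBilin C f g) = opL C f * opL C g :=
  eq_of_formalAct fun F => by
    rw [formalAct_mul]
    simp only [formalAct_opL]
    exact hC.assoc f g F

lemma IsStarProduct.opR_mul (hC : IsStarProduct Ω C) (f g : (Fn E M)⟦X⟧) :
    opR C (formalBilin C f g) = opR C g * opR C f :=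
  eq_of_formalAct fun F => by
    rw [formalAct_mul]
    simp only [formalAct_opR]
    exact (hC.assoc F f g).symm

lemma IsStarProduct.opR_opL (hC : IsStarProduct Ω C) (f g : (Fn E M)⟦X⟧) :
    opR C g * opL C f = opL C f * opR C g :=
  eq_of_formalAct fun F => by
    rw [formalAct_mul, formalAct_mul]
    simp only [formalAct_opR, formalAct_opL]
    exact hC.assoc f F g

lemma IsStarProduct.opL_one (hC : IsStarProduct Ω C) : opL C 1 = 1 :=
  eq_of_formalAct fun F => by
    rw [formalAct_opL, hC.one_mul]
    ext1 n
    rw [formalAct, PowerSeries.coeff_mk, sum_eq_single (0, n)]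
    · simp
    · rintro ⟨a, b⟩ h hne
      have : a ≠ 0 := by
        rintro rfl
        simp_all
      simp [PowerSeries.coeff_one, this]
    · simp

lemma IsStarProduct.opR_one (hC : IsStarProduct Ω C) : opR C 1 = 1 :=
  eq_of_formalAct fun F => by
    rw [formalAct_opR, hC.mul_one, ← hC.opL_one, formalAct_opL, hC.one_mul]

lemma IsStarProduct.apply_one_right (hC : IsStarProduct Ω C) {r : ℕ} (hr : r ≠ 0) (f : Fn E M) :
    C r f 1 = 0 := by
  have h := congrArg (PowerSeries.coeff r) (hC.mul_one (PowerSeries.C f))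
  rw [show (1 : (Fn E M)⟦X⟧) = PowerSeries.C 1 from (map_one _).symm, coeff_formalBilin_C] at h
  rw [h, PowerSeries.coeff_C, if_neg hr]

lemma IsStarProduct.apply_one_left (hC : IsStarProduct Ω C) {r : ℕ} (hr : r ≠ 0) (f : Fn E M) :
    C r 1 f = 0 := by
  have h := congrArg (PowerSeries.coeff r) (hC.one_mul (PowerSeries.C f))
  rw [show (1 : (Fn E M)⟦X⟧) = PowerSeries.C 1 from (map_one _).symm, coeff_formalBilin_C] at h
  rw [h, PowerSeries.coeff_C, if_neg hr]

lemma IsStarProduct.isBidiffOp (hC : IsStarProduct Ω C) (hnat : IsNatural C) (r : ℕ) :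
    IsBidiffOp 𝓘(ℝ, E) r (C r) := by
  rcases Nat.eq_zero_or_pos r with rfl | hr
  · refine ⟨fun f x g hg => ?_, fun g x f hf => ?_⟩
    · have : g.1 x = 0 := by simpa using hg
      simp [hC.zero, this]
    · have : f.1 x = 0 := by simpa using hf
      simp [hC.zero, this]
  · exact hnat r hr

lemma coeff_opL_mul_opR (n : ℕ) (f g : Fn E M) :
    PowerSeries.coeff n (opL C (PowerSeries.C f) * opR C (PowerSeries.C g)) =
      ∑ p ∈ antidiagonal n, C p.1 f * (C p.2).flip g := by
  rw [PowerSeries.coeff_mul]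
  refine sum_congr rfl fun p _ => ?_
  rw [opL, opR, coeff_formalLin_C, coeff_formalLin_C]

/-- The coefficient of `f ⋆ h ⋆ g`, computed with the other bracketing. -/
lemma IsStarProduct.coeff_opL_mul_opR_apply (hC : IsStarProduct Ω C) (n : ℕ) (f g h : Fn E M) :
    PowerSeries.coeff n (opL C (PowerSeries.C f) * opR C (PowerSeries.C g)) h =
      ∑ p ∈ antidiagonal n, C p.1 (C p.2 f h) g := by
  rw [← hC.opR_opL, PowerSeries.coeff_mul, LinearMap.sum_apply]
  refine sum_congr rfl fun p _ => ?_
  rw [opL, opR, coeff_formalLin_C, coeff_formalLin_C]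
  rfl

end Star

end StarProduct

namespace StarProduct

open Filter Topology Finset

set_option linter.unusedSectionVars false

section Existence

variable {E : Type*} [NormedAddCommGroup E] [NormedSpace ℝ E] [FiniteDimensional ℝ E]
  {M : Type*} [TopologicalSpace M] [ChartedSpace E M] [IsManifold 𝓘(ℝ, E) ∞ M] [T2Space M]

/-- Two bilinear maps on functions of two variables that agree on tensors and depend on finite jets
agree. -/
lemma bilin_eq_of_tensor {V : Type*} [AddCommGroup V] [Module ℂ V]
    (L L' : Fn₂ E M →ₗ[ℂ] Fn₂ E M →ₗ[ℂ] V) (z : M × M) (k : ℕ)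
    (hL : ∀ F ∈ pointIdeal₂ E z ^ k, L F = 0) (hL' : ∀ F ∈ pointIdeal₂ E z ^ k, L' F = 0)
    (hR : ∀ F, ∀ G ∈ pointIdeal₂ E z ^ k, L F G = 0)
    (hR' : ∀ F, ∀ G ∈ pointIdeal₂ E z ^ k, L' F G = 0)
    (h : ∀ f g u v, L (tensor f g) (tensor u v) = L' (tensor f g) (tensor u v)) : L = L' :=
  functional_eq_of_tensor L L' z k hL hL' fun f g =>
    functional_eq_of_tensor _ _ z k (hR _) (hR' _) fun u v => h f g u v

/-- The evaluation at a point. -/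
def evalAt {E' : Type*} [NormedAddCommGroup E'] [NormedSpace ℝ E']
    {H' : Type*} [TopologicalSpace H'] {I' : ModelWithCorners ℝ E' H'}
    {P : Type*} [TopologicalSpace P] [ChartedSpace H' P] (w : P) : SmoothFn I' P →ₗ[ℂ] ℂ :=
  ⟨⟨fun f => f.1 w, fun _ _ => rfl⟩, fun _ _ => rfl⟩

@[simp] lemma evalAt_apply {E' : Type*} [NormedAddCommGroup E'] [NormedSpace ℝ E']
    {H' : Type*} [TopologicalSpace H'] {I' : ModelWithCorners ℝ E' H'}
    {P : Type*} [TopologicalSpace P] [ChartedSpace H' P] (w : P) (f : SmoothFn I' P) :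
    evalAt w f = f.1 w := rfl

/-- The external product of two bidifferential operators, the second one with the opposite order of
arguments. -/
lemma exists_external_product {p q : ℕ} {B B' : Fn E M →ₗ[ℂ] Fn E M →ₗ[ℂ] Fn E M}
    (hB : IsBidiffOp 𝓘(ℝ, E) p B) (hB' : IsBidiffOp 𝓘(ℝ, E) q B') :
    ∃ D : Fn₂ E M →ₗ[ℂ] Fn₂ E M →ₗ[ℂ] Fn₂ E M,
      (∀ f g u v, D (tensor f g) (tensor u v) = tensor (B f u) (B' v g)) ∧
      IsBidiffOp (𝓘(ℝ, E).prod 𝓘(ℝ, E)) (p + q) D := by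
  have hid := contMDiff_id (I := 𝓘(ℝ, E).prod 𝓘(ℝ, E)) (n := ∞) (M := M × M)
  choose A hA hA' using fun u v => exists_tensor_extension hid p q
    (tensorₗ.compl₁₂ (B.flip u) (B' v))
    (fun w f hf g => by simp [show (B f u).1 w.1 = 0 from hB.2 u w.1 f hf])
    (fun w f g hg => by simp [show (B' v g).1 w.2 = 0 from hB'.1 v w.2 g hg])
  have huniq : ∀ {k : ℕ} {D D' : Fn₂ E M →ₗ[ℂ] Fn₂ E M}, OrdLTAlong id k D → OrdLTAlong id k D' →
    (∀ f g, D (tensor f g) = D' (tensor f g)) → D = D' := fun h h' => h.eq_of_tensor h'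
  let A' : Fn E M →ₗ[ℂ] Fn E M →ₗ[ℂ] Fn₂ E M →ₗ[ℂ] Fn₂ E M := LinearMap.mk₂ ℂ A
    (fun u u' v => huniq (hA' _ _) (OrdLT.add (hA' u v) (hA' u' v)) fun f g => by
      simp only [hA, LinearMap.add_apply, LinearMap.compl₁₂_apply, map_add, LinearMap.flip_apply])
    (fun c u v => huniq (hA' _ _) (OrdLT.smul (hA' u v) c) fun f g => by
      simp only [hA, LinearMap.smul_apply, LinearMap.compl₁₂_apply, map_smul,
        LinearMap.flip_apply])
    (fun u v v' => huniq (hA' _ _) (OrdLT.add (hA' u v) (hA' u v')) fun f g => by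
      simp only [hA, LinearMap.add_apply, LinearMap.compl₁₂_apply, map_add])
    (fun c u v => huniq (hA' _ _) (OrdLT.smul (hA' u v) c) fun f g => by
      simp only [hA, LinearMap.smul_apply, LinearMap.compl₁₂_apply, map_smul])
  have hA'' : ∀ u v F, A' u v F = A u v F := fun _ _ _ => rfl
  choose D hD hD' using fun F => exists_tensor_extension hid p q
    (A'.compr₂ (LinearMap.applyₗ F))
    (fun w u hu v => by
      have h := functional_eq_of_tensor (evalAt w ∘ₗ A u v) 0 w (p + q + 1)
        (fun F hF => hA' u v w F hF) (fun _ _ => rfl) fun f g => by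
          simp [hA, show (B f u).1 w.1 = 0 from hB.1 f w.1 u hu]
      exact LinearMap.congr_fun h F)
    (fun w u v hv => by
      have h := functional_eq_of_tensor (evalAt w ∘ₗ A u v) 0 w (p + q + 1)
        (fun F hF => hA' u v w F hF) (fun _ _ => rfl) fun f g => by
          simp [hA, show (B' v g).1 w.2 = 0 from hB'.2 g w.2 v hv]
      exact LinearMap.congr_fun h F)
  let D' : Fn₂ E M →ₗ[ℂ] Fn₂ E M →ₗ[ℂ] Fn₂ E M :=
    { toFun := D
      map_add' := fun F G => huniq (hD' _) (OrdLT.add (hD' F) (hD' G)) fun u v => by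
        simp only [hD, LinearMap.add_apply, LinearMap.compr₂_apply, map_add]
      map_smul' := fun c F => huniq (hD' _) (OrdLT.smul (hD' F) c)
        fun u v => by
          simp only [hD, LinearMap.smul_apply, LinearMap.compr₂_apply, map_smul, RingHom.id_apply] }
  refine ⟨D', fun f g u v => ?_, fun F => hD' F, fun G z F hF => ?_⟩
  · show D (tensor f g) (tensor u v) = _
    rw [hD]
    show A u v (tensor f g) = _
    rw [hA]
    rfl
  · have h := functional_eq_of_tensor (evalAt z ∘ₗ D F) 0 z (p + q + 1)
      (fun G hG => hD' F z G hG) (fun _ _ => rfl) fun u v => by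
        simp only [LinearMap.comp_apply, hD, LinearMap.compr₂_apply, LinearMap.zero_apply]
        exact hA' u v z F hF
    exact LinearMap.congr_fun h G

variable {Ω : SymplecticForm E M} {C : ℕ → Fn E M →ₗ[ℂ] Fn E M →ₗ[ℂ] Fn E M}

lemma exists_isTensorOpp (hB : ∀ r, IsBidiffOp 𝓘(ℝ, E) r (C r)) : ∃ D, IsTensorOpp C D := by
  choose Z hZ hZ' using fun p q => exists_external_product (hB p) (hB q)
  refine ⟨fun r => ∑ p ∈ antidiagonal r, Z p.1 p.2, fun r => ⟨fun F => ?_, fun G => ?_⟩,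
    fun r f g u v => ?_⟩
  · rw [LinearMap.sum_apply]
    refine IsDiffOp.sum _ fun p hp => ?_
    rw [← HasAntidiagonal.mem_antidiagonal.1 hp]
    exact (hZ' p.1 p.2).1 F
  · have : (∑ p ∈ antidiagonal r, Z p.1 p.2).flip G =
        ∑ p ∈ antidiagonal r, (Z p.1 p.2).flip G := by
      ext1 F
      simp [LinearMap.sum_apply]
    rw [this]
    refine IsDiffOp.sum _ fun p hp => ?_
    rw [← HasAntidiagonal.mem_antidiagonal.1 hp]
    exact (hZ' p.1 p.2).2 G
  · simp [LinearMap.sum_apply, hZ]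

lemma IsTensorOpp.unique {D D' : ℕ → Fn₂ E M →ₗ[ℂ] Fn₂ E M →ₗ[ℂ] Fn₂ E M}
    (hD : IsTensorOpp C D) (hD' : IsTensorOpp C D') : D = D' := by
  funext r
  ext F G z
  have h := bilin_eq_of_tensor ((D r).compr₂ (evalAt z)) ((D' r).compr₂ (evalAt z)) z (r + 1)
    (fun F hF => LinearMap.ext fun G => (hD.bidiff r).2 G z F hF)
    (fun F hF => LinearMap.ext fun G => (hD'.bidiff r).2 G z F hF)
    (fun F G hG => (hD.bidiff r).1 F z G hG) (fun F G hG => (hD'.bidiff r).1 F z G hG)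
    fun f g u v => by simp [hD.tensor, hD'.tensor]
  exact LinearMap.congr_fun₂ h F G

/-- The diagonal map. -/
def diag (x : M) : M × M := (x, x)

lemma contMDiff_diag : ContMDiff 𝓘(ℝ, E) (𝓘(ℝ, E).prod 𝓘(ℝ, E)) ∞ (diag : M → M × M) :=
  contMDiff_id.prodMk contMDiff_id

/-- `T` is the formal map `F ↦ N_F` on functions of two variables. -/
structure IsOperatorMapFn (C : ℕ → Fn E M →ₗ[ℂ] Fn E M →ₗ[ℂ] Fn E M)
    (T : ℕ → Fn₂ E M →ₗ[ℂ] Module.End ℂ (Fn E M)) : Prop where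
  along : ∀ n h, OrdLTAlong diag (2 * n + 1) ((T n).flip h)
  tensor : ∀ (n : ℕ) (f g : Fn E M), T n (tensor f g) =
    PowerSeries.coeff n (opL C (PowerSeries.C f) * opR C (PowerSeries.C g))

lemma exists_isOperatorMapFn (hC : IsStarProduct Ω C) (hnat : IsNatural C) :
    ∃ T, IsOperatorMapFn C T := by
  have hB := hC.isBidiffOp hnat
  obtain ⟨D, hD⟩ := exists_isTensorOpp hB
  choose Q hQ hQ' using fun i => exists_tensor_extension (contMDiff_diag (E := E) (M := M)) i i (C i)
    (fun w u hu v => (hB i).2 v w u hu) (fun w u v hv => (hB i).1 u w v hv)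
  let T : ℕ → Fn₂ E M →ₗ[ℂ] Module.End ℂ (Fn E M) := fun n =>
    ∑ p ∈ antidiagonal n, ((D p.2).compl₂ (tensorₗ.flip 1)).compr₂ (Q p.1)
  have hT : ∀ n F h, T n F h = ∑ p ∈ antidiagonal n, Q p.1 (D p.2 F (tensor h 1)) := by
    intro n F h
    simp [T, LinearMap.sum_apply]
  refine ⟨T, fun n h x F hF => ?_, fun n f g => ?_⟩
  · rw [LinearMap.flip_apply, hT]
    simp only [AddSubmonoidClass.coe_finsetSum, Finset.sum_apply]
    refine Finset.sum_eq_zero fun p hp => hQ' _ x _ ?_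
    have hp' := HasAntidiagonal.mem_antidiagonal.1 hp
    exact OrdLT.mem_pow ((hD.bidiff p.2).2 (StarProduct.tensor h 1)) _ _
      (Ideal.pow_le_pow_right (by omega) hF)
  · ext1 h
    rw [hT, hC.coeff_opL_mul_opR_apply]
    refine sum_congr rfl fun p _ => ?_
    rw [hD.tensor, Finset.sum_eq_single (p.2, 0), hQ, hC.zero, one_mul]
    · rintro ⟨a, b⟩ h hne
      have : b ≠ 0 := by
        rintro rfl
        simp_all
      rw [hC.apply_one_left this]
      exact map_zero (tensorₗ _)
    · simp

lemma exists_linear_factor {U V W : Type*} [AddCommGroup U] [Module ℂ U] [AddCommGroup V]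
    [Module ℂ V] [AddCommGroup W] [Module ℂ W] (j : U →ₗ[ℂ] V) (hj : Function.Surjective j)
    (f : U →ₗ[ℂ] W) (h : ∀ u, j u = 0 → f u = 0) : ∃ g : V →ₗ[ℂ] W, ∀ u, g (j u) = f u :=
  ⟨(LinearMap.ker j).liftQ f h ∘ₗ (j.quotKerEquivOfSurjective hj).symm.toLinearMap, fun u => by
    have : (j.quotKerEquivOfSurjective hj).symm (j u) = Submodule.Quotient.mk u := by
      rw [LinearEquiv.symm_apply_eq]
      rfl
    simp only [LinearMap.comp_apply, LinearEquiv.coe_coe, this]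
    rfl⟩

variable (E M) in
/-- The jet along the diagonal as a linear map. -/
noncomputable def diagJetₗ : Fn₂ E M →ₗ[ℂ] DiagJets E M :=
  (Ideal.Quotient.mkₐ ℂ (⨅ r : ℕ, diagIdeal E M ^ (r + 1))).toLinearMap

lemma diagJetₗ_apply (F : Fn₂ E M) : diagJetₗ E M F = diagJet F := rfl

lemma diagJetₗ_surjective : Function.Surjective (diagJetₗ E M) := Ideal.Quotient.mk_surjective

lemma diagJetₗ_eq_zero {F : Fn₂ E M} :
    diagJetₗ E M F = 0 ↔ ∀ r : ℕ, F ∈ diagIdeal E M ^ (r + 1) :=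
  Ideal.Quotient.eq_zero_iff_mem.trans (Submodule.mem_iInf _)

lemma IsOperatorMapFn.eq_of_isOperatorMap {T : ℕ → Fn₂ E M →ₗ[ℂ] Module.End ℂ (Fn E M)}
    (hT : IsOperatorMapFn C T) {T' : ℕ → DiagJets E M →ₗ[ℂ] Module.End ℂ (Fn E M)}
    (hT' : IsOperatorMap C T') (n : ℕ) (F : Fn₂ E M) : T' n (diagJet F) = T n F := by
  ext1 h
  obtain ⟨k, hk⟩ := hT'.diff n h
  have h1 : OrdLTAlong diag (k + 1) ((T' n ∘ₗ diagJetₗ E M).flip h) := fun x F hF => hk x F hF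
  refine LinearMap.congr_fun (h1.eq_of_tensor (hT.along n h) fun f g => ?_) F
  show T' n (diagJet (StarProduct.tensor f g)) h = T n (StarProduct.tensor f g) h
  rw [hT'.tensor, hT.tensor]

lemma diagIdeal_pow_le (k : ℕ) (x : M) : diagIdeal E M ^ k ≤ pointIdeal₂ E (x, x) ^ k :=
  Ideal.pow_right_mono (iInf_le _ x) k

lemma exists_isOperatorMap {T : ℕ → Fn₂ E M →ₗ[ℂ] Module.End ℂ (Fn E M)}
    (hT : IsOperatorMapFn C T) : ∃ T', IsOperatorMap C T' := by
  choose T' hT' using fun n => exists_linear_factor (W := Module.End ℂ (Fn E M)) (diagJetₗ E M) diagJetₗ_surjective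
    (T n) fun F hF => by
      ext h x
      exact hT.along n h x F (diagIdeal_pow_le _ x (diagJetₗ_eq_zero.1 hF (2 * n)))
  simp only [diagJetₗ_apply] at hT'
  exact ⟨T', fun n h => ⟨2 * n, fun x F hF => by rw [hT']; exact hT.along n h x F hF⟩,
    fun n f g => by rw [hT', hT.tensor]⟩

lemma exists_isJetProduct {D : ℕ → Fn₂ E M →ₗ[ℂ] Fn₂ E M →ₗ[ℂ] Fn₂ E M}
    (hD : IsTensorOpp C D) : ∃ P, IsJetProduct C P := by
  have hmem : ∀ {r : ℕ} {A : Module.End ℂ (Fn₂ E M)}, OrdLT (r + 1) A → ∀ F,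
      diagJetₗ E M F = 0 → diagJetₗ E M (A F) = 0 := by
    intro r A hA F hF
    rw [diagJetₗ_eq_zero] at hF ⊢
    exact fun k => hA.mem_pow _ _ (hF (r + k))
  choose A hA using fun r F => exists_linear_factor (diagJetₗ E M) diagJetₗ_surjective
    (diagJetₗ E M ∘ₗ D r F) fun G hG => hmem ((hD.bidiff r).1 F) G hG
  have hext : ∀ {f g : DiagJets E M →ₗ[ℂ] DiagJets E M},
      (∀ G, f (diagJetₗ E M G) = g (diagJetₗ E M G)) → f = g := fun h =>
    LinearMap.ext fun G => by
      obtain ⟨G, rfl⟩ := diagJetₗ_surjective G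
      exact h G
  let A' : ∀ r, Fn₂ E M →ₗ[ℂ] DiagJets E M →ₗ[ℂ] DiagJets E M := fun r =>
    { toFun := A r
      map_add' := fun F G => hext fun K => by simp [hA]
      map_smul' := fun c F => hext fun K => by simp [hA] }
  choose P hP using fun r => exists_linear_factor (diagJetₗ E M) diagJetₗ_surjective (A' r)
    fun F hF => hext fun K => by
      show A r F (diagJetₗ E M K) = 0
      rw [hA]
      exact hmem ((hD.bidiff r).2 K) F hF
  refine ⟨P, D, hD, fun r F G => ?_⟩
  rw [← diagJetₗ_apply, ← diagJetₗ_apply, hP]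
  exact hA r F G

end Existence

end StarProduct

namespace StarProduct

open Filter Topology Finset

set_option linter.unusedSectionVars false

/-! ### Multiplicativity of the operator map and its symbol -/

section Symbol

variable {E : Type*} [NormedAddCommGroup E] [NormedSpace ℝ E] [FiniteDimensional ℝ E]
  {M : Type*} [TopologicalSpace M] [ChartedSpace E M] [IsManifold 𝓘(ℝ, E) ∞ M] [T2Space M]
  {Ω : SymplecticForm E M} {C : ℕ → Fn E M →ₗ[ℂ] Fn E M →ₗ[ℂ] Fn E M}
  {D : ℕ → Fn₂ E M →ₗ[ℂ] Fn₂ E M →ₗ[ℂ] Fn₂ E M}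
  {T : ℕ → Fn₂ E M →ₗ[ℂ] Module.End ℂ (Fn E M)}

lemma IsTensorOpp.zero_apply (hC : IsStarProduct Ω C) (hD : IsTensorOpp C D) (F G : Fn₂ E M) :
    D 0 F G = F * G := by
  ext z
  have h := bilin_eq_of_tensor ((D 0).compr₂ (evalAt z))
    ((LinearMap.mul ℂ (Fn₂ E M)).compr₂ (evalAt z)) z 1
    (fun F hF => LinearMap.ext fun G => (hD.bidiff 0).2 G z F (by simpa using hF))
    (fun F hF => LinearMap.ext fun G => by
      have : F.1 z = 0 := by simpa using hF
      simp [this])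
    (fun F G hG => (hD.bidiff 0).1 F z G (by simpa using hG))
    (fun F G hG => by
      have : G.1 z = 0 := by simpa using hG
      simp [this])
    fun f g u v => by
      simp only [LinearMap.compr₂_apply, hD.tensor, HasAntidiagonal.antidiagonal_zero, sum_singleton, hC.zero,
        LinearMap.mul_apply', tensor_mul_tensor, mul_comm v g]
  exact LinearMap.congr_fun₂ h F G

lemma IsTensorOpp.apply_tensor_one (hC : IsStarProduct Ω C) (hD : IsTensorOpp C D) (r : ℕ)
    (f g a : Fn E M) : D r (StarProduct.tensor f g) (StarProduct.tensor a 1) = StarProduct.tensor (C r f a) g := by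
  rw [hD.tensor, sum_eq_single (r, 0)]
  · simp [hC.zero]
  · rintro ⟨p, q⟩ h hne
    have : q ≠ 0 := by
      rintro rfl
      simp_all
    rw [hC.apply_one_left this]
    exact map_zero (tensorₗ _)
  · simp

lemma IsTensorOpp.tensor_one_apply (hC : IsStarProduct Ω C) (hD : IsTensorOpp C D) (r : ℕ)
    (f g a : Fn E M) : D r (StarProduct.tensor a 1) (StarProduct.tensor f g) = StarProduct.tensor (C r a f) g := by
  rw [hD.tensor, sum_eq_single (r, 0)]
  · simp [hC.zero]
  · rintro ⟨p, q⟩ h hne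
    have : q ≠ 0 := by
      rintro rfl
      simp_all
    rw [hC.apply_one_right this]
    exact map_zero (tensorₗ _)
  · simp

/-- The operator `L_f R_g` for formal functions `f` and `g`. -/
lemma IsOperatorMapFn.coeff_opL_mul_opR (hT : IsOperatorMapFn C T) (f g : (Fn E M)⟦X⟧) (n : ℕ) :
    PowerSeries.coeff n (opL C f * opR C g) = ∑ p ∈ antidiagonal n, ∑ q ∈ antidiagonal p.2,
      T p.1 (StarProduct.tensor (PowerSeries.coeff q.1 f) (PowerSeries.coeff q.2 g)) := by
  have h := sum_antidiagonal_middle n fun a b c d =>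
    C a (PowerSeries.coeff c f) * (C b).flip (PowerSeries.coeff d g)
  rw [PowerSeries.coeff_mul]
  simp only [opL, opR, formalLin, PowerSeries.coeff_mk, sum_mul_sum]
  refine h.symm.trans (sum_congr rfl fun p _ => ?_)
  rw [sum_comm]
  refine sum_congr rfl fun q _ => ?_
  rw [hT.tensor, StarProduct.coeff_opL_mul_opR]

lemma IsOperatorMapFn.ordLT (hC : IsStarProduct Ω C) (hnat : IsNatural C)
    (hT : IsOperatorMapFn C T) (n : ℕ) (F : Fn₂ E M) : OrdLT (n + 1) (T n F) := by
  intro x h hh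
  have hB := hC.isBidiffOp hnat
  have h1 := functional_eq_of_tensor (evalAt x ∘ₗ (T n).flip h) 0 (x, x) (2 * n + 1)
    (fun F hF => hT.along n h x F hF) (fun _ _ => rfl) fun f g => by
      rw [LinearMap.comp_apply, LinearMap.flip_apply, hT.tensor, StarProduct.coeff_opL_mul_opR]
      refine OrdLTAt.sum (k := n + 1) (antidiagonal n) (fun p hp => ?_) h hh
      have hp' := HasAntidiagonal.mem_antidiagonal.1 hp
      exact OrdLTAt.mono (OrdLTAt.mul ((hB p.1).1 f x) ((hB p.2).2 g)) (by omega)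
  exact LinearMap.congr_fun h1 F

lemma IsOperatorMapFn.mul_tensor (hC : IsStarProduct Ω C) (hD : IsTensorOpp C D)
    (hT : IsOperatorMapFn C T) (n : ℕ) (f g u v : Fn E M) :
    ∑ p ∈ antidiagonal n, T p.2 (D p.1 (StarProduct.tensor f g) (StarProduct.tensor u v)) =
      ∑ p ∈ antidiagonal n, T p.1 (StarProduct.tensor f g) * T p.2 (StarProduct.tensor u v) := by
  have h1 : opL C (formalBilin C (PowerSeries.C f) (PowerSeries.C u)) *
      opR C (formalBilin C (PowerSeries.C v) (PowerSeries.C g)) =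
      (opL C (PowerSeries.C f) * opR C (PowerSeries.C g)) *
        (opL C (PowerSeries.C u) * opR C (PowerSeries.C v)) := by
    rw [hC.opL_mul, hC.opR_mul, mul_assoc, mul_assoc, ← mul_assoc (opL C (PowerSeries.C u)),
      ← hC.opR_opL, mul_assoc]
  have h2 := congrArg (PowerSeries.coeff n) h1
  rw [hT.coeff_opL_mul_opR, PowerSeries.coeff_mul] at h2
  simp only [hT.tensor]
  rw [← h2, ← Finset.Nat.sum_antidiagonal_swap]
  refine sum_congr rfl fun p _ => ?_
  rw [Prod.fst_swap, Prod.snd_swap, hD.tensor, map_sum]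
  refine sum_congr rfl fun q _ => ?_
  rw [coeff_formalBilin_C, coeff_formalBilin_C]

/-- The operator map is multiplicative. -/
lemma IsOperatorMapFn.mul (hC : IsStarProduct Ω C) (hnat : IsNatural C) (hD : IsTensorOpp C D)
    (hT : IsOperatorMapFn C T) (n : ℕ) (F G : Fn₂ E M) :
    ∑ p ∈ antidiagonal n, T p.2 (D p.1 F G) = ∑ p ∈ antidiagonal n, T p.1 F * T p.2 G := by
  ext h x
  let L : Fn₂ E M →ₗ[ℂ] Fn₂ E M →ₗ[ℂ] ℂ :=
    ∑ p ∈ antidiagonal n, (D p.1).compr₂ (evalAt x ∘ₗ (T p.2).flip h)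
  let L' : Fn₂ E M →ₗ[ℂ] Fn₂ E M →ₗ[ℂ] ℂ :=
    ∑ p ∈ antidiagonal n, ((T p.1).compl₂ ((T p.2).flip h)).compr₂ (evalAt x)
  have hL : ∀ F G, L F G = ∑ p ∈ antidiagonal n, (T p.2 (D p.1 F G) h).1 x := by
    intro F G
    simp [L, LinearMap.sum_apply]
  have hL' : ∀ F G, L' F G = ∑ p ∈ antidiagonal n, (T p.1 F (T p.2 G h)).1 x := by
    intro F G
    simp [L', LinearMap.sum_apply]
  have key : L = L' := by
    refine bilin_eq_of_tensor L L' (x, x) (3 * n + 1) (fun F hF => LinearMap.ext fun G => ?_)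
      (fun F hF => LinearMap.ext fun G => ?_) (fun F G hG => ?_) (fun F G hG => ?_) ?_
    · rw [hL]
      refine Finset.sum_eq_zero fun p hp => ?_
      have hp' := HasAntidiagonal.mem_antidiagonal.1 hp
      refine hT.along p.2 h x _ (OrdLT.mem_pow ((hD.bidiff p.1).2 G) _ _
        (Ideal.pow_le_pow_right (by omega) hF))
    · rw [hL']
      refine Finset.sum_eq_zero fun p hp => ?_
      have hp' := HasAntidiagonal.mem_antidiagonal.1 hp
      exact hT.along p.1 _ x F (Ideal.pow_le_pow_right (by omega) hF)
    · rw [hL]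
      refine Finset.sum_eq_zero fun p hp => ?_
      have hp' := HasAntidiagonal.mem_antidiagonal.1 hp
      refine hT.along p.2 h x _ (OrdLT.mem_pow ((hD.bidiff p.1).1 F) _ _
        (Ideal.pow_le_pow_right (by omega) hG))
    · rw [hL']
      refine Finset.sum_eq_zero fun p hp => ?_
      have hp' := HasAntidiagonal.mem_antidiagonal.1 hp
      refine hT.ordLT hC hnat p.1 F x _ ?_
      exact OrdLTAlong.mem_pow contMDiff_diag (J := pointIdeal₂ E (x, x)) (fun f hf => hf) (2 * p.2)
        (hT.along p.2 h) (p.1 + 1) G (Ideal.pow_le_pow_right (by omega) hG)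
    · intro f g u v
      have h1 := congrArg (fun A : Module.End ℂ (Fn E M) => (A h).1 x)
        (hT.mul_tensor hC hD n f g u v)
      simp only [LinearMap.sum_apply, AddSubmonoidClass.coe_finsetSum, Finset.sum_apply,
        Module.End.mul_apply] at h1
      rw [hL, hL', h1]
  have h2 := LinearMap.congr_fun₂ key F G
  rw [hL, hL'] at h2
  simpa [LinearMap.sum_apply] using h2

lemma IsOperatorMapFn.zero_apply (hC : IsStarProduct Ω C) (hT : IsOperatorMapFn C T)
    (F : Fn₂ E M) : T 0 F = LinearMap.mulLeft ℂ (pull contMDiff_diag F) := by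
  ext1 h
  have h1 : OrdLTAlong diag 1
      (LinearMap.mulRight ℂ h ∘ₗ (pull (contMDiff_diag (E := E) (M := M))).toLinearMap) := by
    intro x F hF
    have : F.1 (diag x) = 0 := by simpa using hF
    simp [this]
  refine LinearMap.congr_fun (OrdLTAlong.eq_of_tensor (hT.along 0 h) h1 fun f g => ?_) F
  rw [LinearMap.flip_apply, hT.tensor, StarProduct.coeff_opL_mul_opR]
  ext x
  simp only [HasAntidiagonal.antidiagonal_zero, sum_singleton, Module.End.mul_apply, LinearMap.flip_apply,
    hC.zero, Subalgebra.coe_mul, Pi.mul_apply, LinearMap.comp_apply, AlgHom.toLinearMap_apply,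
    LinearMap.mulRight_apply, pull_apply, diag, tensor_apply]
  ring

/-- Up to operators of lower order the operator map is multiplicative for the pointwise product. -/
lemma IsOperatorMapFn.ordLT_mul_sub (hC : IsStarProduct Ω C) (hnat : IsNatural C)
    (hD : IsTensorOpp C D) (hT : IsOperatorMapFn C T) (n : ℕ) (F G : Fn₂ E M) :
    OrdLT n (T n (F * G) - ∑ p ∈ antidiagonal n, T p.1 F * T p.2 G) := by
  have h1 := hT.mul hC hnat hD n F G
  rw [← Finset.add_sum_erase _ _ (show (0, n) ∈ antidiagonal n by simp),
    hD.zero_apply hC] at h1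
  have h2 : T n (F * G) - ∑ p ∈ antidiagonal n, T p.1 F * T p.2 G =
      -∑ p ∈ (antidiagonal n).erase (0, n), T p.2 (D p.1 F G) := by
    rw [← h1]
    simp only
    abel
  rw [h2]
  refine (OrdLT.sum _ fun p hp => (hT.ordLT hC hnat p.2 _).mono ?_).neg
  obtain ⟨hne, hp⟩ := Finset.mem_erase.1 hp
  have hp' := HasAntidiagonal.mem_antidiagonal.1 hp
  have : p.1 ≠ 0 := fun h => hne (Prod.ext h (by simp; omega))
  omega

lemma mem_diagIdeal {F : Fn₂ E M} : F ∈ diagIdeal E M ↔ ∀ x, F.1 (x, x) = 0 := by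
  simp [diagIdeal]

lemma pull_diag_eq_zero {F : Fn₂ E M} (hF : F ∈ diagIdeal E M) : pull contMDiff_diag F = 0 := by
  ext x
  exact mem_diagIdeal.1 hF x

lemma IsOperatorMapFn.ordLT_of_mem_diagIdeal_pow (hC : IsStarProduct Ω C) (hnat : IsNatural C)
    (hD : IsTensorOpp C D) (hT : IsOperatorMapFn C T) (r : ℕ) :
    ∀ F ∈ diagIdeal E M ^ r, ∀ n < r, OrdLT n (T n F) := by
  induction r with
  | zero => intro F _ n hn; omega
  | succ r ih =>
    intro F hF n hn
    rw [pow_succ'] at hF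
    refine Submodule.mul_induction_on hF (fun G hG F hF => ?_) fun F G hF hG => ?_
    · have h1 := hT.ordLT_mul_sub hC hnat hD n G F
      have h2 : OrdLT n (∑ p ∈ antidiagonal n, T p.1 G * T p.2 F) := by
        refine OrdLT.sum _ fun p hp => ?_
        have hp' := HasAntidiagonal.mem_antidiagonal.1 hp
        rcases Nat.eq_zero_or_pos p.1 with h0 | h0
        · rw [h0, hT.zero_apply hC, pull_diag_eq_zero hG]
          simpa using OrdLT.zero
        · rw [← hp']
          exact (hT.ordLT hC hnat p.1 G).mul' (ih F hF p.2 (by omega))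
      exact h1.of_sub h2
    · rw [map_add]
      exact hF.add hG

/-! ### Hamiltonian derivations -/

variable (C) in
/-- The operator `f ↦ {f, a}` on `M`. -/
noncomputable def ham (a : Fn E M) : Module.End ℂ (Fn E M) := (C 1).flip a - C 1 a

lemma ham_apply (a f : Fn E M) : ham C a f = C 1 f a - C 1 a f := rfl

lemma ordLT_ham (hB : IsBidiffOp 𝓘(ℝ, E) 1 (C 1)) (a : Fn E M) : OrdLT 2 (ham C a) :=
  OrdLT.sub (hB.2 a) (hB.1 a)

lemma IsStarProduct.ham_one (hC : IsStarProduct Ω C) (a : Fn E M) : ham C a 1 = 0 := by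
  rw [ham_apply, hC.apply_one_left one_ne_zero, hC.apply_one_right one_ne_zero, sub_zero]

variable (D) in
/-- The operator `f ⊗ g ↦ {f, a} ⊗ g` on `M × M`. -/
noncomputable def ham₂ (a : Fn E M) : Module.End ℂ (Fn₂ E M) :=
  (D 1).flip (tensor a 1) - D 1 (tensor a 1)

lemma IsTensorOpp.ordLT_ham₂ (hD : IsTensorOpp C D) (a : Fn E M) : OrdLT 2 (ham₂ D a) :=
  OrdLT.sub ((hD.bidiff 1).2 _) ((hD.bidiff 1).1 _)

lemma IsTensorOpp.ham₂_tensor (hC : IsStarProduct Ω C) (hD : IsTensorOpp C D) (a f g : Fn E M) :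
    ham₂ D a (StarProduct.tensor f g) = StarProduct.tensor (ham C a f) g := by
  rw [ham₂, LinearMap.sub_apply, LinearMap.flip_apply, hD.apply_tensor_one hC,
    hD.tensor_one_apply hC]
  exact (LinearMap.map_sub₂ tensorₗ _ _ _).symm

lemma IsTensorOpp.ham₂_one (hC : IsStarProduct Ω C) (hD : IsTensorOpp C D) (a : Fn E M) :
    ham₂ D a 1 = 0 := by
  rw [← tensor_one_one, hD.ham₂_tensor hC, hC.ham_one]
  exact LinearMap.map_zero₂ tensorₗ _

/-- The operator of `f ⊗ 1 - 1 ⊗ f` is `-{·, f}` in degree one. -/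
lemma IsOperatorMapFn.one_apply_sub (hC : IsStarProduct Ω C) (hT : IsOperatorMapFn C T)
    (a : Fn E M) : T 1 (StarProduct.tensor a 1 - StarProduct.tensor 1 a) = -ham C a := by
  ext1 h
  rw [map_sub, hT.tensor, hT.tensor, StarProduct.coeff_opL_mul_opR, StarProduct.coeff_opL_mul_opR]
  simp [Finset.Nat.antidiagonal_succ, hC.zero, ham_apply, hC.apply_one_left, hC.apply_one_right]

end Symbol

end StarProduct

namespace StarProduct

open Filter Topology Finset

set_option linter.unusedSectionVars false

/-! ### Coordinates on a symplectic manifold -/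

section Coordinates

variable {E : Type*} [NormedAddCommGroup E] [NormedSpace ℝ E] [FiniteDimensional ℝ E]
  {M : Type*} [TopologicalSpace M] [ChartedSpace E M] [IsManifold 𝓘(ℝ, E) ∞ M] [T2Space M]
  {Ω : SymplecticForm E M} {C : ℕ → Fn E M →ₗ[ℂ] Fn E M →ₗ[ℂ] Fn E M}

lemma mfderiv_coordFn {ι : Type*} [Fintype ι] (b : Module.Basis ι ℝ E) {Ξ : M → E}
    (hΞ : ContMDiff 𝓘(ℝ, E) 𝓘(ℝ, E) ∞ Ξ) (i : ι) (x : M) :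
    (mfderiv 𝓘(ℝ, E) 𝓘(ℝ, ℂ) (coordFn b hΞ i).1 x : E →L[ℝ] ℂ) =
      (Complex.ofRealCLM.comp (b.coord i).toContinuousLinearMap).comp
        (mfderiv 𝓘(ℝ, E) 𝓘(ℝ, E) Ξ x : E →L[ℝ] E) := by
  have h1 : HasMFDerivAt 𝓘(ℝ, E) 𝓘(ℝ, ℂ)
      (Complex.ofRealCLM.comp (b.coord i).toContinuousLinearMap) (Ξ x)
      (Complex.ofRealCLM.comp (b.coord i).toContinuousLinearMap) :=
    (ContinuousLinearMap.hasFDerivAt _).hasMFDerivAt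
  have h2 := (hΞ.mdifferentiable (by simp) x).hasMFDerivAt
  exact (h1.comp x h2).mfderiv

lemma bracket_coordFn {ι : Type*} [Fintype ι] (b : Module.Basis ι ℝ E) {Ξ : M → E}
    (hΞ : ContMDiff 𝓘(ℝ, E) 𝓘(ℝ, E) ∞ Ξ) (i j : ι) (x : M) :
    Ω.bracket (coordFn b hΞ i).1 (coordFn b hΞ j).1 x =
      ((b.coord i ((mfderiv 𝓘(ℝ, E) 𝓘(ℝ, E) Ξ x : E →L[ℝ] E) (Ω.sharp x
        ((b.coord j) ∘ₗ (mfderiv 𝓘(ℝ, E) 𝓘(ℝ, E) Ξ x : E →L[ℝ] E).toLinearMap))) : ℝ) : ℂ) := by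
  have h1 : (Complex.reCLM.comp ((Complex.ofRealCLM.comp (b.coord j).toContinuousLinearMap).comp
      (mfderiv 𝓘(ℝ, E) 𝓘(ℝ, E) Ξ x : E →L[ℝ] E))).toLinearMap =
      (b.coord j) ∘ₗ (mfderiv 𝓘(ℝ, E) 𝓘(ℝ, E) Ξ x : E →L[ℝ] E).toLinearMap := by
    ext v
    rfl
  have h2 : (Complex.imCLM.comp ((Complex.ofRealCLM.comp (b.coord j).toContinuousLinearMap).comp
      (mfderiv 𝓘(ℝ, E) 𝓘(ℝ, E) Ξ x : E →L[ℝ] E))).toLinearMap = 0 := by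
    ext v
    rfl
  have h3 : ∀ (df dg : E →L[ℝ] ℂ), mfderiv 𝓘(ℝ, E) 𝓘(ℝ, ℂ) (coordFn b hΞ i).1 x = df →
      mfderiv 𝓘(ℝ, E) 𝓘(ℝ, ℂ) (coordFn b hΞ j).1 x = dg →
      Ω.bracket (coordFn b hΞ i).1 (coordFn b hΞ j).1 x =
        df (Ω.sharp x (Complex.reCLM.comp dg).toLinearMap) +
          Complex.I * df (Ω.sharp x (Complex.imCLM.comp dg).toLinearMap) := by
    rintro df dg rfl rfl
    rfl
  have h4 : ∀ (df : E →L[ℝ] ℂ) (α β : Module.Dual ℝ E), β = 0 →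
      df (Ω.sharp x α) + Complex.I * df (Ω.sharp x β) = df (Ω.sharp x α) := by
    rintro df α β rfl
    have h5 : Ω.sharp x (0 : Module.Dual ℝ E) = 0 := map_zero (Ω.sharp x)
    have h6 : df (Ω.sharp x (0 : Module.Dual ℝ E)) = 0 := (congrArg df h5).trans (map_zero df)
    rw [h6, mul_zero, add_zero]
  refine (h3 _ _ (mfderiv_coordFn b hΞ i x) (mfderiv_coordFn b hΞ j x)).trans
    ((h4 _ _ _ h2).trans ?_)
  exact congrArg (fun α : Module.Dual ℝ E => ((Complex.ofRealCLM.comp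
    (b.coord i).toContinuousLinearMap).comp (mfderiv 𝓘(ℝ, E) 𝓘(ℝ, E) Ξ x : E →L[ℝ] E))
      (Ω.sharp x α)) h1

lemma det_bracket_coordFn_ne_zero {ι : Type*} [Fintype ι] [DecidableEq ι] (b : Module.Basis ι ℝ E)
    {Ξ : M → E} (hΞ : ContMDiff 𝓘(ℝ, E) 𝓘(ℝ, E) ∞ Ξ) {x : M}
    (hΞx : Ξ =ᶠ[𝓝 x] extChartAt 𝓘(ℝ, E) x) :
    (Matrix.of fun i j => Ω.bracket (coordFn b hΞ i).1 (coordFn b hΞ j).1 x).det ≠ 0 := by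
  set φ : E →L[ℝ] E := mfderiv 𝓘(ℝ, E) 𝓘(ℝ, E) Ξ x with hφ
  have hinv : φ.IsInvertible := by
    have h := isInvertible_mfderiv_extChartAt (I := 𝓘(ℝ, E)) (mem_extChartAt_source (I := 𝓘(ℝ, E)) x)
    rwa [← hΞx.mfderiv_eq] at h
  obtain ⟨e, he⟩ := hinv
  let W : Matrix ι ι ℝ := Matrix.of fun i j =>
    b.coord i (φ (Ω.sharp x ((b.coord j) ∘ₗ φ.toLinearMap)))
  have hW : (Matrix.of fun i j => Ω.bracket (coordFn b hΞ i).1 (coordFn b hΞ j).1 x) =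
      W.map (Complex.ofRealHom) := by
    ext i j
    exact bracket_coordFn b hΞ i j x
  have hdet : (W.map Complex.ofRealHom).det = ((W.det : ℝ) : ℂ) :=
    (RingHom.map_det Complex.ofRealHom W).symm
  rw [hW, hdet]
  refine fun h0 => ?_
  obtain ⟨v, hv0, hv⟩ := Matrix.exists_mulVec_eq_zero_iff.mpr (Complex.ofReal_eq_zero.mp h0)
  let α : Module.Dual ℝ E := (∑ k, v k • b.coord k) ∘ₗ φ.toLinearMap
  have hα : α = ∑ k, v k • ((b.coord k) ∘ₗ φ.toLinearMap) := by
    ext u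
    simp [α]
  let S : Module.Dual ℝ E ≃ₗ[ℝ] E := Ω.sharp x
  have h1 : φ (S α) = 0 := by
    refine b.ext_elem fun i => ?_
    have h2 := congrFun hv i
    rw [Matrix.mulVec, dotProduct] at h2
    rw [hα, map_sum, map_sum]
    simp only [map_smul, map_sum, map_zero, Finsupp.coe_finsetSum, Finset.sum_apply,
      Finsupp.coe_smul, Pi.smul_apply, smul_eq_mul, Finsupp.coe_zero, Pi.zero_apply]
    simp only [Pi.zero_apply] at h2
    rw [← h2]
    exact Finset.sum_congr rfl fun k _ => mul_comm _ _
  have h2 : S α = 0 := by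
    rw [← he] at h1
    exact e.map_eq_zero_iff.mp h1
  have h3 : α = 0 := S.map_eq_zero_iff.mp h2
  refine hv0 (funext fun i => ?_)
  have h4 := LinearMap.congr_fun h3 (e.symm (b i))
  have h5 : φ (e.symm (b i)) = b i := by rw [← he]; exact e.apply_symm_apply _
  simp only [α, LinearMap.comp_apply, ContinuousLinearMap.coe_coe, h5] at h4
  simpa [Finsupp.single_apply] using h4

/-- Coordinates `t_i` near the point `x₀`, and functions `w_ik` which invert the matrix of the
Poisson brackets `{t_j, t_k}`. -/
structure IsCoords (C : ℕ → Fn E M →ₗ[ℂ] Fn E M →ₗ[ℂ] Fn E M) (x₀ : M) {n : ℕ} (t : Fin n → Fn E M)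
    (w : Fin n → Fin n → Fn E M) : Prop where
  inv : ∀ᶠ x in 𝓝 x₀, ∀ i j,
    ∑ k, (w i k).1 x * (ham C (t k) (t j)).1 x = if i = j then 1 else 0
  hadamard : ∀ᶠ y in 𝓝 x₀, ∀ f : Fn E M, ∃ g : Fin n → Fn E M,
    ∀ᶠ z in 𝓝 y, f.1 z = f.1 y + ∑ i, ((t i).1 z - (t i).1 y) * (g i).1 z
  hadamard₂ : ∃ W ∈ 𝓝 (x₀, x₀), ∀ G : Fn₂ E M, ∃ K : Fin n → Fn₂ E M, ∀ z ∈ W,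
    G.1 z = G.1 (z.1, z.1) + ∑ i, ((t i).1 z.2 - (t i).1 z.1) * (K i).1 z

lemma IsCoords.eventually {x₀ : M} {n : ℕ} {t : Fin n → Fn E M} {w : Fin n → Fin n → Fn E M}
    (ht : IsCoords C x₀ t w) : ∀ᶠ x in 𝓝 x₀, IsCoords C x t w := by
  obtain ⟨W, hW, h⟩ := ht.hadamard₂
  have hd : Tendsto (fun x : M => (x, x)) (𝓝 x₀) (𝓝 (x₀, x₀)) :=
    (continuous_id.prodMk continuous_id).tendsto x₀
  filter_upwards [eventually_eventually_nhds.2 ht.inv, eventually_eventually_nhds.2 ht.hadamard,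
    hd.eventually (eventually_eventually_nhds.2 hW)] with x h1 h2 h3
  exact ⟨h1, h2, W, h3, h⟩

lemma IsStarProduct.exists_isCoords_coordFn (hC : IsStarProduct Ω C) {x₀ : M} {Ξ : M → E}
    (hΞ : ContMDiff 𝓘(ℝ, E) 𝓘(ℝ, E) ∞ Ξ) (hΞx : Ξ =ᶠ[𝓝 x₀] extChartAt 𝓘(ℝ, E) x₀)
    (b : Module.Basis (Fin (Module.finrank ℝ E)) ℝ E) :
    ∃ w : Fin _ → Fin _ → Fn E M, IsCoords C x₀ (coordFn b hΞ) w := by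
  let A : Matrix (Fin (Module.finrank ℝ E)) (Fin (Module.finrank ℝ E)) (Fn E M) :=
    Matrix.of fun k j => ham C (coordFn b hΞ k) (coordFn b hΞ j)
  have hev : ∀ x : M, (A.det).1 x = (Matrix.of fun i j =>
      Ω.bracket (coordFn b hΞ i).1 (coordFn b hΞ j).1 x).det := by
    intro x
    let ev : Fn E M →+* ℂ := (Pi.evalRingHom (fun _ : M => ℂ) x).comp
      (SmoothFn 𝓘(ℝ, E) M).val.toRingHom
    refine (RingHom.map_det ev A).trans ?_
    rw [← Matrix.det_transpose]
    congr 1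
    ext i j
    exact hC.one _ _ x
  obtain ⟨u, hu⟩ := exists_eventually_inverse (I := 𝓘(ℝ, E)) (d := A.det) (x := x₀)
    (by rw [hev]; exact det_bracket_coordFn_ne_zero b hΞ hΞx)
  refine ⟨fun i k => u * A.adjugate i k, ?_, ?_, ?_⟩
  · filter_upwards [hu] with x hx i j
    have h1 := congrArg (fun B : Matrix _ _ (Fn E M) => (B i j).1 x) A.adjugate_mul
    simp only [Matrix.mul_apply, Matrix.smul_apply, Matrix.one_apply, smul_eq_mul,
      AddSubmonoidClass.coe_finsetSum, Finset.sum_apply, Subalgebra.coe_mul, Pi.mul_apply] at h1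
    simp only [Subalgebra.coe_mul, Pi.mul_apply, mul_assoc, ← Finset.mul_sum]
    refine (congrArg (u.1 x * ·) h1).trans ?_
    rw [← mul_assoc, hx]
    split_ifs <;> simp
  · exact hadamard_near b x₀ hΞ hΞx
  · obtain ⟨U, hU, V, hV, -, h⟩ := hadamard_coord (I := 𝓘(ℝ, E)) (I' := 𝓘(ℝ, E)) b
      (contMDiff_id (I := 𝓘(ℝ, E))) x₀ hΞ hΞx
    refine ⟨U ×ˢ V, prod_mem_nhds hU hV, fun G => ?_⟩
    obtain ⟨K, hK⟩ := h G
    exact ⟨K, fun z hz => hK z.1 hz.1 z.2 hz.2⟩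

lemma IsStarProduct.exists_isCoords (hC : IsStarProduct Ω C) (x₀ : M) :
    ∃ (n : ℕ) (t : Fin n → Fn E M) (w : Fin n → Fin n → Fn E M), IsCoords C x₀ t w := by
  obtain ⟨Ξ, hΞ, hΞx⟩ := exists_chart_extension 𝓘(ℝ, E) x₀
  exact ⟨_, _, hC.exists_isCoords_coordFn hΞ hΞx (Module.finBasis ℝ E)⟩

end Coordinates

/-! ### Powers of the vanishing ideal of the diagonal -/

section Germs

variable {E : Type*} [NormedAddCommGroup E] [NormedSpace ℝ E] [FiniteDimensional ℝ E]
  {H : Type*} [TopologicalSpace H] {I : ModelWithCorners ℝ E H}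
  {N : Type*} [TopologicalSpace N] [ChartedSpace H N] [IsManifold I ∞ N] [T2Space N]

variable (I) in
/-- The ideal of the functions that vanish near the point `z`. -/
def germIdeal (z : N) : Ideal (SmoothFn I N) where
  carrier := {f | ∀ᶠ y in 𝓝 z, f.1 y = 0}
  add_mem' {f g} hf hg := by
    filter_upwards [hf, hg] with y h1 h2
    simp [h1, h2]
  zero_mem' := Eventually.of_forall fun _ => rfl
  smul_mem' c f hf := by
    filter_upwards [hf] with y h1
    simp [h1]

lemma germIdeal_le_pow (z : N) (k : ℕ) : germIdeal I z ≤ pointIdeal I z ^ k :=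
  fun _ hf => mem_pow_of_eventually_eq_zero hf k

lemma OrdLT.mem_germIdeal {k : ℕ} {D : Module.End ℂ (SmoothFn I N)} (hD : OrdLT k D) {z : N}
    {f : SmoothFn I N} (hf : f ∈ germIdeal I z) : D f ∈ germIdeal I z := by
  have h : ∀ᶠ y in 𝓝 z, ∀ᶠ y' in 𝓝 y, f.1 y' = 0 := eventually_eventually_nhds.2 hf
  filter_upwards [h] with y hy
  exact hD y f (mem_pow_of_eventually_eq_zero hy k)

end Germs

section Diagonal

variable {E : Type*} [NormedAddCommGroup E] [NormedSpace ℝ E] [FiniteDimensional ℝ E]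
  {M : Type*} [TopologicalSpace M] [ChartedSpace E M] [IsManifold 𝓘(ℝ, E) ∞ M] [T2Space M]
  {Ω : SymplecticForm E M} {C : ℕ → Fn E M →ₗ[ℂ] Fn E M →ₗ[ℂ] Fn E M}
  {D : ℕ → Fn₂ E M →ₗ[ℂ] Fn₂ E M →ₗ[ℂ] Fn₂ E M}
  {T : ℕ → Fn₂ E M →ₗ[ℂ] Module.End ℂ (Fn E M)}

variable (E M) in
/-- The functions on `M × M` that vanish to the order `n` along the diagonal. -/
noncomputable def diagVanish (n : ℕ) : Ideal (Fn₂ E M) := ⨅ x : M, pointIdeal₂ E (x, x) ^ n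

lemma mem_diagVanish {n : ℕ} {F : Fn₂ E M} :
    F ∈ diagVanish E M n ↔ ∀ x : M, F ∈ pointIdeal₂ E (x, x) ^ n := Ideal.mem_iInf

lemma diagVanish_anti {m n : ℕ} (h : m ≤ n) : diagVanish E M n ≤ diagVanish E M m :=
  fun _ hF => mem_diagVanish.2 fun x => Ideal.pow_le_pow_right h (mem_diagVanish.1 hF x)

lemma diagVanish_one : diagVanish E M 1 = diagIdeal E M := by
  simp [diagVanish, diagIdeal]

lemma mul_mem_diagVanish {m n : ℕ} {F G : Fn₂ E M} (hF : F ∈ diagVanish E M m)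
    (hG : G ∈ diagVanish E M n) : F * G ∈ diagVanish E M (m + n) :=
  mem_diagVanish.2 fun x => by
    rw [pow_add]
    exact Ideal.mul_mem_mul (mem_diagVanish.1 hF x) (mem_diagVanish.1 hG x)

lemma OrdLT.mem_diagVanish {k j : ℕ} {X : Module.End ℂ (Fn₂ E M)} (hX : OrdLT (k + 1) X)
    {F : Fn₂ E M} (hF : F ∈ diagVanish E M (k + j)) : X F ∈ diagVanish E M j :=
  StarProduct.mem_diagVanish.2 fun x => hX.mem_pow _ _ (StarProduct.mem_diagVanish.1 hF x)

lemma sup_germIdeal_le_pow (x : M) (n : ℕ) :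
    diagIdeal E M ^ n ⊔ germIdeal (𝓘(ℝ, E).prod 𝓘(ℝ, E)) (x, x) ≤ pointIdeal₂ E (x, x) ^ n :=
  sup_le (Ideal.pow_right_mono (iInf_le _ x) n) (germIdeal_le_pow _ n)

/-- The function `f(x) - f(y)`. -/
noncomputable def delta (f : Fn E M) : Fn₂ E M := tensor f 1 - tensor 1 f

lemma delta_apply (f : Fn E M) (z : M × M) : (delta f).1 z = f.1 z.1 - f.1 z.2 := by
  simp [delta, tensor_apply]

lemma delta_mem (f : Fn E M) : delta f ∈ diagIdeal E M :=
  mem_diagIdeal.2 fun x => by simp [delta_apply]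

section Euler

variable {x₀ : M} {n : ℕ} {t : Fin n → Fn E M} {w : Fin n → Fin n → Fn E M}

variable (D t w) in
/-- The vector field dual to the coordinate `t_i` on the first factor of `M × M`. -/
noncomputable def coordField (i : Fin n) : Module.End ℂ (Fn₂ E M) :=
  ∑ k, LinearMap.mulLeft ℂ (tensor (w i k) 1) * ham₂ D (t k)

lemma coordField_apply (i : Fin n) (F : Fn₂ E M) :
    coordField D t w i F = ∑ k, tensor (w i k) 1 * ham₂ D (t k) F := by
  simp [coordField, LinearMap.sum_apply]

lemma ordLT_coordField (hD : IsTensorOpp C D) (i : Fin n) : OrdLT 2 (coordField D t w i) :=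
  OrdLT.sum _ fun k _ => (ordLT_mulLeft _).mul (hD.ordLT_ham₂ (t k))

lemma coordField_one (hC : IsStarProduct Ω C) (hD : IsTensorOpp C D) (i : Fin n) :
    coordField D t w i 1 = 0 := by
  simp [coordField_apply, hD.ham₂_one hC]

lemma coordField_delta (hC : IsStarProduct Ω C) (hD : IsTensorOpp C D) (ht : IsCoords C x₀ t w)
    (i j : Fin n) : ∀ᶠ z in 𝓝 (x₀, x₀),
      (coordField D t w i (delta (t j))).1 z = if i = j then 1 else 0 := by
  have h1 : Tendsto Prod.fst (𝓝 (x₀, x₀)) (𝓝 x₀) := continuous_fst.tendsto (x₀, x₀)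
  filter_upwards [h1.eventually ht.inv] with z hz
  rw [← hz i j, coordField_apply]
  simp only [delta, map_sub, hD.ham₂_tensor hC, hC.ham_one, AddSubmonoidClass.coe_finsetSum,
    Finset.sum_apply, Subalgebra.coe_mul, Pi.mul_apply, AddSubgroupClass.coe_sub, Pi.sub_apply,
    tensor_apply]
  simp

variable (D t w) in
/-- The Euler vector field of the diagonal. -/
noncomputable def eulerField (F : Fn₂ E M) : Fn₂ E M := ∑ i, delta (t i) * coordField D t w i F

lemma eulerField_add (F G : Fn₂ E M) :
    eulerField D t w (F + G) = eulerField D t w F + eulerField D t w G := by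
  simp [eulerField, mul_add, Finset.sum_add_distrib]

lemma eulerField_mul (hC : IsStarProduct Ω C) (hD : IsTensorOpp C D) (F G : Fn₂ E M) :
    eulerField D t w (F * G) = eulerField D t w F * G + F * eulerField D t w G := by
  simp only [eulerField, (ordLT_coordField hD _).leibniz (coordField_one hC hD _), Finset.sum_mul,
    Finset.mul_sum, ← Finset.sum_add_distrib]
  exact Finset.sum_congr rfl fun i _ => by ring

lemma eulerField_sub_mem (hC : IsStarProduct Ω C) (hD : IsTensorOpp C D) (ht : IsCoords C x₀ t w)
    (G : Fn₂ E M) (hG : G ∈ diagIdeal E M) : eulerField D t w G - G ∈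
      diagIdeal E M ^ 2 ⊔ germIdeal (𝓘(ℝ, E).prod 𝓘(ℝ, E)) (x₀, x₀) := by
  obtain ⟨W, hW, hK⟩ := ht.hadamard₂
  obtain ⟨K, hK⟩ := hK G
  replace hK := mem_of_superset hW hK
  set 𝔤 := germIdeal (𝓘(ℝ, E).prod 𝓘(ℝ, E)) (x₀, x₀)
  have hg : G + ∑ j, delta (t j) * K j ∈ 𝔤 := by
    filter_upwards [hK] with z hz
    have h0 : G.1 (z.1, z.1) = 0 := mem_diagIdeal.1 hG z.1
    simp only [Subalgebra.coe_add, Pi.add_apply, AddSubmonoidClass.coe_finsetSum, Finset.sum_apply,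
      Subalgebra.coe_mul, Pi.mul_apply, delta_apply]
    rw [hz, h0, zero_add, ← Finset.sum_add_distrib]
    exact Finset.sum_eq_zero fun i _ => by ring
  have hY : ∀ i, coordField D t w i G + K i ∈ diagIdeal E M ⊔ 𝔤 := by
    intro i
    have h1 := (ordLT_coordField (t := t) (w := w) hD i).mem_germIdeal hg
    rw [map_add, map_sum] at h1
    simp only [(ordLT_coordField hD i).leibniz (coordField_one hC hD i)] at h1
    rw [Finset.sum_add_distrib] at h1
    have h2 : ∑ j, coordField D t w i (delta (t j)) * K j - K i ∈ 𝔤 := by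
      filter_upwards [eventually_all.2 (coordField_delta hC hD ht i)] with z hz
      simp [hz]
    have h3 : ∑ j, delta (t j) * coordField D t w i (K j) ∈ diagIdeal E M :=
      Ideal.sum_mem _ fun j _ => Ideal.mul_mem_right _ _ (delta_mem _)
    have h4 : coordField D t w i G + K i = (coordField D t w i G +
        (∑ j, coordField D t w i (delta (t j)) * K j +
          ∑ j, delta (t j) * coordField D t w i (K j)) -
        (∑ j, coordField D t w i (delta (t j)) * K j - K i)) -
        ∑ j, delta (t j) * coordField D t w i (K j) := by ring
    rw [h4]
    exact Ideal.sub_mem _ (Ideal.mem_sup_right (Ideal.sub_mem _ h1 h2)) (Ideal.mem_sup_left h3)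
  have h5 : eulerField D t w G - G = ∑ i, delta (t i) * (coordField D t w i G + K i) -
      (G + ∑ j, delta (t j) * K j) := by
    simp only [eulerField, mul_add, Finset.sum_add_distrib]
    ring
  rw [h5]
  refine Ideal.sub_mem _ (Ideal.sum_mem _ fun i _ => ?_) (Ideal.mem_sup_right hg)
  have h6 := Ideal.mul_mem_mul (delta_mem (t i)) (hY i)
  rw [Ideal.mul_sup, ← pow_two] at h6
  exact sup_le_sup_left (α := Ideal (Fn₂ E M)) Ideal.mul_le_right _ h6

end Euler

/-- Locally, the functions that vanish to the order `n` along the diagonal are in the power of its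
vanishing ideal. -/
lemma diagVanish_le_sup (hC : IsStarProduct Ω C) (hD : IsTensorOpp C D) (x₀ : M) (n : ℕ) :
    diagVanish E M n ≤ diagIdeal E M ^ n ⊔ germIdeal (𝓘(ℝ, E).prod 𝓘(ℝ, E)) (x₀, x₀) := by
  obtain ⟨d, t, w, ht⟩ := hC.exists_isCoords x₀
  set 𝔤 := germIdeal (𝓘(ℝ, E).prod 𝓘(ℝ, E)) (x₀, x₀)
  induction n with
  | zero => simp
  | succ n ih =>
    rcases Nat.eq_zero_or_pos n with rfl | hn
    · rw [zero_add, diagVanish_one, pow_one]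
      exact le_sup_left
    intro F hF
    obtain ⟨A, hA, g, hg, rfl⟩ := Submodule.mem_sup.1 (ih (diagVanish_anti n.le_succ hF))
    have h1 := (euler_sub_mem (eulerField_add (D := D) (t := t) (w := w)) (eulerField_mul hC hD)
      (eulerField_sub_mem hC hD ht) n A hA).resolve_right hn.ne'
    have h2 : eulerField D t w (A + g) ∈ diagIdeal E M ^ (n + 1) ⊔ 𝔤 := by
      refine Ideal.sum_mem _ fun i _ => ?_
      have h3 : coordField D t w i (A + g) ∈ diagIdeal E M ^ n ⊔ 𝔤 :=
        ih ((ordLT_coordField hD i).mem_diagVanish (by rwa [add_comm] at hF))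
      have h6 := Ideal.mul_mem_mul (delta_mem (t i)) h3
      rw [Ideal.mul_sup, ← pow_succ'] at h6
      exact sup_le_sup_left (α := Ideal (Fn₂ E M)) Ideal.mul_le_right _ h6
    have h3 : eulerField D t w g ∈ 𝔤 := Ideal.sum_mem _ fun i _ =>
      Ideal.mul_mem_left _ _ ((ordLT_coordField hD i).mem_germIdeal hg)
    have h4 : n • (A + g) ∈ diagIdeal E M ^ (n + 1) ⊔ 𝔤 := by
      have : n • (A + g) = eulerField D t w (A + g) - (eulerField D t w A - n • A) -
          (eulerField D t w g - n • g) := by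
        rw [eulerField_add, smul_add]
        abel
      rw [this]
      exact Ideal.sub_mem _ (Ideal.sub_mem _ h2 h1)
        (Ideal.mem_sup_right (Ideal.sub_mem _ h3 (nsmul_mem hg n)))
    have h5 : A + g = algebraMap ℂ (Fn₂ E M) ((n : ℂ)⁻¹) * (n • (A + g)) := by
      rw [← Nat.cast_smul_eq_nsmul ℂ, mul_smul_comm, ← Algebra.smul_def, smul_smul,
        mul_inv_cancel₀ (by exact_mod_cast hn.ne'), one_smul]
    rw [h5]
    exact Ideal.mul_mem_left _ _ h4

lemma IsOperatorMapFn.ordLT_of_mem_diagVanish (hC : IsStarProduct Ω C) (hnat : IsNatural C)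
    (hD : IsTensorOpp C D) (hT : IsOperatorMapFn C T) {n : ℕ} {F : Fn₂ E M}
    (hF : F ∈ diagVanish E M (n + 1)) : OrdLT n (T n F) := by
  intro x f hf
  obtain ⟨A, hA, g, hg, rfl⟩ := Submodule.mem_sup.1 (diagVanish_le_sup hC hD x _ hF)
  have h1 := hT.ordLT_of_mem_diagIdeal_pow hC hnat hD (n + 1) A hA n n.lt_succ_self x f hf
  have h2 : (T n g f).1 x = 0 := hT.along n f x g (germIdeal_le_pow _ _ hg)
  rw [map_add]
  simp [h1, h2]

lemma OrdLT.of_sum_eq {k : ℕ} {ι : Type*} {s : Finset ι} {A B : ι → Module.End ℂ (Fn E M)}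
    {p q : ι} (hp : p ∈ s) (hq : q ∈ s) (h : ∑ i ∈ s, A i = ∑ i ∈ s, B i)
    (hA : ∀ i ∈ s, i ≠ p → OrdLT k (A i)) (hB : ∀ i ∈ s, i ≠ q → OrdLT k (B i)) :
    OrdLT k (A p - B q) := by
  intro x f hf
  have h1 := congrArg (fun X : Module.End ℂ (Fn E M) => (X f).1 x) h
  simp only [LinearMap.sum_apply, AddSubmonoidClass.coe_finsetSum, Finset.sum_apply] at h1
  rw [Finset.sum_eq_single_of_mem p hp fun i hi hne => hA i hi hne x f hf,
    Finset.sum_eq_single_of_mem q hq fun i hi hne => hB i hi hne x f hf] at h1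
  simp [h1]

/-- The commutator of an operator of the map with a function, up to lower order. -/
lemma IsOperatorMapFn.ordLT_ham₂_sub (hC : IsStarProduct Ω C) (hnat : IsNatural C)
    (hD : IsTensorOpp C D) (hT : IsOperatorMapFn C T) {n : ℕ} {F : Fn₂ E M}
    (hF : F ∈ diagVanish E M (n + 1)) (a : Fn E M) :
    OrdLT n (T n (ham₂ D a F) - commMul (T (n + 1) F) a) := by
  have hCa : ∀ k, T k (StarProduct.tensor a 1) = C k a := by
    intro k
    rw [hT.tensor, StarProduct.coeff_opL_mul_opR, sum_eq_single (k, 0)]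
    · ext1 h
      simp [hC.zero]
    · rintro ⟨p, q⟩ h hne
      have : q ≠ 0 := by
        rintro rfl
        simp_all
      ext1 h
      simp [hC.apply_one_right this]
    · simp
  have h1 := hT.mul hC hnat hD (n + 1) F (StarProduct.tensor a 1)
  have h2 := hT.mul hC hnat hD (n + 1) (StarProduct.tensor a 1) F
  rw [← Finset.Nat.sum_antidiagonal_swap (f := fun p => T p.1 (StarProduct.tensor a 1) * T p.2 F)]
    at h2
  have h3 : ∑ p ∈ antidiagonal (n + 1), (T p.2 (D p.1 F (StarProduct.tensor a 1)) -
      T p.2 (D p.1 (StarProduct.tensor a 1) F)) =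
      ∑ p ∈ antidiagonal (n + 1), (T p.1 F * C p.2 a - C p.2 a * T p.1 F) := by
    ext f x
    have h5 := congrArg (fun X : Module.End ℂ (Fn E M) => (X f).1 x) h1
    have h6 := congrArg (fun X : Module.End ℂ (Fn E M) => (X f).1 x) h2
    simp only [LinearMap.sum_apply, AddSubmonoidClass.coe_finsetSum, Finset.sum_apply, hCa,
      Prod.fst_swap, Prod.snd_swap] at h5 h6
    simp only [LinearMap.sum_apply, AddSubmonoidClass.coe_finsetSum, Finset.sum_apply,
      LinearMap.sub_apply, AddSubgroupClass.coe_sub, Pi.sub_apply, Finset.sum_sub_distrib]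
    rw [h5, h6]
  have h4 : (C 0 a : Module.End ℂ (Fn E M)) = LinearMap.mulLeft ℂ a :=
    LinearMap.ext fun f => hC.zero a f
  have h8 : T n (ham₂ D a F) = T n (D 1 F (StarProduct.tensor a 1)) -
      T n (D 1 (StarProduct.tensor a 1) F) := by
    rw [ham₂, LinearMap.sub_apply, map_sub, LinearMap.flip_apply]
  rw [h8, commMul, ← h4]
  refine OrdLT.of_sum_eq (p := (1, n)) (q := (n + 1, 0)) (by simp; omega) (by simp) h3
    (fun p hp hne => ?_) fun p hp hne => ?_
  · have hp' := HasAntidiagonal.mem_antidiagonal.1 hp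
    by_cases hp0 : p.1 = 0
    · rw [hp0, hD.zero_apply hC, hD.zero_apply hC, mul_comm]
      intro x f _
      simp
    · have : p.1 ≠ 1 := fun h => hne (Prod.ext h (by simp; omega))
      exact ((hT.ordLT hC hnat p.2 _).sub (hT.ordLT hC hnat p.2 _)).mono (by omega)
  · have hp' := HasAntidiagonal.mem_antidiagonal.1 hp
    have hp2 : p.2 ≠ 0 := fun h => hne (Prod.ext (by simp; omega) h)
    have h7 : OrdLT p.1 (T p.1 F) :=
      hT.ordLT_of_mem_diagVanish hC hnat hD (diagVanish_anti (by omega) hF)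
    obtain ⟨p1, p2⟩ := p
    cases p1 with
    | zero =>
      rw [h7.eq_zero]
      intro x f _
      simp
    | succ k =>
      exact (OrdLT.commutator h7 ((hC.isBidiffOp hnat p2).1 a)).mono (by simp at hp'; omega)

/-- An operator of lower order than expected comes from a function vanishing to higher order. -/
lemma IsOperatorMapFn.mem_diagVanish_succ (hC : IsStarProduct Ω C) (hnat : IsNatural C)
    (hD : IsTensorOpp C D) (hT : IsOperatorMapFn C T) (n : ℕ) : ∀ {F : Fn₂ E M},
    F ∈ diagVanish E M n → OrdLT n (T n F) → F ∈ diagVanish E M (n + 1) := by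
  induction n with
  | zero =>
    intro F _ h
    rw [zero_add, diagVanish_one]
    refine mem_diagIdeal.2 fun x => ?_
    have h1 := LinearMap.congr_fun h.eq_zero 1
    rw [hT.zero_apply hC, LinearMap.mulLeft_apply, mul_one, LinearMap.zero_apply] at h1
    exact congrArg (fun f : Fn E M => f.1 x) h1
  | succ n ih =>
    intro F hF h
    have h1 : ∀ a, ham₂ D a F ∈ diagVanish E M (n + 1) := fun a =>
      ih ((hD.ordLT_ham₂ a).mem_diagVanish (by rwa [add_comm] at hF))
        ((hT.ordLT_ham₂_sub hC hnat hD hF a).of_sub (h.commMul a))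
    refine mem_diagVanish.2 fun x => ?_
    obtain ⟨d, t, w, ht⟩ := hC.exists_isCoords x
    obtain ⟨A, hA, g, hg, hAg⟩ := Submodule.mem_sup.1 (diagVanish_le_sup hC hD x _ hF)
    have h2 := (euler_sub_mem (eulerField_add (D := D) (t := t) (w := w)) (eulerField_mul hC hD)
      (eulerField_sub_mem hC hD ht) (n + 1) A hA).resolve_right (Nat.succ_ne_zero n)
    have h3 : eulerField D t w F ∈ pointIdeal₂ E (x, x) ^ (n + 2) := by
      refine Ideal.sum_mem _ fun i _ => ?_
      rw [pow_succ']
      refine Ideal.mul_mem_mul (mem_diagIdeal.1 (delta_mem (t i)) x) ?_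
      rw [coordField_apply]
      exact Ideal.sum_mem _ fun k _ => Ideal.mul_mem_left _ _ (mem_diagVanish.1 (h1 (t k)) x)
    have h4 : eulerField D t w g ∈ germIdeal (𝓘(ℝ, E).prod 𝓘(ℝ, E)) (x, x) :=
      Ideal.sum_mem _ fun i _ =>
        Ideal.mul_mem_left _ _ ((ordLT_coordField hD i).mem_germIdeal hg)
    have h5 : (n + 1) • F ∈ pointIdeal₂ E (x, x) ^ (n + 2) := by
      have : (n + 1) • F = eulerField D t w F - (eulerField D t w A - (n + 1) • A) -
          (eulerField D t w g - (n + 1) • g) := by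
        rw [← hAg, eulerField_add, smul_add]
        abel
      rw [this]
      exact Ideal.sub_mem _ (Ideal.sub_mem _ h3 (sup_germIdeal_le_pow x _ h2))
        (germIdeal_le_pow _ _ (Ideal.sub_mem _ h4 (nsmul_mem hg _)))
    have h6 : F = algebraMap ℂ (Fn₂ E M) (((n + 1 : ℕ) : ℂ)⁻¹) * ((n + 1) • F) := by
      rw [← Nat.cast_smul_eq_nsmul ℂ, mul_smul_comm, ← Algebra.smul_def, smul_smul,
        mul_inv_cancel₀ (by exact_mod_cast Nat.succ_ne_zero n), one_smul]
    rw [h6]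
    exact Ideal.mul_mem_left _ _ h5

end Diagonal

end StarProduct

namespace StarProduct

open Filter Topology Finset

set_option linter.unusedSectionVars false

/-! ### Gluing -/

section Gluing

variable {E : Type*} [NormedAddCommGroup E] [NormedSpace ℝ E] [FiniteDimensional ℝ E]
  {H : Type*} [TopologicalSpace H] {I : ModelWithCorners ℝ E H}
  {N : Type*} [TopologicalSpace N] [ChartedSpace H N] [IsManifold I ∞ N] [T2Space N]
  [SigmaCompactSpace N]

/-- A family of functions, one for each point of a manifold, glued by a partition of unity. -/
lemma exists_glue (U : N → Set N) (hU : ∀ z, U z ∈ 𝓝 z) (F : N → SmoothFn I N) :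
    ∃ (G : SmoothFn I N) (ρ : N → SmoothFn I N), (∀ i y, ∃ r : ℝ, 0 ≤ r ∧ (ρ i).1 y = r) ∧
      ∀ z, ∃ s : Finset N, (∀ i ∈ s, z ∈ U i) ∧ (∀ᶠ y in 𝓝 z, ∑ i ∈ s, (ρ i).1 y = 1) ∧
        ∀ᶠ y in 𝓝 z, G.1 y = ∑ i ∈ s, (ρ i).1 y * (F i).1 y := by
  obtain ⟨f, hf⟩ := SmoothPartitionOfUnity.exists_isSubordinate I isClosed_univ
    (fun z => interior (U z)) (fun z => isOpen_interior)
    fun z _ => Set.mem_iUnion.2 ⟨z, mem_interior_iff_mem_nhds.2 (hU z)⟩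
  let ρ : N → SmoothFn I N := fun i => ⟨fun y => (f i y : ℂ),
    (Complex.ofRealCLM.contDiff (n := ∞)).contMDiff.comp (f i).contMDiff⟩
  have hsmul : ∀ i y, f i y • (F i).1 y = (ρ i).1 y * (F i).1 y := fun i y => by
    simp [ρ]
  refine ⟨⟨fun y => ∑ᶠ i, f i y • (F i).1 y,
    f.contMDiff_finsum_smul fun i x _ => ContMDiff.contMDiffAt (F i).2⟩, ρ,
    fun i y => ⟨f i y, f.nonneg i y, rfl⟩, fun z => ⟨f.fintsupport z, fun i hi => ?_, ?_, ?_⟩⟩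
  · exact interior_subset (hf i ((f.mem_fintsupport_iff z i).1 hi))
  · filter_upwards [f.eventually_finsupport_subset z] with y hy
    have h1 := f.sum_finsupport (x₀ := y) (Set.mem_univ _)
    rw [Finset.sum_subset hy fun i _ hi => by simpa using hi] at h1
    simp only [ρ]
    exact_mod_cast h1
  · filter_upwards [f.eventually_finsupport_subset z] with y hy
    show ∑ᶠ i, f i y • (F i).1 y = _
    rw [finsum_eq_sum_of_support_subset]
    · exact Finset.sum_congr rfl fun i _ => hsmul i y
    · intro i hi
      refine hy ((f.mem_finsupport y).2 fun h0 => hi ?_)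
      simp [h0]

end Gluing

section Surjective

variable {E : Type*} [NormedAddCommGroup E] [NormedSpace ℝ E] [FiniteDimensional ℝ E]
  {M : Type*} [TopologicalSpace M] [ChartedSpace E M] [IsManifold 𝓘(ℝ, E) ∞ M] [T2Space M]
  {Ω : SymplecticForm E M} {C : ℕ → Fn E M →ₗ[ℂ] Fn E M →ₗ[ℂ] Fn E M}
  {D : ℕ → Fn₂ E M →ₗ[ℂ] Fn₂ E M →ₗ[ℂ] Fn₂ E M}
  {T : ℕ → Fn₂ E M →ₗ[ℂ] Module.End ℂ (Fn E M)}

/-- A family of functions on `M × M`, given near the points of the diagonal, glued by a partition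
of unity. -/
lemma exists_glue_diag [SigmaCompactSpace M] (U : M → Set M) (hU : ∀ x, U x ∈ 𝓝 x)
    (F : M → Fn₂ E M) : ∃ (G : Fn₂ E M) (ρ : M → Fn₂ E M), ∀ x, ∃ s : Finset M,
      (∀ i ∈ s, x ∈ U i) ∧ (∀ᶠ z in 𝓝 (x, x), ∑ i ∈ s, (ρ i).1 z = 1) ∧
        ∀ᶠ z in 𝓝 (x, x), G.1 z = ∑ i ∈ s, (ρ i).1 z * (F i).1 z := by
  classical
  obtain ⟨G, ρ, -, h⟩ := exists_glue (I := 𝓘(ℝ, E).prod 𝓘(ℝ, E)) (N := M × M)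
    (fun z => if z.1 = z.2 then U z.1 ×ˢ U z.1 else {y | y.1 ≠ y.2})
    (fun z => by
      split_ifs with hz
      · obtain ⟨x, y⟩ := z
        obtain rfl : x = y := hz
        exact prod_mem_nhds (hU x) (hU x)
      · exact (isOpen_ne_fun continuous_fst continuous_snd).mem_nhds hz)
    fun z => F z.1
  refine ⟨G, fun x => ρ (x, x), fun x => ?_⟩
  obtain ⟨s, hs, h1, h2⟩ := h (x, x)
  have hd : ∀ i ∈ s, i.1 = i.2 ∧ x ∈ U i.1 := by
    intro i hi
    have h3 := hs i hi
    split_ifs at h3 with h4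
    · exact ⟨h4, h3.1⟩
    · exact absurd rfl h3
  have hd' : ∀ i ∈ s, (i.1, i.1) = i := fun i hi => Prod.ext rfl (hd i hi).1
  have hinj : Set.InjOn Prod.fst (s : Set (M × M)) := fun i hi j hj hij => by
    rw [← hd' i hi, ← hd' j hj, hij]
  refine ⟨s.image Prod.fst, fun i hi => ?_, ?_, ?_⟩
  · obtain ⟨j, hj, rfl⟩ := Finset.mem_image.1 hi
    exact (hd j hj).2
  · filter_upwards [h1] with z hz
    rw [Finset.sum_image hinj, ← hz]
    exact Finset.sum_congr rfl fun i hi => by rw [hd' i hi]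
  · filter_upwards [h2] with z hz
    rw [Finset.sum_image hinj, hz]
    exact Finset.sum_congr rfl fun i hi => by rw [hd' i hi]

section Euler

variable {x₀ : M} {d : ℕ} {t : Fin d → Fn E M} {w : Fin d → Fin d → Fn E M}

variable (C t w) in
/-- The vector field dual to the coordinate `t_i`. -/
noncomputable def baseField (i : Fin d) : Module.End ℂ (Fn E M) :=
  ∑ k, LinearMap.mulLeft ℂ (w i k) * ham C (t k)

lemma baseField_apply (i : Fin d) (f : Fn E M) :
    baseField C t w i f = ∑ k, w i k * ham C (t k) f := by
  simp [baseField, LinearMap.sum_apply]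

lemma ordLT_baseField (hB : IsBidiffOp 𝓘(ℝ, E) 1 (C 1)) (i : Fin d) : OrdLT 2 (baseField C t w i) :=
  OrdLT.sum _ fun k _ => (ordLT_mulLeft _).mul (ordLT_ham hB (t k))

lemma baseField_one (hC : IsStarProduct Ω C) (i : Fin d) : baseField C t w i 1 = 0 := by
  simp [baseField_apply, hC.ham_one]

/-- An operator of order `n + 1` is recovered from its commutators with the coordinates, up to
lower order. -/
lemma IsCoords.ordLTAt_sub (hC : IsStarProduct Ω C) (hnat : IsNatural C) (ht : IsCoords C x₀ t w)
    {n : ℕ} {X : Module.End ℂ (Fn E M)} (hX : OrdLT (n + 2) X) : ∀ᶠ x in 𝓝 x₀, OrdLTAt x (n + 1)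
      ((∑ i, commMul X (t i) * baseField C t w i) - ((n : ℂ) + 1) • X) := by
  have hY : ∀ i, OrdLT 2 (baseField C t w i) := ordLT_baseField (hnat 1 le_rfl)
  have hL := fun i => (hY i).leibniz (baseField_one hC i)
  filter_upwards [ht.inv, ht.hadamard] with x hinv hhad f hf
  let θ : Fin d → Fn E M := fun i => t i - (t i).1 x • 1
  have hθ : ∀ i, θ i ∈ pointIdeal 𝓘(ℝ, E) x := fun i => sub_smul_one_mem _ _
  have hYθ : ∀ i j, (baseField C t w i (θ j)).1 x = if i = j then 1 else 0 := by
    intro i j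
    rw [← hinv i j]
    simp [θ, hC.ham_one, baseField_apply]
  let e : Fn E M → Fn E M := fun f => ∑ i, θ i * baseField C t w i f
  have hadd : ∀ a b, e (a + b) = e a + e b := fun a b => by
    simp [e, mul_add, Finset.sum_add_distrib]
  have hmul : ∀ a b, e (a * b) = e a * b + a * e b := fun a b => by
    simp only [e, hL, Finset.sum_mul, Finset.mul_sum, ← Finset.sum_add_distrib]
    exact Finset.sum_congr rfl fun i _ => by ring
  have h1 : ∀ a ∈ pointIdeal 𝓘(ℝ, E) x, e a - a ∈ pointIdeal 𝓘(ℝ, E) x ^ 2 ⊔ ⊥ := by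
    intro a ha
    rw [sup_bot_eq]
    obtain ⟨g, hg⟩ := hhad a
    have hg' : a - ∑ j, θ j * g j ∈ germIdeal 𝓘(ℝ, E) x := by
      filter_upwards [hg] with z hz
      have ha' : a.1 x = 0 := ha
      simp [hz, θ, ha']
    have h2 : ∀ i, baseField C t w i a - g i ∈ pointIdeal 𝓘(ℝ, E) x := by
      intro i
      have h3 : (baseField C t w i (a - ∑ j, θ j * g j)).1 x = 0 :=
        ((hY i).mem_germIdeal hg').self_of_nhds
      have h4 : ∀ j, (θ j).1 x = 0 := hθ
      rw [map_sub, map_sum] at h3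
      simp only [hL] at h3
      simpa [hYθ, h4] using h3
    have h5 : e a - a = ∑ i, θ i * (baseField C t w i a - g i) - (a - ∑ j, θ j * g j) := by
      simp only [e, mul_sub, Finset.sum_sub_distrib]
      ring
    rw [h5]
    refine Ideal.sub_mem _ (Ideal.sum_mem _ fun i _ => ?_) (germIdeal_le_pow _ _ hg')
    rw [pow_two]
    exact Ideal.mul_mem_mul (hθ i) (h2 i)
  have h2 := (euler_sub_mem hadd hmul h1 (n + 1) f hf).resolve_right (Nat.succ_ne_zero n)
  rw [sup_bot_eq] at h2
  have h3 := hX x _ h2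
  rw [map_sub, ← Nat.cast_smul_eq_nsmul ℂ, map_smul] at h3
  have h4 : (X (e f)).1 x = ((∑ i, commMul X (t i) * baseField C t w i) f).1 x := by
    simp only [e, map_sum, LinearMap.sum_apply, AddSubmonoidClass.coe_finsetSum, Finset.sum_apply,
      Module.End.mul_apply, commMul_eval]
    refine Finset.sum_congr rfl fun i _ => ?_
    simp only [θ, Algebra.algebraMap_eq_smul_one]
  have h5 : (X (e f)).1 x - ((n : ℂ) + 1) * (X f).1 x = 0 := by simpa using h3
  rw [h4] at h5
  simpa using h5

end Euler

lemma IsOperatorMapFn.ordLT_mul_sub_of_mem (hC : IsStarProduct Ω C) (hnat : IsNatural C)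
    (hD : IsTensorOpp C D) (hT : IsOperatorMapFn C T) {n : ℕ} (G : Fn₂ E M) {F : Fn₂ E M}
    (hF : F ∈ diagVanish E M n) :
    OrdLT n (T n (G * F) - LinearMap.mulLeft ℂ (pull contMDiff_diag G) * T n F) := by
  intro x f hf
  have h1 := hT.ordLT_mul_sub hC hnat hD n G F x f hf
  have h2 : ((∑ p ∈ antidiagonal n, T p.1 G * T p.2 F) f).1 x =
      ((LinearMap.mulLeft ℂ (pull contMDiff_diag G) * T n F) f).1 x := by
    rw [LinearMap.sum_apply, AddSubmonoidClass.coe_finsetSum, Finset.sum_apply,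
      Finset.sum_eq_single (0, n)]
    · rw [hT.zero_apply hC]
    · intro p hp hne
      have hp' := HasAntidiagonal.mem_antidiagonal.1 hp
      have hp1 : p.1 ≠ 0 := fun h => hne (Prod.ext h (by simp; omega))
      have h3 : OrdLT p.2 (T p.2 F) :=
        hT.ordLT_of_mem_diagVanish hC hnat hD (diagVanish_anti (by omega) hF)
      have h4 := (hT.ordLT hC hnat p.1 G).mul' h3
      rw [hp'] at h4
      exact h4 x f hf
    · simp
  rw [LinearMap.sub_apply, AddSubgroupClass.coe_sub, Pi.sub_apply] at h1 ⊢
  rw [← h2]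
  exact h1

/-- The leading term of a product with a function that vanishes on the diagonal. -/
lemma IsOperatorMapFn.ordLT_succ_mul_sub (hC : IsStarProduct Ω C) (hnat : IsNatural C)
    (hD : IsTensorOpp C D) (hT : IsOperatorMapFn C T) {n : ℕ} {F τ : Fn₂ E M}
    (hF : F ∈ diagVanish E M n) (hτ : τ ∈ diagIdeal E M) :
    OrdLT (n + 1) (T (n + 1) (F * τ) - T n F * T 1 τ) := by
  intro x f hf
  have h1 := hT.ordLT_mul_sub hC hnat hD (n + 1) F τ x f hf
  have h2 : ((∑ p ∈ antidiagonal (n + 1), T p.1 F * T p.2 τ) f).1 x =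
      ((T n F * T 1 τ) f).1 x := by
    rw [LinearMap.sum_apply, AddSubmonoidClass.coe_finsetSum, Finset.sum_apply,
      Finset.sum_eq_single (n, 1)]
    · intro p hp hne
      have hp' := HasAntidiagonal.mem_antidiagonal.1 hp
      rcases Nat.eq_zero_or_pos p.2 with h0 | h0
      · rw [h0, hT.zero_apply hC, pull_diag_eq_zero hτ]
        simp
      have hp1 : p.2 ≠ 1 := fun h => hne (Prod.ext (by simp; omega) h)
      have h3 : OrdLT p.1 (T p.1 F) :=
        hT.ordLT_of_mem_diagVanish hC hnat hD (diagVanish_anti (by omega) hF)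
      have h4 := h3.mul (hT.ordLT hC hnat p.2 τ)
      rw [hp'] at h4
      exact h4 x f hf
    · simp
  rw [LinearMap.sub_apply, AddSubgroupClass.coe_sub, Pi.sub_apply] at h1 ⊢
  rw [← h2]
  exact h1

lemma IsOperatorMapFn.ordLT_one_sub_baseField (hC : IsStarProduct Ω C) (hnat : IsNatural C)
    (hD : IsTensorOpp C D) (hT : IsOperatorMapFn C T) {d : ℕ} (t : Fin d → Fn E M)
    (w : Fin d → Fin d → Fn E M) (i : Fin d) :
    OrdLT 1 (T 1 (-∑ k, StarProduct.tensor (w i k) 1 * delta (t k)) - baseField C t w i) := by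
  intro x f hf
  have h1 : ∀ k, OrdLT 1 (T 1 (StarProduct.tensor (w i k) 1 * delta (t k)) -
      LinearMap.mulLeft ℂ (w i k) * -ham C (t k)) := by
    intro k
    have h2 := hT.ordLT_mul_sub_of_mem hC hnat hD (StarProduct.tensor (w i k) 1)
      (show delta (t k) ∈ diagVanish E M 1 by rw [diagVanish_one]; exact delta_mem _)
    have h3 : pull contMDiff_diag (StarProduct.tensor (w i k) 1) = w i k := by
      ext y
      simp [diag, tensor_apply]
    rwa [h3, delta, hT.one_apply_sub hC] at h2
  have h4 := OrdLT.sum (k := 1) Finset.univ (fun k _ => h1 k) x f hf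
  simp only [LinearMap.sum_apply, LinearMap.sub_apply, AddSubmonoidClass.coe_finsetSum,
    Finset.sum_apply, AddSubgroupClass.coe_sub, Pi.sub_apply, Module.End.mul_apply,
    LinearMap.neg_apply, map_neg, NegMemClass.coe_neg, Pi.neg_apply, sub_neg_eq_add,
    Finset.sum_add_distrib, LinearMap.mulLeft_apply, map_sum, baseField_apply] at h4 ⊢
  rw [← neg_eq_zero, ← h4]
  simp only [Subalgebra.coe_add, AddSubmonoidClass.coe_finsetSum, Pi.add_apply, Finset.sum_apply]
  ring

/-- Every operator of order at most `n` is, up to lower order, the operator of a function that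
vanishes to the order `n` along the diagonal. -/
lemma IsOperatorMapFn.exists_ordLT_sub [SigmaCompactSpace M] (hC : IsStarProduct Ω C)
    (hnat : IsNatural C) (hD : IsTensorOpp C D) (hT : IsOperatorMapFn C T) (n : ℕ) :
    ∀ {X : Module.End ℂ (Fn E M)}, OrdLT (n + 1) X →
      ∃ F ∈ diagVanish E M n, OrdLT n (T n F - X) := by
  induction n with
  | zero =>
    intro X hX
    refine ⟨StarProduct.tensor (X 1) 1, mem_diagVanish.2 fun x => by simp, ?_⟩
    have h3 : pull contMDiff_diag (StarProduct.tensor (X 1) 1) = X 1 := by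
      ext y
      simp [diag, tensor_apply]
    rw [hT.zero_apply hC, h3, ← OrdLT.eq_mulLeft hX]
    intro x f _
    simp
  | succ n ih =>
    intro X hX
    have hloc : ∀ x₀ : M, ∃ F ∈ diagVanish E M (n + 1), ∃ U ∈ 𝓝 x₀, ∀ x ∈ U,
        OrdLTAt x (n + 1) (T (n + 1) F - X) := by
      intro x₀
      obtain ⟨d, t, w, ht⟩ := hC.exists_isCoords x₀
      choose F hF hFX using fun i => ih (hX.commMul (t i))
      let τ : Fin d → Fn₂ E M := fun i => -∑ k, StarProduct.tensor (w i k) 1 * delta (t k)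
      have hτ : ∀ i, τ i ∈ diagIdeal E M := fun i =>
        Ideal.neg_mem_iff _ |>.2 (Ideal.sum_mem _ fun k _ => Ideal.mul_mem_left _ _ (delta_mem _))
      have hτ' : ∀ i, τ i ∈ diagVanish E M 1 := fun i => by
        rw [diagVanish_one]
        exact hτ i
      have h1 : ∀ i, OrdLT (n + 1) (T (n + 1) (F i * τ i) -
          commMul X (t i) * baseField C t w i) := by
        intro i
        have h2 := hT.ordLT_succ_mul_sub hC hnat hD (hF i) (hτ i)
        have h3 := (hFX i).mul (ordLT_baseField (t := t) (w := w) (hnat 1 le_rfl) i)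
        have h4 := (hT.ordLT hC hnat n (F i)).mul'
          (hT.ordLT_one_sub_baseField hC hnat hD t w i)
        intro x f hf
        have h5 := h2 x f hf
        have h6 := h3 x f hf
        have h7 := h4 x f hf
        simp only [LinearMap.sub_apply, AddSubgroupClass.coe_sub, Pi.sub_apply,
          Module.End.mul_apply, map_sub] at h5 h6 h7 ⊢
        linear_combination h5 + h6 + h7
      refine ⟨((n : ℂ) + 1)⁻¹ • ∑ i, F i * τ i, ?_, _, ht.ordLTAt_sub hC hnat hX, fun x hx => ?_⟩
      · rw [Algebra.smul_def]
        exact Ideal.mul_mem_left _ _ (Ideal.sum_mem _ fun i _ => mul_mem_diagVanish (hF i) (hτ' i))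
      · intro f hf
        have hn : ((n : ℂ) + 1) ≠ 0 := by exact_mod_cast Nat.succ_ne_zero n
        have h5 := OrdLT.sum Finset.univ (fun i _ => h1 i) x f hf
        have h6 := hx f hf
        simp only [LinearMap.sum_apply, LinearMap.sub_apply, AddSubmonoidClass.coe_finsetSum,
          Finset.sum_apply, AddSubgroupClass.coe_sub, Pi.sub_apply, LinearMap.smul_apply, map_smul,
          map_sum, SetLike.val_smul, Pi.smul_apply, smul_eq_mul, Finset.sum_sub_distrib]
          at h5 h6 ⊢
        rw [sub_eq_zero.1 h5, sub_eq_zero.1 h6]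
        field_simp
        ring
    choose F hF U hU hFU using hloc
    obtain ⟨G, ρ, h⟩ := exists_glue_diag U hU F
    have hG : ∀ x, ∃ s : Finset M, (∀ i ∈ s, x ∈ U i) ∧ (∑ i ∈ s, (ρ i).1 (x, x) = 1) ∧
        G - ∑ i ∈ s, ρ i * F i ∈ germIdeal (𝓘(ℝ, E).prod 𝓘(ℝ, E)) (x, x) := by
      intro x
      obtain ⟨s, hs, h1, h2⟩ := h x
      refine ⟨s, hs, h1.self_of_nhds, ?_⟩
      filter_upwards [h2] with z hz
      simp [hz]
    refine ⟨G, mem_diagVanish.2 fun x => ?_, fun x f hf => ?_⟩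
    · obtain ⟨s, -, -, h2⟩ := hG x
      have h3 := Ideal.add_mem _ (germIdeal_le_pow _ (n + 1) h2) (Ideal.sum_mem _ (t := s) fun i _ =>
        Ideal.mul_mem_left _ (ρ i) (mem_diagVanish.1 (hF i) x))
      rwa [sub_add_cancel] at h3
    · obtain ⟨s, hs, h1, h2⟩ := hG x
      have h3 : (T (n + 1) (G - ∑ i ∈ s, ρ i * F i) f).1 x = 0 :=
        hT.along (n + 1) f x _ (germIdeal_le_pow _ _ h2)
      have h4 : ∀ i ∈ s, (T (n + 1) (ρ i * F i) f).1 x = (ρ i).1 (x, x) * (X f).1 x := by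
        intro i hi
        have h5 := hT.ordLT_mul_sub_of_mem hC hnat hD (ρ i) (hF i) x f hf
        have h6 := hFU i x (hs i hi) f hf
        simp only [LinearMap.sub_apply, AddSubgroupClass.coe_sub, Pi.sub_apply,
          Module.End.mul_apply, LinearMap.mulLeft_apply, Subalgebra.coe_mul, Pi.mul_apply,
          pull_apply] at h5 h6
        rw [sub_eq_zero.1 h5, sub_eq_zero.1 h6]
        rfl
      simp only [map_sub, map_sum, LinearMap.sub_apply, LinearMap.sum_apply,
        AddSubmonoidClass.coe_finsetSum, Finset.sum_apply, AddSubgroupClass.coe_sub,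
        Pi.sub_apply] at h3 ⊢
      rw [Finset.sum_congr rfl h4, ← Finset.sum_mul, h1, one_mul] at h3
      exact h3

end Surjective

end StarProduct

namespace StarProduct

open Filter Topology Finset

set_option linter.unusedSectionVars false

/-! ### Jets of smooth functions on a vector space -/

section VectorSpace

variable {V : Type*} [NormedAddCommGroup V] [NormedSpace ℝ V]

lemma contDiff_smoothFn (g : SmoothFn 𝓘(ℝ, V) V) : ContDiff ℝ ∞ g.1 := contMDiff_iff_contDiff.1 g.2

lemma differentiable_smoothFn (g : SmoothFn 𝓘(ℝ, V) V) : Differentiable ℝ g.1 :=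
  (contDiff_smoothFn g).differentiable (by simp)

/-- The directional derivative. -/
noncomputable def dirDeriv (w : V) : Module.End ℂ (SmoothFn 𝓘(ℝ, V) V) where
  toFun g := ⟨fun x => fderiv ℝ g.1 x w,
    (((contDiff_smoothFn g).fderiv_right (m := ∞) (by simp)).clm_apply contDiff_const).contMDiff⟩
  map_add' f g := by
    ext x
    show fderiv ℝ (f.1 + g.1) x w = _
    rw [fderiv_add (differentiable_smoothFn f x) (differentiable_smoothFn g x)]
    rfl
  map_smul' c g := by
    ext x
    show fderiv ℝ (c • g.1) x w = _
    rw [fderiv_const_smul (differentiable_smoothFn g x)]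
    rfl

lemma dirDeriv_apply (w : V) (g : SmoothFn 𝓘(ℝ, V) V) (x : V) :
    (dirDeriv w g).1 x = fderiv ℝ g.1 x w := rfl

lemma dirDeriv_mul (w : V) (f g : SmoothFn 𝓘(ℝ, V) V) :
    dirDeriv w (f * g) = dirDeriv w f * g + f * dirDeriv w g := by
  ext x
  show fderiv ℝ (f.1 * g.1) x w = fderiv ℝ f.1 x w * g.1 x + f.1 x * fderiv ℝ g.1 x w
  rw [fderiv_mul (differentiable_smoothFn f x) (differentiable_smoothFn g x)]
  simp
  ring

lemma ordLT_dirDeriv (w : V) : OrdLT 2 (dirDeriv w) := by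
  intro x f hf
  rw [pow_two] at hf
  refine Submodule.mul_induction_on hf (fun a ha b hb => ?_) fun a b ha hb => ?_
  · have ha' : a.1 x = 0 := ha
    have hb' : b.1 x = 0 := hb
    simp [dirDeriv_mul, ha', hb']
  · rw [map_add]
    simp [ha, hb]

variable [FiniteDimensional ℝ V]

lemma mem_pow_succ_of_dirDeriv {z : V} {r : ℕ} {g : SmoothFn 𝓘(ℝ, V) V} (h0 : g.1 z = 0)
    (h : ∀ w, dirDeriv w g ∈ pointIdeal 𝓘(ℝ, V) z ^ r) : g ∈ pointIdeal 𝓘(ℝ, V) z ^ (r + 1) := by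
  let b := Module.finBasis ℝ V
  have hid : ContMDiff 𝓘(ℝ, V) 𝓘(ℝ, V) ∞ (id : V → V) := contMDiff_id
  let t := coordFn b hid
  have htd : ∀ i j, (dirDeriv (b i) (t j)).1 z = if i = j then 1 else 0 := by
    intro i j
    have h1 : (t j).1 = Complex.ofRealCLM.comp (b.coord j).toContinuousLinearMap := rfl
    rw [dirDeriv_apply, h1, ContinuousLinearMap.fderiv]
    by_cases hij : i = j <;> simp [hij]
  have had := (hadamard_near b z hid (Eventually.of_forall fun y => by
    rw [extChartAt_model_space_eq_id]; rfl)).self_of_nhds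
  let θ : Fin _ → SmoothFn 𝓘(ℝ, V) V := fun i => t i - (t i).1 z • 1
  have hθ : ∀ i, θ i ∈ pointIdeal 𝓘(ℝ, V) z := fun i => sub_smul_one_mem _ _
  have hone : ∀ w : V, dirDeriv w (1 : SmoothFn 𝓘(ℝ, V) V) = 0 := by
    intro w
    ext x
    show fderiv ℝ (fun _ => (1 : ℂ)) x w = 0
    simp
  have hθd : ∀ i j, (dirDeriv (b i) (θ j)).1 z = if i = j then 1 else 0 := by
    intro i j
    rw [← htd i j]
    simp [θ, hone]
  let e : SmoothFn 𝓘(ℝ, V) V → SmoothFn 𝓘(ℝ, V) V := fun f => ∑ i, θ i * dirDeriv (b i) f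
  have hadd : ∀ a b, e (a + b) = e a + e b := fun a b => by
    simp [e, mul_add, Finset.sum_add_distrib]
  have hmul : ∀ a b, e (a * b) = e a * b + a * e b := fun a b => by
    simp only [e, dirDeriv_mul, Finset.sum_mul, Finset.mul_sum, ← Finset.sum_add_distrib]
    exact Finset.sum_congr rfl fun i _ => by ring
  have h1 : ∀ a ∈ pointIdeal 𝓘(ℝ, V) z, e a - a ∈ pointIdeal 𝓘(ℝ, V) z ^ 2 ⊔ ⊥ := by
    intro a ha
    rw [sup_bot_eq]
    obtain ⟨g, hg⟩ := had a
    have hg' : a - ∑ j, θ j * g j ∈ germIdeal 𝓘(ℝ, V) z := by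
      filter_upwards [hg] with y hy
      have ha' : a.1 z = 0 := ha
      simp [hy, θ, ha', t]
    have h2 : ∀ i, dirDeriv (b i) a - g i ∈ pointIdeal 𝓘(ℝ, V) z := by
      intro i
      have h3 : (dirDeriv (b i) (a - ∑ j, θ j * g j)).1 z = 0 :=
        ((ordLT_dirDeriv (b i)).mem_germIdeal hg').self_of_nhds
      have h4 : ∀ j, (θ j).1 z = 0 := hθ
      rw [map_sub, map_sum] at h3
      simp only [dirDeriv_mul] at h3
      simpa [hθd, h4] using h3
    have h5 : e a - a = ∑ i, θ i * (dirDeriv (b i) a - g i) - (a - ∑ j, θ j * g j) := by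
      simp only [e, mul_sub, Finset.sum_sub_distrib]
      ring
    rw [h5]
    refine Ideal.sub_mem _ (Ideal.sum_mem _ fun i _ => ?_) (germIdeal_le_pow _ _ hg')
    rw [pow_two]
    exact Ideal.mul_mem_mul (hθ i) (h2 i)
  have heg : e g ∈ pointIdeal 𝓘(ℝ, V) z ^ (r + 1) := Ideal.sum_mem _ fun i _ => by
    rw [pow_succ']
    exact Ideal.mul_mem_mul (hθ i) (h (b i))
  have key : ∀ j ≤ r, g ∈ pointIdeal 𝓘(ℝ, V) z ^ (j + 1) := by
    intro j
    induction j with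
    | zero => intro _; simpa using h0
    | succ j ih =>
      intro hj
      have h2 := (euler_sub_mem hadd hmul h1 (j + 1) g (ih (by omega))).resolve_right
        (Nat.succ_ne_zero j)
      rw [sup_bot_eq] at h2
      have h3 := Ideal.sub_mem _ (Ideal.pow_le_pow_right (show j + 2 ≤ r + 1 by omega) heg) h2
      rw [sub_sub_cancel] at h3
      have h6 : g = algebraMap ℂ (SmoothFn 𝓘(ℝ, V) V) (((j + 1 : ℕ) : ℂ)⁻¹) * ((j + 1) • g) := by
        rw [← Nat.cast_smul_eq_nsmul ℂ, mul_smul_comm, ← Algebra.smul_def, smul_smul,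
          mul_inv_cancel₀ (by exact_mod_cast Nat.succ_ne_zero j), one_smul]
      rw [h6]
      exact Ideal.mul_mem_left _ _ h3
  exact key r le_rfl

lemma iteratedFDeriv_dirDeriv (g : SmoothFn 𝓘(ℝ, V) V) (z w : V) (k : ℕ) (m : Fin k → V) :
    iteratedFDeriv ℝ k (dirDeriv w g).1 z m = iteratedFDeriv ℝ (k + 1) g.1 z (Fin.snoc m w) := by
  have h1 : ContDiffAt ℝ ∞ (fderiv ℝ g.1) z :=
    ((contDiff_smoothFn g).fderiv_right (m := ∞) (by simp)).contDiffAt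
  have h2 : (dirDeriv w g).1 = ContinuousLinearMap.apply ℝ ℂ w ∘ fderiv ℝ g.1 := rfl
  rw [h2, ContinuousLinearMap.iteratedFDeriv_comp_left _ h1 (by exact_mod_cast le_top),
    iteratedFDeriv_succ_apply_right]
  simp

/-- A smooth function is in a power of the ideal of a point iff its derivatives vanish there. -/
lemma mem_pow_iff_iteratedFDeriv (z : V) (r : ℕ) : ∀ g : SmoothFn 𝓘(ℝ, V) V,
    g ∈ pointIdeal 𝓘(ℝ, V) z ^ r ↔ ∀ k < r, iteratedFDeriv ℝ k g.1 z = 0 := by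
  induction r with
  | zero => simp
  | succ r ih =>
    intro g
    constructor
    · intro hg k hk
      cases k with
      | zero =>
        have h0 : g.1 z = 0 := by simpa using Ideal.pow_le_pow_right (show 1 ≤ r + 1 by omega) hg
        ext m
        simpa using h0
      | succ k =>
        ext m
        have h1 := (ih (dirDeriv (m (Fin.last k)) g)).1 ((ordLT_dirDeriv _).mem_pow _ r
          (by rwa [add_comm] at hg)) k (by omega)
        have h2 := iteratedFDeriv_dirDeriv g z (m (Fin.last k)) k (Fin.init m)
        rw [Fin.snoc_init_self, h1] at h2
        exact h2.symm
    · intro h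
      refine mem_pow_succ_of_dirDeriv ?_ fun w => (ih _).2 fun k hk => ?_
      · have h1 := congrArg (fun A => A 0) (h 0 (by omega))
        simpa using h1
      · ext m
        rw [iteratedFDeriv_dirDeriv, h (k + 1) (by omega)]
        rfl

end VectorSpace

/-! ### Borel's lemma -/

section Borel

variable {E : Type*} [NormedAddCommGroup E] [NormedSpace ℝ E] [FiniteDimensional ℝ E]

/-- A smooth function `p(a, v)`, homogeneous of degree `s` in `v`, with compact support in `a`. -/
structure IsHomogeneousFn (s : ℕ) (p : SmoothFn 𝓘(ℝ, E × E) (E × E)) : Prop where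
  homogeneous : ∀ (a v : E) (c : ℝ), p.1 (a, c • v) = (c : ℂ) ^ s * p.1 (a, v)
  support : ∃ K : Set E, IsCompact K ∧ ∀ a ∉ K, ∀ v, p.1 (a, v) = 0
  mem : ∀ a : E, p ∈ pointIdeal 𝓘(ℝ, E × E) (a, (0 : E)) ^ s

lemma exists_cutoff {s : ℕ} {p : SmoothFn 𝓘(ℝ, E × E) (E × E)} (hp : IsHomogeneousFn s p) :
    ∃ f : SmoothFn 𝓘(ℝ, E × E) (E × E), (∀ a : E, ∀ᶠ z in 𝓝 (a, (0 : E)), f.1 z = p.1 z) ∧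
      (∀ k, ∃ c, ∀ z, ‖iteratedFDeriv ℝ k f.1 z‖ ≤ c) ∧
      ∀ k < s, ∀ z, ‖iteratedFDeriv ℝ k f.1 z‖ ≤ (1 / 2) ^ s := by
  let χ : ContDiffBump (0 : E) := ⟨1, 2, by norm_num, by norm_num⟩
  let χ' : E → ℂ := fun v => (χ v : ℂ)
  have hχ' : ContDiff ℝ ∞ χ' := Complex.ofRealCLM.contDiff.comp χ.contDiff
  let ψ : E × E → ℂ := fun z => p.1 z * χ' z.2
  have hψ : ContDiff ℝ ∞ ψ := (contDiff_smoothFn p).mul (hχ'.comp contDiff_snd)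
  have hψc : HasCompactSupport ψ := by
    obtain ⟨K, hK, hpK⟩ := hp.support
    refine HasCompactSupport.intro (hK.prod (isCompact_closedBall (0 : E) 2)) fun z hz => ?_
    by_cases h : z.1 ∈ K
    · have h2 : z.2 ∉ Metric.closedBall (0 : E) 2 := fun h2 => hz ⟨h, h2⟩
      have h3 : χ z.2 = 0 := by
        rw [Metric.mem_closedBall, not_le] at h2
        exact χ.zero_of_le_dist h2.le
      simp [ψ, χ', h3]
    · simp [ψ, hpK z.1 h z.2]
  have hbd : ∀ k, ∃ c, ∀ z, ‖iteratedFDeriv ℝ k ψ z‖ ≤ c := fun k =>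
    (hψ.continuous_iteratedFDeriv (by exact_mod_cast le_top)).bounded_above_of_compact_support
      (hψc.iteratedFDeriv k)
  choose c hc using hbd
  have hc0 : ∀ k, 0 ≤ c k := fun k => (norm_nonneg _).trans (hc k 0)
  let B := ∑ k ∈ range s, c k
  have hB0 : 0 ≤ B := Finset.sum_nonneg fun k _ => hc0 k
  let ε : ℝ := (1 / 2) ^ s / (1 + B)
  have hε : 0 < ε := by positivity
  have hε1 : ε ≤ 1 := by
    rw [div_le_one (by positivity)]
    calc ((1 : ℝ) / 2) ^ s ≤ 1 := pow_le_one₀ (by norm_num) (by norm_num)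
      _ ≤ 1 + B := by linarith
  have hεB : ε * B ≤ (1 / 2) ^ s := by
    rw [div_mul_eq_mul_div, div_le_iff₀ (by positivity)]
    have : (0 : ℝ) ≤ (1 / 2) ^ s := by positivity
    nlinarith
  let A : E × E →L[ℝ] E × E :=
    (ContinuousLinearMap.fst ℝ E E).prod (ε⁻¹ • ContinuousLinearMap.snd ℝ E E)
  have hε1' : 1 ≤ ε⁻¹ := (one_le_inv₀ hε).2 hε1
  have hA : ‖A‖ ≤ ε⁻¹ := by
    refine ContinuousLinearMap.opNorm_le_bound _ (by positivity) fun z => ?_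
    refine max_le ?_ ?_
    · calc ‖z.1‖ ≤ ‖z‖ := norm_fst_le z
        _ ≤ ε⁻¹ * ‖z‖ := le_mul_of_one_le_left (norm_nonneg _) hε1'
    · show ‖ε⁻¹ • z.2‖ ≤ _
      rw [norm_smul, Real.norm_of_nonneg (by positivity)]
      gcongr
      exact norm_snd_le z
  let f : E × E → ℂ := ((ε : ℂ) ^ s) • (ψ ∘ A)
  have hfd : ∀ k z, ‖iteratedFDeriv ℝ k f z‖ ≤ ε ^ s * (c k * ε⁻¹ ^ k) := by
    intro k z
    have h1 : ContDiff ℝ ∞ (ψ ∘ A) := hψ.comp A.contDiff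
    have h2 : iteratedFDeriv ℝ k f z = ((ε : ℂ) ^ s) • iteratedFDeriv ℝ k (ψ ∘ A) z :=
      iteratedFDeriv_const_smul_apply (h1.of_le (by exact_mod_cast le_top)).contDiffAt
    rw [h2, norm_smul, norm_pow, Complex.norm_real, Real.norm_of_nonneg hε.le,
      A.iteratedFDeriv_comp_right hψ z (by exact_mod_cast le_top)]
    gcongr
    refine (ContinuousMultilinearMap.norm_compContinuousLinearMap_le _ _).trans ?_
    rw [Finset.prod_const, Finset.card_univ, Fintype.card_fin]
    gcongr
    · exact hc0 k
    · exact hc k _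
  have hf : ∀ z, f z = p.1 z * χ' (ε⁻¹ • z.2) := by
    intro z
    show (ε : ℂ) ^ s * (p.1 (z.1, ε⁻¹ • z.2) * χ' (ε⁻¹ • z.2)) = _
    rw [hp.homogeneous, ← mul_assoc, ← mul_assoc, ← mul_pow, ← Complex.ofReal_mul,
      mul_inv_cancel₀ hε.ne']
    simp
  refine ⟨⟨f, ContDiff.contMDiff
    (show ContDiff ℝ ∞ f from (hψ.comp A.contDiff).const_smul ((ε : ℂ) ^ s))⟩, fun a => ?_,
    fun k => ⟨_, hfd k⟩, fun k hk z => ?_⟩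
  · have h1 : Tendsto (fun z : E × E => ε⁻¹ • z.2) (𝓝 (a, 0)) (𝓝 0) := by
      have : Continuous (fun z : E × E => ε⁻¹ • z.2) := continuous_snd.const_smul _
      simpa using this.tendsto (a, 0)
    filter_upwards [h1.eventually χ.eventuallyEq_one] with z hz
    show f z = p.1 z
    rw [hf]
    simp only [χ']
    rw [show χ (ε⁻¹ • z.2) = 1 from hz]
    simp
  · refine (hfd k z).trans (le_trans ?_ hεB)
    have h1 : c k ≤ B := Finset.single_le_sum (fun k _ => hc0 k) (Finset.mem_range.2 hk)
    have h2 : ε ^ s * ε⁻¹ ^ k ≤ ε := by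
      obtain ⟨j, rfl⟩ : ∃ j, s = k + 1 + j := ⟨s - (k + 1), by omega⟩
      rw [pow_add, pow_succ, inv_pow]
      have h3 : ε ^ k ≠ 0 := by positivity
      have h4 : ε ^ j ≤ 1 := pow_le_one₀ hε.le hε1
      calc ε ^ k * ε * ε ^ j * (ε ^ k)⁻¹ = ε * ε ^ j := by field_simp
        _ ≤ ε := mul_le_of_le_one_right hε.le h4
    calc ε ^ s * (c k * ε⁻¹ ^ k) = (ε ^ s * ε⁻¹ ^ k) * c k := by ring
      _ ≤ ε * B := by
        gcongr
        exact hc0 k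

/-- Borel's lemma along `v = 0`. -/
lemma exists_borel {p : ℕ → SmoothFn 𝓘(ℝ, E × E) (E × E)} (hp : ∀ s, IsHomogeneousFn s (p s)) :
    ∃ h : SmoothFn 𝓘(ℝ, E × E) (E × E), ∀ (r : ℕ) (a : E),
      h - ∑ s ∈ range r, p s ∈ pointIdeal 𝓘(ℝ, E × E) (a, (0 : E)) ^ r := by
  choose f hfp hfb hfs using fun s => exists_cutoff (hp s)
  choose c hc using hfb
  let v : ℕ → ℕ → ℝ := fun k s => if k < s then (1 / 2) ^ s else c s k
  have hv : ∀ k, Summable (v k) := by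
    intro k
    refine (summable_congr_cofinite ?_).2 (summable_geometric_of_lt_one (r := 1 / 2)
      (by norm_num) (by norm_num))
    rw [Nat.cofinite_eq_atTop]
    filter_upwards [eventually_gt_atTop k] with s hs
    simp [v, hs]
  have hvb : ∀ k s z, ‖iteratedFDeriv ℝ k (f s).1 z‖ ≤ v k s := by
    intro k s z
    by_cases h : k < s
    · simpa only [v, if_pos h] using hfs s k h z
    · simpa only [v, if_neg h] using hc s k z
  have hfc : ∀ s, ContDiff ℝ ((⊤ : ℕ∞) : ℕ∞ω) (f s).1 := fun s => contDiff_smoothFn (f s)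
  have hH := contDiff_tsum hfc (fun k _ => hv k) fun k s z _ => hvb k s z
  refine ⟨⟨_, hH.contMDiff⟩, fun r a => ?_⟩
  have hm : ∀ s, f s ∈ pointIdeal 𝓘(ℝ, E × E) (a, (0 : E)) ^ s := fun s =>
    mem_pow_of_eventuallyEq (hfp s a) ((hp s).mem a)
  have h1 : (⟨_, hH.contMDiff⟩ : SmoothFn 𝓘(ℝ, E × E) (E × E)) - ∑ s ∈ range r, f s ∈
      pointIdeal 𝓘(ℝ, E × E) (a, (0 : E)) ^ r := by
    refine (mem_pow_iff_iteratedFDeriv _ r _).2 fun k hk => ?_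
    have h2 : ((⟨_, hH.contMDiff⟩ : SmoothFn 𝓘(ℝ, E × E) (E × E)) - ∑ s ∈ range r, f s).1 =
        (fun z => ∑' s, (f s).1 z) - (fun z => ∑ s ∈ range r, (f s).1 z) := by
      ext z
      simp
    have h3 : ContDiff ℝ k (fun z => ∑ s ∈ range r, (f s).1 z) :=
      ContDiff.sum fun s _ => (hfc s).of_le (by exact_mod_cast le_top)
    rw [h2, iteratedFDeriv_sub_apply (hH.of_le (by exact_mod_cast le_top)).contDiffAt
      h3.contDiffAt, iteratedFDeriv_tsum_apply hfc (fun k _ => hv k) (fun k s z _ => hvb k s z)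
      le_top, iteratedFDeriv_fun_sum_apply fun s _ => ((hfc s).of_le
        (by exact_mod_cast le_top)).contDiffAt, sub_eq_zero]
    refine tsum_eq_sum fun s hs => ?_
    exact (mem_pow_iff_iteratedFDeriv _ s _).1 (hm s) k
      (hk.trans_le (not_lt.1 fun h => hs (mem_range.2 h)))
  have h4 : ∑ s ∈ range r, f s - ∑ s ∈ range r, p s ∈
      pointIdeal 𝓘(ℝ, E × E) (a, (0 : E)) ^ r := by
    rw [← Finset.sum_sub_distrib]
    refine Ideal.sum_mem _ fun s _ => mem_pow_of_eventually_eq_zero ?_ r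
    filter_upwards [hfp s a] with z hz
    simp [hz]
  have h5 := Ideal.add_mem _ h1 h4
  rwa [sub_add_sub_cancel] at h5

end Borel

end StarProduct

namespace StarProduct

open Filter Topology Finset

set_option linter.unusedSectionVars false

/-! ### Borel's lemma along the diagonal -/

section BorelDiagonal

variable {E : Type*} [NormedAddCommGroup E] [NormedSpace ℝ E] [FiniteDimensional ℝ E]
  {M : Type*} [TopologicalSpace M] [ChartedSpace E M] [IsManifold 𝓘(ℝ, E) ∞ M] [T2Space M]
  {Ω : SymplecticForm E M} {C : ℕ → Fn E M →ₗ[ℂ] Fn E M →ₗ[ℂ] Fn E M}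
  {D : ℕ → Fn₂ E M →ₗ[ℂ] Fn₂ E M →ₗ[ℂ] Fn₂ E M}

lemma mem_sup_of_vanish_on (hC : IsStarProduct Ω C) (hD : IsTensorOpp C D) {U : Set M} {n : ℕ}
    {F : Fn₂ E M} (hF : ∀ x ∈ U, F ∈ pointIdeal₂ E (x, x) ^ n) {x : M} (hx : U ∈ 𝓝 x) :
    F ∈ diagIdeal E M ^ n ⊔ germIdeal (𝓘(ℝ, E).prod 𝓘(ℝ, E)) (x, x) := by
  obtain ⟨β, hβ, hβ'⟩ := exists_bump (I := 𝓘(ℝ, E)) hx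
  have h1 : tensor β 1 ^ n * F ∈ diagVanish E M n := by
    refine mem_diagVanish.2 fun y => ?_
    by_cases hy : y ∈ U
    · exact Ideal.mul_mem_left _ _ (hF y hy)
    · exact Ideal.mul_mem_right _ _ (Ideal.pow_mem_pow (by simp [tensor_apply, hβ' y hy]) n)
  have h2 : F - tensor β 1 ^ n * F ∈ germIdeal (𝓘(ℝ, E).prod 𝓘(ℝ, E)) (x, x) := by
    have h3 : Tendsto Prod.fst (𝓝 (x, x)) (𝓝 x) := continuous_fst.tendsto (x, x)
    filter_upwards [h3.eventually hβ] with z hz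
    simp [tensor_apply, hz]
  have h4 := Ideal.add_mem _ (Ideal.mem_sup_right (S := diagIdeal E M ^ n) h2)
    (diagVanish_le_sup hC hD x n h1)
  rwa [sub_add_cancel] at h4

section Local

/-- The map `(x, y) ↦ (Ξ x, Ξ x - Ξ y)`. -/
def relCoord (Ξ : M → E) (z : M × M) : E × E := (Ξ z.1, Ξ z.1 - Ξ z.2)

lemma contMDiff_relCoord {Ξ : M → E} (hΞ : ContMDiff 𝓘(ℝ, E) 𝓘(ℝ, E) ∞ Ξ) :
    ContMDiff (𝓘(ℝ, E).prod 𝓘(ℝ, E)) 𝓘(ℝ, E × E) ∞ (relCoord Ξ) := by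
  have h1 : ContMDiff (𝓘(ℝ, E).prod 𝓘(ℝ, E)) 𝓘(ℝ, E) ∞ (fun z : M × M => Ξ z.1) :=
    hΞ.comp contMDiff_fst
  have h2 : ContMDiff (𝓘(ℝ, E).prod 𝓘(ℝ, E)) 𝓘(ℝ, E) ∞ (fun z : M × M => Ξ z.2) :=
    hΞ.comp contMDiff_snd
  exact h1.prodMk_space (h1.sub h2)

/-- A coordinate of the second component, as a smooth function. -/
noncomputable def sndCoord {ι : Type*} (b : Module.Basis ι ℝ E) (i : ι) : SmoothFn 𝓘(ℝ, E × E) (E × E) :=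
  ⟨fun z => (b.coord i z.2 : ℂ), ContDiff.contMDiff
    (Complex.ofRealCLM.contDiff.comp
      ((b.coord i).toContinuousLinearMap.contDiff.comp contDiff_snd))⟩

lemma pull_sndCoord {Ξ : M → E} (hΞ : ContMDiff 𝓘(ℝ, E) 𝓘(ℝ, E) ∞ Ξ) {ι : Type*} [Fintype ι] (b : Module.Basis ι ℝ E) (i : ι) :
    pull (contMDiff_relCoord hΞ) (sndCoord b i) = delta (coordFn b hΞ i) := by
  ext z
  rw [pull_apply, delta_apply]
  simp [sndCoord, relCoord, coordFn_apply]

lemma IsHomogeneousFn.sndCoord_mul {s : ℕ} {p : SmoothFn 𝓘(ℝ, E × E) (E × E)}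
    (hp : IsHomogeneousFn s p) {ι : Type*} (b : Module.Basis ι ℝ E) (i : ι) :
    IsHomogeneousFn (s + 1) (sndCoord b i * p) where
  homogeneous a v c := by
    simp only [Subalgebra.coe_mul, Pi.mul_apply, hp.homogeneous]
    simp [sndCoord]
    ring
  support := by
    obtain ⟨K, hK, h⟩ := hp.support
    exact ⟨K, hK, fun a ha v => by simp [h a ha v]⟩
  mem a := by
    rw [pow_succ']
    exact Ideal.mul_mem_mul (by simp [sndCoord]) (hp.mem a)

lemma IsHomogeneousFn.const_mul {s : ℕ} {p : SmoothFn 𝓘(ℝ, E × E) (E × E)}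
    (hp : IsHomogeneousFn s p) (c : ℂ) : IsHomogeneousFn s (c • p) where
  homogeneous a v r := by
    simp [hp.homogeneous]
    ring
  support := by
    obtain ⟨K, hK, h⟩ := hp.support
    exact ⟨K, hK, fun a ha v => by simp [h a ha v]⟩
  mem a := by
    rw [Algebra.smul_def]
    exact Ideal.mul_mem_left _ _ (hp.mem a)

lemma IsHomogeneousFn.sum {s : ℕ} {ι : Type*} [Fintype ι] {p : ι → SmoothFn 𝓘(ℝ, E × E) (E × E)}
    (hp : ∀ i, IsHomogeneousFn s (p i)) : IsHomogeneousFn s (∑ i, p i) where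
  homogeneous a v r := by
    simp [(hp _).homogeneous, Finset.mul_sum]
  support := by
    choose K hK h using fun i => (hp i).support
    refine ⟨⋃ i, K i, isCompact_iUnion hK, fun a ha v => ?_⟩
    simp only [AddSubmonoidClass.coe_finsetSum, Finset.sum_apply]
    exact Finset.sum_eq_zero fun i _ => h i a (fun hi => ha (Set.mem_iUnion.2 ⟨i, hi⟩)) v
  mem a := Ideal.sum_mem _ fun i _ => (hp i).mem a

/-- The leading term of a function that vanishes to the order `s` along the diagonal. -/
lemma exists_leading_term {Ξ : M → E} (hΞ : ContMDiff 𝓘(ℝ, E) 𝓘(ℝ, E) ∞ Ξ)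
    (hC : IsStarProduct Ω C) (hD : IsTensorOpp C D) {U : Set M}
    (hU : IsOpen U) (b : Module.Basis (Fin (Module.finrank ℝ E)) ℝ E)
    {w : Fin (Module.finrank ℝ E) → Fin (Module.finrank ℝ E) → Fn E M}
    (hUc : ∀ x ∈ U, IsCoords C x (coordFn b hΞ) w)
    (hlift : ∀ G : Fn E M, ∃ g : SmoothFn 𝓘(ℝ, E) E, HasCompactSupport g.1 ∧
      ∀ y ∈ U, G.1 y = g.1 (Ξ y)) (s : ℕ) :
    ∀ F : Fn₂ E M, (∀ x ∈ U, F ∈ pointIdeal₂ E (x, x) ^ s) → ∃ p, IsHomogeneousFn s p ∧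
      ∀ x ∈ U, F - pull (contMDiff_relCoord hΞ) p ∈ pointIdeal₂ E (x, x) ^ (s + 1) := by
  induction s with
  | zero =>
    intro F _
    obtain ⟨g, hgc, hg⟩ := hlift (pull contMDiff_diag F)
    refine ⟨pull (φ := (Prod.fst : E × E → E)) (contDiff_fst.contMDiff) g, ⟨?_, ?_, ?_⟩, ?_⟩
    · intro a v c
      simp [pull_apply]
    · exact ⟨tsupport g.1, hgc, fun a ha v => by
        rw [pull_apply]
        exact image_eq_zero_of_notMem_tsupport ha⟩
    · simp
    · intro x hx
      have h1 : F.1 (x, x) = g.1 (Ξ x) := hg x hx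
      simp [pull_apply, relCoord, h1]
  | succ s ih =>
    intro F hF
    set t := coordFn b hΞ with ht
    choose p hp hFp using fun i => ih (coordField D t w i F) fun x hx =>
      (ordLT_coordField hD i).mem_pow _ s (by simpa [add_comm] using hF x hx)
    refine ⟨(((s + 1 : ℕ) : ℂ)⁻¹) • ∑ i, sndCoord b i * p i,
      (IsHomogeneousFn.sum fun i => (hp i).sndCoord_mul b i).const_mul _, fun x hx => ?_⟩
    obtain ⟨A, hA, g, hg, hAg⟩ := Submodule.mem_sup.1
      (mem_sup_of_vanish_on hC hD hF (hU.mem_nhds hx))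
    have h2 := (euler_sub_mem (eulerField_add (D := D) (t := t) (w := w)) (eulerField_mul hC hD)
      (eulerField_sub_mem hC hD (hUc x hx)) (s + 1) A hA).resolve_right (Nat.succ_ne_zero s)
    have h4 : eulerField D t w g ∈ germIdeal (𝓘(ℝ, E).prod 𝓘(ℝ, E)) (x, x) :=
      Ideal.sum_mem _ fun i _ =>
        Ideal.mul_mem_left _ _ ((ordLT_coordField hD i).mem_germIdeal hg)
    have h5 : (s + 1) • F - eulerField D t w F ∈ pointIdeal₂ E (x, x) ^ (s + 2) := by
      have : (s + 1) • F - eulerField D t w F = -(eulerField D t w A - (s + 1) • A) -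
          (eulerField D t w g - (s + 1) • g) := by
        rw [← hAg, eulerField_add, smul_add]
        abel
      rw [this]
      exact Ideal.sub_mem _ ((Ideal.neg_mem_iff _).2 (sup_germIdeal_le_pow x _ h2))
        (germIdeal_le_pow _ _ (Ideal.sub_mem _ h4 (nsmul_mem hg _)))
    have h6 : eulerField D t w F - ∑ i, delta (t i) * pull (contMDiff_relCoord hΞ) (p i) ∈
        pointIdeal₂ E (x, x) ^ (s + 2) := by
      rw [eulerField, ← Finset.sum_sub_distrib]
      refine Ideal.sum_mem _ fun i _ => ?_
      rw [← mul_sub, pow_succ']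
      exact Ideal.mul_mem_mul (mem_diagIdeal.1 (delta_mem (t i)) x) (hFp i x hx)
    have h7 : F - pull (contMDiff_relCoord hΞ) ((((s + 1 : ℕ) : ℂ)⁻¹) • ∑ i, sndCoord b i * p i) =
        algebraMap ℂ (Fn₂ E M) (((s + 1 : ℕ) : ℂ)⁻¹) * (((s + 1) • F - eulerField D t w F) +
        (eulerField D t w F - ∑ i, delta (t i) * pull (contMDiff_relCoord hΞ) (p i))) := by
      rw [sub_add_sub_cancel, ← Algebra.smul_def, smul_sub, ← Nat.cast_smul_eq_nsmul ℂ, smul_smul,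
        inv_mul_cancel₀ (by exact_mod_cast Nat.succ_ne_zero s), one_smul, map_smul, map_sum]
      simp only [map_mul, ht, pull_sndCoord hΞ b]
    rw [h7]
    exact Ideal.mul_mem_left _ _ (Ideal.add_mem _ h5 h6)

end Local

lemma exists_borel_local (hC : IsStarProduct Ω C) (hD : IsTensorOpp C D) {F : ℕ → Fn₂ E M}
    (hF : ∀ s, F s ∈ diagVanish E M s) (x₀ : M) : ∃ G : Fn₂ E M, ∃ U ∈ 𝓝 x₀, ∀ x ∈ U, ∀ r,
      G - ∑ s ∈ range r, F s ∈ pointIdeal₂ E (x, x) ^ r := by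
  obtain ⟨Ξ, hΞ, hΞx⟩ := exists_chart_extension 𝓘(ℝ, E) x₀
  let b := Module.finBasis ℝ E
  obtain ⟨w, hw⟩ := hC.exists_isCoords_coordFn hΞ hΞx b
  obtain ⟨U₁, hU₁, hx₁, -, hlift⟩ := exists_coordinate_lift 𝓘(ℝ, E) x₀
  obtain ⟨U₂, hU₂, hU₂o, hx₂⟩ := eventually_nhds_iff.1 (hΞx.and hw.eventually)
  set U := U₁ ∩ U₂
  have lead := exists_leading_term hΞ hC hD (hU₁.inter hU₂o) b (fun x hx => (hU₂ x hx.2).2)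
    fun G => by
      obtain ⟨g, hg, hg', -⟩ := hlift G
      refine ⟨g, hg, fun y hy => ?_⟩
      rw [hg' y hy.1, (hU₂ y hy.2).1]
  choose! p hp hpF using lead
  let Φ := pull (contMDiff_relCoord hΞ)
  let R : ℕ → Fn₂ E M := fun s => Nat.rec (F 0) (fun s R => F (s + 1) + (R - Φ (p s R))) s
  have hR : ∀ s, ∀ x ∈ U, R s ∈ pointIdeal₂ E (x, x) ^ s := by
    intro s
    induction s with
    | zero => simp
    | succ s ih =>
      intro x hx
      exact Ideal.add_mem _ (mem_diagVanish.1 (hF (s + 1)) x) (hpF s (R s) ih x hx)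
  obtain ⟨h, hh⟩ := exists_borel fun s => hp s (R s) (hR s)
  refine ⟨Φ h, U, (hU₁.inter hU₂o).mem_nhds ⟨hx₁, hx₂⟩, fun x hx r => ?_⟩
  have h1 : ∀ r, (∑ s ∈ range (r + 1), F s) = Φ (∑ s ∈ range r, p s (R s)) + R r := by
    intro r
    induction r with
    | zero => simp [R]
    | succ r ih =>
      rw [Finset.sum_range_succ, ih, Finset.sum_range_succ, map_add]
      show _ = _ + (F (r + 1) + (R r - Φ (p r (R r))))
      ring
  cases r with
  | zero => simp
  | succ r =>
    have h2 : Φ h - ∑ s ∈ range (r + 1), F s =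
        Φ (h - ∑ s ∈ range (r + 1), p s (R s)) - (R r - Φ (p r (R r))) := by
      rw [h1, map_sub, Finset.sum_range_succ, map_add]
      ring
    rw [h2]
    refine Ideal.sub_mem _ (pull_mem_pow _ _ ?_) (hpF r (R r) (hR r) x hx)
    have h3 := hh (r + 1) (Ξ x)
    have h4 : relCoord Ξ (x, x) = (Ξ x, 0) := by simp [relCoord]
    rwa [h4]

/-- Borel's lemma along the diagonal. -/
lemma exists_borel_diag [SigmaCompactSpace M] (hC : IsStarProduct Ω C) (hD : IsTensorOpp C D)
    {F : ℕ → Fn₂ E M} (hF : ∀ s, F s ∈ diagVanish E M s) :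
    ∃ G : Fn₂ E M, ∀ r, G - ∑ s ∈ range r, F s ∈ diagVanish E M r := by
  choose G U hU hG using exists_borel_local hC hD hF
  obtain ⟨H, ρ, h⟩ := exists_glue_diag U hU G
  refine ⟨H, fun r => mem_diagVanish.2 fun x => ?_⟩
  obtain ⟨s, hs, h1, h2⟩ := h x
  refine mem_pow_of_eventuallyEq (g := ∑ i ∈ s, ρ i * (G i - ∑ s ∈ range r, F s)) ?_
    (Ideal.sum_mem _ fun i hi => Ideal.mul_mem_left _ _ (hG i x (hs i hi) r))
  filter_upwards [h1, h2] with z hz1 hz2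
  simp only [AddSubgroupClass.coe_sub, Pi.sub_apply, AddSubmonoidClass.coe_finsetSum,
    Finset.sum_apply, Subalgebra.coe_mul, Pi.mul_apply, mul_sub, Finset.sum_sub_distrib]
  rw [← Finset.sum_mul, hz1, hz2, one_mul]

end BorelDiagonal

end StarProduct

namespace StarProduct

open Filter Topology Finset

set_option linter.unusedSectionVars false

/-! ### Division of flat functions -/

section Division

variable {E : Type*} [NormedAddCommGroup E] [NormedSpace ℝ E] [FiniteDimensional ℝ E]
  {H : Type*} [TopologicalSpace H] {I : ModelWithCorners ℝ E H} [I.Boundaryless]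
  {N : Type*} [TopologicalSpace N] [ChartedSpace H N] [IsManifold I ∞ N] [T2Space N]

lemma contDiffAt_comp_symm (x : N) (F : SmoothFn I N) {e : E} (he : e ∈ (extChartAt I x).target) :
    ContDiffAt ℝ ∞ (fun e => F.1 ((extChartAt I x).symm e)) e := by
  rw [← contMDiffAt_iff_contDiffAt]
  exact (ContMDiff.contMDiffAt F.2).comp e
    ((contMDiffOn_extChartAt_symm x).contMDiffAt ((isOpen_extChartAt_target x).mem_nhds he))

variable (I) in
/-- The derivatives in the coordinates of a chart are, near a point, given by first order operators
on the manifold. -/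
lemma exists_coordinate_derivation (x : N) : ∃ W : Set E, IsOpen W ∧ extChartAt I x x ∈ W ∧
    W ⊆ (extChartAt I x).target ∧ ∀ v : E, ∃ X : Module.End ℂ (SmoothFn I N), OrdLT 2 X ∧
      ∀ F, ∀ e ∈ W, (X F).1 ((extChartAt I x).symm e) =
        fderiv ℝ (fun e => F.1 ((extChartAt I x).symm e)) e v := by
  let φ := extChartAt I x
  obtain ⟨β, -, -⟩ := (SmoothBumpFunction.nhds_basis_tsupport (I := I) x).mem_iff.1 univ_mem
  have hd : ∀ F : SmoothFn I N, ∀ y ∈ φ.source,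
      DifferentiableAt ℝ (fun e => F.1 (φ.symm e)) (φ y) := fun F y hy =>
    (contDiffAt_comp_symm x F (φ.map_source hy)).differentiableAt (by simp)
  have hβ0 : ∀ y ∉ φ.source, β y = 0 := fun y hy => image_eq_zero_of_notMem_tsupport fun h =>
    hy (β.tsupport_subset_extChartAt_source h)
  have hW : ∀ᶠ e in 𝓝 (φ x), e ∈ φ.target ∧ β (φ.symm e) = 1 := by
    refine Eventually.and ((isOpen_extChartAt_target x).mem_nhds (mem_extChartAt_target x)) ?_
    have h1 := continuousAt_extChartAt_symm (I := I) x
    rw [ContinuousAt, extChartAt_to_inv] at h1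
    exact h1.eventually β.eventuallyEq_one
  obtain ⟨W, hW, hWo, hxW⟩ := eventually_nhds_iff.1 hW
  refine ⟨W, hWo, hxW, fun e he => (hW e he).1, fun v => ?_⟩
  have hsm : ∀ F : SmoothFn I N, ContMDiff I 𝓘(ℝ, ℂ) ∞
      (fun y => β y • fderiv ℝ (fun e => F.1 (φ.symm e)) (φ y) v) := by
    intro F
    refine contMDiff_of_tsupport fun y hy => ?_
    have hy' : y ∈ φ.source :=
      β.tsupport_subset_extChartAt_source (tsupport_smul_subset_left _ _ hy)
    have h1 : ContDiffAt ℝ ∞ (fun e => fderiv ℝ (fun e => F.1 (φ.symm e)) e v) (φ y) :=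
      ((contDiffAt_comp_symm x F (φ.map_source hy')).fderiv_right (m := ∞) (by simp)).clm_apply
        contDiffAt_const
    exact β.contMDiffAt.smul (h1.contMDiffAt.comp y
      (contMDiffAt_extChartAt' (by simpa [φ] using hy')))
  let X : Module.End ℂ (SmoothFn I N) :=
    { toFun := fun F => ⟨_, hsm F⟩
      map_add' := fun F G => by
        ext y
        show β y • fderiv ℝ ((fun e => F.1 (φ.symm e)) + fun e => G.1 (φ.symm e)) (φ y) v =
          β y • fderiv ℝ (fun e => F.1 (φ.symm e)) (φ y) v +
            β y • fderiv ℝ (fun e => G.1 (φ.symm e)) (φ y) v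
        by_cases hy : y ∈ φ.source
        · rw [fderiv_add (hd F y hy) (hd G y hy), ← smul_add]
          rfl
        · simp [hβ0 y hy]
      map_smul' := fun c F => by
        ext y
        show β y • fderiv ℝ (c • fun e => F.1 (φ.symm e)) (φ y) v =
          c • β y • fderiv ℝ (fun e => F.1 (φ.symm e)) (φ y) v
        by_cases hy : y ∈ φ.source
        · rw [fderiv_const_smul (hd F y hy), smul_comm]
          rfl
        · simp [hβ0 y hy] }
  refine ⟨X, fun y F hF => ?_, fun F e he => ?_⟩
  · by_cases hy : y ∈ φ.source
    · rw [pow_two] at hF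
      refine Submodule.mul_induction_on hF (fun a ha b hb => ?_) fun a b ha hb => ?_
      · have ha' : a.1 (φ.symm (φ y)) = 0 := by rw [φ.left_inv hy]; exact ha
        have hb' : b.1 (φ.symm (φ y)) = 0 := by rw [φ.left_inv hy]; exact hb
        show β y • fderiv ℝ ((fun e => a.1 (φ.symm e)) * fun e => b.1 (φ.symm e)) (φ y) v = 0
        rw [fderiv_mul (hd a y hy) (hd b y hy)]
        simp [ha', hb']
      · rw [map_add]
        simp [ha, hb]
    · show β y • fderiv ℝ (fun e => F.1 (φ.symm e)) (φ y) v = 0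
      simp [hβ0 y hy]
  · show β (φ.symm e) • fderiv ℝ (fun e => F.1 (φ.symm e)) (φ (φ.symm e)) v = _
    rw [(hW e he).2, φ.right_inv (hW e he).1, one_smul]

/-- The quotient of a flat function by a power of a function that measures the distance to the set
where it is flat is smooth. -/
lemma contMDiff_div_pow_of_flat (𝔉 : Ideal (SmoothFn I N))
    (hX : ∀ X : Module.End ℂ (SmoothFn I N), OrdLT 2 X → ∀ F ∈ 𝔉, X F ∈ 𝔉) (Q : SmoothFn I N)
    (hQ : ∀ F ∈ 𝔉, ∀ (k : ℕ) (z : N), Q.1 z = 0 →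
      ∃ c, 0 ≤ c ∧ ∀ᶠ y in 𝓝 z, ‖F.1 y‖ ≤ c * ‖Q.1 y‖ ^ k) {F : SmoothFn I N} (hF : F ∈ 𝔉) (k : ℕ) :
    ContMDiff I 𝓘(ℝ, ℂ) ∞ (fun y => F.1 y / Q.1 y ^ k) := by
  intro x
  obtain ⟨W, hWo, hxW, hWt, hW⟩ := exists_coordinate_derivation I x
  choose X hX2 hXF using hW
  let φ := extChartAt I x
  let h : SmoothFn I N → ℕ → E → ℂ := fun F k e => F.1 (φ.symm e) / Q.1 (φ.symm e) ^ k
  have hd : ∀ F : SmoothFn I N, ∀ e ∈ W, DifferentiableAt ℝ (fun e => F.1 (φ.symm e)) e :=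
    fun F e he => (contDiffAt_comp_symm x F (hWt he)).differentiableAt (by simp)
  have key : ∀ F ∈ 𝔉, ∀ k, ∀ e ∈ W, DifferentiableAt ℝ (h F k) e ∧
      ∀ v, fderiv ℝ (h F k) e v = h (X v F * Q - k • (F * X v Q)) (k + 1) e := by
    intro F hF k e he
    by_cases hQe : Q.1 (φ.symm e) = 0
    · obtain ⟨c, hc, hb⟩ := hQ F hF (k + 2) _ hQe
      have hcont : Tendsto φ.symm (𝓝 e) (𝓝 (φ.symm e)) :=
        continuousAt_extChartAt_symm'' (hWt he)
      have h1 : (fun e' => Q.1 (φ.symm e')) =O[𝓝 e] fun e' => e' - e := by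
        have h2 := (hd Q e he).isBigO_sub
        simpa [hQe] using h2
      have h2 : h F k =O[𝓝 e] fun e' => ‖Q.1 (φ.symm e')‖ ^ 2 := by
        refine Asymptotics.IsBigO.of_bound c ?_
        filter_upwards [hcont.eventually hb] with e' he'
        rw [norm_pow, norm_norm]
        simp only [h, norm_div, norm_pow]
        rcases eq_or_ne (‖Q.1 (φ.symm e')‖ ^ k) 0 with h0 | h0
        · rw [h0, div_zero]
          positivity
        · rw [div_le_iff₀ (lt_of_le_of_ne (by positivity) h0.symm), mul_assoc, ← pow_add, add_comm]
          exact he'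
      have h3 : h F k =O[𝓝 e] fun e' => ‖e' - e‖ ^ 2 :=
        h2.trans (h1.norm_left.norm_right.pow 2)
      have h4 : HasFDerivAt (h F k) (0 : E →L[ℝ] ℂ) e := h3.hasFDerivAt (by norm_num)
      refine ⟨h4.differentiableAt, fun v => ?_⟩
      rw [h4.fderiv]
      simp [h, hQe]
    · have h1 : DifferentiableAt ℝ (fun e => Q.1 (φ.symm e) ^ k) e := (hd Q e he).pow k
      have h2 : DifferentiableAt ℝ (h F k) e := by
        simp only [h, div_eq_mul_inv]
        exact (hd F e he).mul (((contDiffAt_inv ℝ (n := 1) (pow_ne_zero k hQe)).differentiableAt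
          (by simp)).comp e h1)
      refine ⟨h2, fun v => ?_⟩
      have h3 : (fun e => F.1 (φ.symm e)) =ᶠ[𝓝 e] (h F k) * fun e => Q.1 (φ.symm e) ^ k := by
        have h4 := (hd Q e he).continuousAt.eventually_ne hQe
        filter_upwards [h4] with e' he'
        simp only [h, Pi.mul_apply]
        rw [div_mul_cancel₀ _ (pow_ne_zero k he')]
      have h5 : fderiv ℝ (fun e => F.1 (φ.symm e)) e v =
          fderiv ℝ ((h F k) * fun e => Q.1 (φ.symm e) ^ k) e v := by rw [h3.fderiv_eq]
      rw [fderiv_mul h2 h1, fderiv_fun_pow k (hd Q e he)] at h5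
      simp only [add_apply, smul_apply, smul_eq_mul,
        nsmul_eq_mul] at h5
      rw [← hXF v F e he, ← hXF v Q e he] at h5
      have h6 : h (X v F * Q - k • (F * X v Q)) (k + 1) e =
          ((X v F).1 (φ.symm e) * Q.1 (φ.symm e) - k * (F.1 (φ.symm e) *
            (X v Q).1 (φ.symm e))) / Q.1 (φ.symm e) ^ (k + 1) := by
        simp [h]
      have h7 : F.1 (φ.symm e) = h F k e * Q.1 (φ.symm e) ^ k := h3.self_of_nhds
      rw [h6, h5, h7, eq_div_iff (pow_ne_zero _ hQe)]
      cases k with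
      | zero => simp
      | succ k =>
        rw [Nat.add_sub_cancel]
        simp only [φ]
        ring
  have hCD : ∀ n : ℕ, ∀ F ∈ 𝔉, ∀ k, ContDiffOn ℝ n (h F k) W := by
    intro n
    induction n with
    | zero =>
      intro F hF k
      rw [Nat.cast_zero, contDiffOn_zero]
      exact fun e he => (key F hF k e he).1.continuousAt.continuousWithinAt
    | succ n ih =>
      intro F hF k
      rw [Nat.cast_succ, contDiffOn_succ_iff_fderiv_of_isOpen hWo]
      refine ⟨fun e he => (key F hF k e he).1.differentiableWithinAt, by simp, ?_⟩
      refine contDiffOn_clm_apply.2 fun v => ?_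
      refine (ih (X v F * Q - k • (F * X v Q)) ?_ (k + 1)).congr fun e he => (key F hF k e he).2 v
      exact Ideal.sub_mem _ (Ideal.mul_mem_right _ _ (hX _ (hX2 v) F hF))
        (nsmul_mem (Ideal.mul_mem_right _ _ hF) k)
  have h1 : ContDiffAt ℝ ∞ (h F k) (φ x) :=
    (contDiffOn_infty.2 fun n => hCD n F hF k).contDiffAt (hWo.mem_nhds hxW)
  have h2 : ContMDiffAt I 𝓘(ℝ, ℂ) ∞ (fun y => h F k (φ y)) x :=
    h1.contMDiffAt.comp x (contMDiffAt_extChartAt (x := x))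
  refine h2.congr_of_eventuallyEq ?_
  filter_upwards [extChartAt_source_mem_nhds (I := I) x] with y hy
  simp only [h]
  rw [φ.left_inv hy]

end Division

section Flat

variable {E : Type*} [NormedAddCommGroup E] [NormedSpace ℝ E] [FiniteDimensional ℝ E]
  {M : Type*} [TopologicalSpace M] [ChartedSpace E M] [IsManifold 𝓘(ℝ, E) ∞ M] [T2Space M]
  {Ω : SymplecticForm E M} {C : ℕ → Fn E M →ₗ[ℂ] Fn E M →ₗ[ℂ] Fn E M}
  {D : ℕ → Fn₂ E M →ₗ[ℂ] Fn₂ E M →ₗ[ℂ] Fn₂ E M}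

/-- A nonnegative function that, on `U`, vanishes on the diagonal only, and not faster than the
square of the distance. -/
structure IsDistSqOn (U : Set (M × M)) (q : Fn₂ E M) : Prop where
  nonneg : ∀ z, ∃ r : ℝ, 0 ≤ r ∧ q.1 z = r
  eq_zero_iff : ∀ z ∈ U, q.1 z = 0 ↔ z.1 = z.2
  bound : ∀ x : M, (x, x) ∈ U → ∀ G ∈ diagIdeal E M, ∃ c, 0 ≤ c ∧
    ∀ᶠ z in 𝓝 (x, x), ‖G.1 z‖ ^ 2 ≤ c * ‖q.1 z‖

lemma exists_isDistSqOn_nhds (z : M × M) :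
    ∃ U ∈ 𝓝 z, ∃ q : Fn₂ E M, IsDistSqOn U q := by
  by_cases hz : z.1 = z.2
  · obtain ⟨x, y⟩ := z
    obtain rfl : x = y := hz
    obtain ⟨Ξ, hΞ, hΞx⟩ := exists_chart_extension 𝓘(ℝ, E) x
    let b := Module.finBasis ℝ E
    obtain ⟨U, hU, V, hV, -, h⟩ := hadamard_coord (I := 𝓘(ℝ, E)) (I' := 𝓘(ℝ, E)) b
      (contMDiff_id (I := 𝓘(ℝ, E))) x hΞ hΞx
    let q : Fn₂ E M := ∑ i, delta (coordFn b hΞ i) ^ 2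
    let r : M × M → ℝ := fun z => ∑ i, (b.coord i (Ξ z.1) - b.coord i (Ξ z.2)) ^ 2
    have hr0 : ∀ z, 0 ≤ r z := fun z => Finset.sum_nonneg fun i _ => sq_nonneg _
    have hqr : ∀ z, q.1 z = r z := by
      intro z
      simp [q, r, delta_apply, coordFn_apply]
    refine ⟨interior (U ×ˢ V), interior_mem_nhds.2 (prod_mem_nhds hU hV), q,
      fun z => ⟨r z, hr0 z, hqr z⟩, fun z hz => ⟨fun h0 => ?_, fun h0 => ?_⟩, fun y hy G hG => ?_⟩
    · rw [hqr, Complex.ofReal_eq_zero, Finset.sum_eq_zero_iff_of_nonneg fun i _ => sq_nonneg _]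
        at h0
      by_contra hne
      obtain ⟨β, hβ, hβ'⟩ := exists_bump (I := 𝓘(ℝ, E)) (x := z.1) (U := {z.2}ᶜ)
        (isOpen_compl_singleton.mem_nhds hne)
      obtain ⟨K, hK⟩ := h (tensor 1 β)
      have hz' := interior_subset hz
      have h1 := hK z.1 hz'.1 z.2 hz'.2
      rw [Finset.sum_eq_zero fun i hi => by
        have h2 := pow_eq_zero_iff (two_ne_zero) |>.1 (h0 i hi)
        rw [sub_eq_zero] at h2
        simp [coordFn_apply, h2]] at h1
      simp [tensor_apply, hβ.self_of_nhds, hβ' z.2 (by simp)] at h1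
    · simp [hqr, r, h0]
    · obtain ⟨K, hK⟩ := h G
      have hcont : ContinuousAt (fun z => ∑ i, ‖(K i).1 z‖ ^ 2) (y, y) :=
        (continuous_finsetSum _ fun i _ => ((ContMDiff.continuous (K i).2).norm.pow 2)).continuousAt
      have hc0 : ∀ z, 0 ≤ ∑ i, ‖(K i).1 z‖ ^ 2 := fun z => Finset.sum_nonneg fun i _ => sq_nonneg _
      refine ⟨∑ i, ‖(K i).1 (y, y)‖ ^ 2 + 1, by linarith [hc0 (y, y)], ?_⟩
      filter_upwards [isOpen_interior.mem_nhds hy,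
        hcont.eventually_lt continuousAt_const (lt_add_one _)] with z hz hlt
      have hz' := interior_subset hz
      have h1 := hK z.1 hz'.1 z.2 hz'.2
      have h2 : G.1 (z.1, id z.1) = 0 := mem_diagIdeal.1 hG z.1
      rw [h2, zero_add] at h1
      have h3 : ‖G.1 z‖ ≤ ∑ i, |b.coord i (Ξ z.1) - b.coord i (Ξ z.2)| * ‖(K i).1 z‖ := by
        have h4 : G.1 z = G.1 (z.1, z.2) := rfl
        rw [h4, h1]
        refine (norm_sum_le _ _).trans (Finset.sum_le_sum fun i _ => ?_)
        rw [norm_mul, coordFn_apply, coordFn_apply, ← Complex.ofReal_sub, Complex.norm_real,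
          Real.norm_eq_abs, abs_sub_comm]
        rfl
      calc ‖G.1 z‖ ^ 2 ≤ (∑ i, |b.coord i (Ξ z.1) - b.coord i (Ξ z.2)| * ‖(K i).1 z‖) ^ 2 := by
            gcongr
        _ ≤ (∑ i, |b.coord i (Ξ z.1) - b.coord i (Ξ z.2)| ^ 2) * ∑ i, ‖(K i).1 z‖ ^ 2 :=
            Finset.sum_mul_sq_le_sq_mul_sq _ _ _
        _ = r z * ∑ i, ‖(K i).1 z‖ ^ 2 := by simp only [sq_abs, r]
        _ ≤ (∑ i, ‖(K i).1 (y, y)‖ ^ 2 + 1) * ‖q.1 z‖ := by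
            rw [hqr, Complex.norm_real, Real.norm_of_nonneg (hr0 z), mul_comm]
            exact mul_le_mul_of_nonneg_right hlt.le (hr0 z)
  · refine ⟨{y | y.1 ≠ y.2}, (isOpen_ne_fun continuous_fst continuous_snd).mem_nhds hz, 1,
      fun z => ⟨1, zero_le_one, by simp⟩, fun z hz => ?_, fun x hx => absurd rfl hx⟩
    have hz' : z.1 ≠ z.2 := hz
    simp [hz']

variable (E M) in
lemma exists_isDistSqOn_univ [SigmaCompactSpace M] : ∃ q : Fn₂ E M, IsDistSqOn Set.univ q := by
  choose U hU q hq using exists_isDistSqOn_nhds (E := E) (M := M)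
  obtain ⟨Q, ρ, hρ, h⟩ := exists_glue (I := 𝓘(ℝ, E).prod 𝓘(ℝ, E)) U hU q
  choose a ha haρ using hρ
  choose r hr hrq using fun i => (hq i).nonneg
  choose s hs h1 h2 using h
  have hQ : ∀ z, ∀ᶠ y in 𝓝 z, Q.1 y = (∑ i ∈ s z, a i y * r i y : ℝ) := by
    intro z
    filter_upwards [h2 z] with y hy
    rw [hy]
    push_cast
    exact Finset.sum_congr rfl fun i _ => by rw [haρ, hrq]
  have ha1 : ∀ z, ∀ᶠ y in 𝓝 z, ∑ i ∈ s z, a i y = 1 := by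
    intro z
    filter_upwards [h1 z] with y hy
    simp only [haρ] at hy
    exact_mod_cast hy
  refine ⟨Q, fun z => ⟨_, Finset.sum_nonneg fun i _ => mul_nonneg (ha i z) (hr i z),
    (hQ z).self_of_nhds⟩, fun z _ => ?_, fun x _ G hG => ?_⟩
  · have hrz : ∀ i ∈ s z, r i z = 0 ↔ z.1 = z.2 := by
      intro i hi
      rw [← (hq i).eq_zero_iff z (hs z i hi), hrq, Complex.ofReal_eq_zero]
    rw [(hQ z).self_of_nhds, Complex.ofReal_eq_zero,
      Finset.sum_eq_zero_iff_of_nonneg fun i _ => mul_nonneg (ha i z) (hr i z)]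
    refine ⟨fun h0 => ?_, fun h0 i hi => by rw [(hrz i hi).2 h0, mul_zero]⟩
    obtain ⟨i, hi, hne⟩ := Finset.exists_ne_zero_of_sum_ne_zero
      (show ∑ i ∈ s z, a i z ≠ 0 by rw [(ha1 z).self_of_nhds]; exact one_ne_zero)
    exact (hrz i hi).1 ((mul_eq_zero.1 (h0 i hi)).resolve_left hne)
  · have hb : ∀ i, ∃ c, 0 ≤ c ∧ (i ∈ s (x, x) → ∀ᶠ z in 𝓝 (x, x), ‖G.1 z‖ ^ 2 ≤ c * r i z) := by
      intro i
      by_cases hi : i ∈ s (x, x)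
      · obtain ⟨c, hc, hcz⟩ := (hq i).bound x (hs _ i hi) G hG
        refine ⟨c, hc, fun _ => ?_⟩
        filter_upwards [hcz] with z hz
        rwa [hrq, Complex.norm_real, Real.norm_of_nonneg (hr i z)] at hz
      · exact ⟨0, le_rfl, fun h => absurd h hi⟩
    choose c hc hcz using hb
    refine ⟨∑ i ∈ s (x, x), c i, Finset.sum_nonneg fun i _ => hc i, ?_⟩
    filter_upwards [hQ (x, x), ha1 (x, x), (Filter.eventually_all_finset _).2 hcz]
      with z hz1 hz2 hz3
    rw [hz1, Complex.norm_real, Real.norm_of_nonneg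
      (Finset.sum_nonneg fun i _ => mul_nonneg (ha i z) (hr i z)), Finset.mul_sum]
    calc ‖G.1 z‖ ^ 2 = ∑ i ∈ s (x, x), a i z * ‖G.1 z‖ ^ 2 := by
          rw [← Finset.sum_mul, hz2, one_mul]
      _ ≤ ∑ i ∈ s (x, x), (∑ i ∈ s (x, x), c i) * (a i z * r i z) := by
          refine Finset.sum_le_sum fun i hi => ?_
          have h3 : c i ≤ ∑ i ∈ s (x, x), c i := Finset.single_le_sum (fun i _ => hc i) hi
          calc a i z * ‖G.1 z‖ ^ 2 ≤ a i z * (c i * r i z) :=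
                mul_le_mul_of_nonneg_left (hz3 i hi) (ha i z)
            _ = c i * (a i z * r i z) := by ring
            _ ≤ _ := mul_le_mul_of_nonneg_right h3 (mul_nonneg (ha i z) (hr i z))

lemma IsDistSqOn.bound_pow {q : Fn₂ E M} (hq : IsDistSqOn Set.univ q) (x : M) (j : ℕ) :
    ∀ G ∈ diagIdeal E M ^ j, ∃ c, 0 ≤ c ∧ ∀ᶠ z in 𝓝 (x, x), ‖G.1 z‖ ^ 2 ≤ c * ‖q.1 z‖ ^ j := by
  induction j with
  | zero =>
    intro G _
    have hcont : ContinuousAt (fun z => ‖G.1 z‖ ^ 2) (x, x) :=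
      ((ContMDiff.continuous G.2).norm.pow 2).continuousAt
    refine ⟨‖G.1 (x, x)‖ ^ 2 + 1, by positivity, ?_⟩
    filter_upwards [hcont.eventually_lt continuousAt_const (lt_add_one _)] with z hz
    simpa using hz.le
  | succ j ih =>
    intro G hG
    rw [pow_succ'] at hG
    refine Submodule.mul_induction_on hG (fun A hA B hB => ?_) fun A B hA hB => ?_
    · obtain ⟨c, hc, h1⟩ := hq.bound x trivial A hA
      obtain ⟨c', hc', h2⟩ := ih B hB
      refine ⟨c * c', by positivity, ?_⟩
      filter_upwards [h1, h2] with z hz1 hz2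
      calc ‖A.1 z * B.1 z‖ ^ 2 = ‖A.1 z‖ ^ 2 * ‖B.1 z‖ ^ 2 := by rw [norm_mul, mul_pow]
        _ ≤ (c * ‖q.1 z‖) * (c' * ‖q.1 z‖ ^ j) := by gcongr
        _ = c * c' * ‖q.1 z‖ ^ (j + 1) := by ring
    · obtain ⟨c, hc, h1⟩ := hA
      obtain ⟨c', hc', h2⟩ := hB
      refine ⟨2 * c + 2 * c', by positivity, ?_⟩
      filter_upwards [h1, h2] with z hz1 hz2
      have h3 : ‖A.1 z + B.1 z‖ ≤ ‖A.1 z‖ + ‖B.1 z‖ := norm_add_le _ _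
      calc ‖A.1 z + B.1 z‖ ^ 2 ≤ (‖A.1 z‖ + ‖B.1 z‖) ^ 2 := by gcongr
        _ ≤ 2 * ‖A.1 z‖ ^ 2 + 2 * ‖B.1 z‖ ^ 2 := by nlinarith [sq_nonneg (‖A.1 z‖ - ‖B.1 z‖)]
        _ ≤ (2 * c + 2 * c') * ‖q.1 z‖ ^ (j + 1) := by nlinarith

/-- The functions that vanish to infinite order along the diagonal are in all powers of its
vanishing ideal. -/
lemma mem_diagIdeal_pow_of_flat [SigmaCompactSpace M] (hC : IsStarProduct Ω C)
    (hD : IsTensorOpp C D) {F : Fn₂ E M} (hF : ∀ r, F ∈ diagVanish E M r) (k : ℕ) :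
    F ∈ diagIdeal E M ^ k := by
  obtain ⟨Q, hQ⟩ := exists_isDistSqOn_univ E M
  have hbd : ∀ F ∈ ⨅ r, diagVanish E M r, ∀ (k : ℕ) (z : M × M), Q.1 z = 0 →
      ∃ c, 0 ≤ c ∧ ∀ᶠ y in 𝓝 z, ‖F.1 y‖ ≤ c * ‖Q.1 y‖ ^ k := by
    rintro F hF k ⟨x, y⟩ hz
    obtain rfl : x = y := (hQ.eq_zero_iff _ trivial).1 hz
    obtain ⟨A, hA, g, hg, rfl⟩ := Submodule.mem_sup.1
      (diagVanish_le_sup hC hD x (2 * k) (Ideal.mem_iInf.1 hF (2 * k)))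
    obtain ⟨c, hc, h⟩ := hQ.bound_pow x (2 * k) A hA
    refine ⟨Real.sqrt c, Real.sqrt_nonneg c, ?_⟩
    filter_upwards [h, hg] with z hz hgz
    have h1 : ‖(A + g).1 z‖ = ‖A.1 z‖ := by simp [hgz]
    rw [h1]
    refine le_of_sq_le_sq ?_ (by positivity)
    rw [mul_pow, Real.sq_sqrt hc, ← pow_mul, mul_comm k 2]
    exact hz
  have hflat : F ∈ ⨅ r, diagVanish E M r := Ideal.mem_iInf.2 hF
  have hsm := contMDiff_div_pow_of_flat (I := 𝓘(ℝ, E).prod 𝓘(ℝ, E)) (⨅ r, diagVanish E M r)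
    (fun X hX F hF => Ideal.mem_iInf.2 fun r =>
      OrdLT.mem_diagVanish (k := 1) hX (Ideal.mem_iInf.1 hF _)) Q hbd hflat k
  have h1 : F = Q ^ k * ⟨_, hsm⟩ := by
    ext z
    show F.1 z = Q.1 z ^ k * (F.1 z / Q.1 z ^ k)
    by_cases hz : Q.1 z = 0
    · have h2 : F.1 z = 0 := by
        obtain ⟨c, -, h3⟩ := hbd F hflat 1 z hz
        have h4 := h3.self_of_nhds
        rw [hz] at h4
        simpa using h4
      simp [h2]
    · rw [mul_div_cancel₀ _ (pow_ne_zero k hz)]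
  rw [h1]
  refine Ideal.mul_mem_right _ _ (Ideal.pow_mem_pow (mem_diagIdeal.2 fun x => ?_) k)
  exact (hQ.eq_zero_iff _ trivial).2 rfl

end Flat

end StarProduct

namespace StarProduct

open Filter Topology Finset

set_option linter.unusedSectionVars false

/-! ### The isomorphism onto the algebra of natural operators -/

section Isomorphism

variable {E : Type*} [NormedAddCommGroup E] [NormedSpace ℝ E] [FiniteDimensional ℝ E]
  {M : Type*} [TopologicalSpace M] [ChartedSpace E M] [IsManifold 𝓘(ℝ, E) ∞ M] [T2Space M]
  {Ω : SymplecticForm E M} {C : ℕ → Fn E M →ₗ[ℂ] Fn E M →ₗ[ℂ] Fn E M}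
  {D : ℕ → Fn₂ E M →ₗ[ℂ] Fn₂ E M →ₗ[ℂ] Fn₂ E M}
  {S : ℕ → Fn₂ E M →ₗ[ℂ] Module.End ℂ (Fn E M)}
  {P : ℕ → DiagJets E M →ₗ[ℂ] DiagJets E M →ₗ[ℂ] DiagJets E M}
  {T : ℕ → DiagJets E M →ₗ[ℂ] Module.End ℂ (Fn E M)}

lemma IsJetProduct.unique {P' : ℕ → DiagJets E M →ₗ[ℂ] DiagJets E M →ₗ[ℂ] DiagJets E M}
    (hP : IsJetProduct C P) (hP' : IsJetProduct C P') : P = P' := by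
  obtain ⟨D, hD, h⟩ := hP
  obtain ⟨D', hD', h'⟩ := hP'
  obtain rfl := hD.unique hD'
  ext1 r
  refine LinearMap.ext₂ fun u v => ?_
  obtain ⟨F, rfl⟩ := diagJetₗ_surjective u
  obtain ⟨G, rfl⟩ := diagJetₗ_surjective v
  exact (h r F G).trans (h' r F G).symm

lemma IsOperatorMap.unique (hS : IsOperatorMapFn C S)
    {T' : ℕ → DiagJets E M →ₗ[ℂ] Module.End ℂ (Fn E M)}
    (hT : IsOperatorMap C T) (hT' : IsOperatorMap C T') : T = T' := by
  ext1 n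
  refine LinearMap.ext fun u => ?_
  obtain ⟨F, rfl⟩ := diagJetₗ_surjective u
  exact (hS.eq_of_isOperatorMap hT n F).trans (hS.eq_of_isOperatorMap hT' n F).symm

lemma IsOperatorMap.mul (hC : IsStarProduct Ω C) (hnat : IsNatural C) (hS : IsOperatorMapFn C S)
    (hP : IsJetProduct C P) (hT : IsOperatorMap C T) (n : ℕ) (u v : DiagJets E M) :
    ∑ p ∈ antidiagonal n, T p.1 (P p.2 u v) = ∑ p ∈ antidiagonal n, T p.1 u * T p.2 v := by
  obtain ⟨D, hD, h⟩ := hP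
  obtain ⟨F, rfl⟩ := diagJetₗ_surjective u
  obtain ⟨G, rfl⟩ := diagJetₗ_surjective v
  simp only [diagJetₗ_apply, h, hS.eq_of_isOperatorMap hT]
  rw [← hS.mul hC hnat hD n F G, ← Finset.Nat.sum_antidiagonal_swap]
  rfl

lemma IsOperatorMap.formalLin_formalBilin (hC : IsStarProduct Ω C) (hnat : IsNatural C)
    (hS : IsOperatorMapFn C S) (hP : IsJetProduct C P) (hT : IsOperatorMap C T)
    (F G : (DiagJets E M)⟦X⟧) :
    formalLin T (formalBilin P F G) = formalLin T F * formalLin T G := by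
  ext1 n
  rw [PowerSeries.coeff_mul]
  simp only [formalLin, formalBilin, PowerSeries.coeff_mk, map_sum, sum_mul_sum]
  rw [← sum_antidiagonal_assoc n fun a b c => ∑ r ∈ antidiagonal c,
    T a (P b (PowerSeries.coeff r.1 F) (PowerSeries.coeff r.2 G)),
    ← sum_antidiagonal_middle n fun a b c d =>
      T a (PowerSeries.coeff c F) * T b (PowerSeries.coeff d G)]
  refine sum_congr rfl fun p _ => ?_
  rw [sum_comm, sum_comm (s := antidiagonal p.1)]
  exact sum_congr rfl fun r _ => hT.mul hC hnat hS hP p.1 _ _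

lemma IsOperatorMap.formalLin_jetTensor (hS : IsOperatorMapFn C S) (hT : IsOperatorMap C T)
    (f g : (Fn E M)⟦X⟧) : formalLin T (jetTensor f g) = opL C f * opR C g := by
  ext1 n
  rw [hS.coeff_opL_mul_opR]
  simp only [formalLin, jetTensor, PowerSeries.coeff_mk, map_sum, hS.eq_of_isOperatorMap hT]

lemma jetTensor_one_one : jetTensor (1 : (Fn E M)⟦X⟧) 1 = 1 := by
  ext1 n
  rw [jetTensor, PowerSeries.coeff_mk]
  have h0 : ∀ f : Fn E M, diagJet (tensor f 0) = 0 := fun f => by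
    have h1 : tensor f 0 = 0 := map_zero (tensorₗ f)
    rw [h1]
    exact map_zero (diagJetₗ E M)
  have h0' : ∀ f : Fn E M, diagJet (tensor 0 f) = 0 := fun f => by
    have h1 : tensor 0 f = 0 := LinearMap.map_zero₂ tensorₗ f
    rw [h1]
    exact map_zero (diagJetₗ E M)
  by_cases hn : n = 0
  · subst hn
    rw [HasAntidiagonal.antidiagonal_zero, sum_singleton]
    simp only [PowerSeries.coeff_zero_one, tensor_one_one]
    rfl
  · rw [PowerSeries.coeff_one, if_neg hn]
    refine Finset.sum_eq_zero fun p hp => ?_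
    have hp' := HasAntidiagonal.mem_antidiagonal.1 hp
    rw [PowerSeries.coeff_one, PowerSeries.coeff_one]
    by_cases h1 : p.1 = 0
    · have h2 : p.2 ≠ 0 := by omega
      rw [if_neg h2, h0]
    · rw [if_neg h1, h0']

lemma formalLin_smul {R W : Type*} [CommRing R] [Algebra ℂ R] [Ring W] [Algebra ℂ W]
    (T : ℕ → R →ₗ[ℂ] W) (c : ℂ) (F : R⟦X⟧) : formalLin T (c • F) = c • formalLin T F := by
  ext1 n
  simp [formalLin, Finset.smul_sum]

lemma formalLin_formalConst_mul {R W : Type*} [CommRing R] [Algebra ℂ R] [Ring W] [Algebra ℂ W]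
    (T : ℕ → R →ₗ[ℂ] W) (c : ℂ⟦X⟧) (F : R⟦X⟧) :
    formalLin T (formalConst R c * F) = formalConst W c * formalLin T F := by
  ext1 n
  rw [PowerSeries.coeff_mul]
  simp only [formalLin, formalConst, PowerSeries.coeff_mk, PowerSeries.coeff_mul,
    PowerSeries.coeff_map, ← Algebra.smul_def, map_sum, map_smul, Finset.smul_sum]
  rw [← sum_antidiagonal_assoc n fun a b d =>
      PowerSeries.coeff b c • T a (PowerSeries.coeff d F),
    ← sum_antidiagonal_assoc n fun a b d =>
      PowerSeries.coeff a c • T b (PowerSeries.coeff d F)]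
  refine sum_congr rfl fun p _ => ?_
  rw [← Finset.Nat.sum_antidiagonal_swap]
  rfl

lemma formalLin_formalConst_mul_diagJets (T : ℕ → DiagJets E M →ₗ[ℂ] Module.End ℂ (Fn E M))
    (c : ℂ⟦X⟧) (F : (DiagJets E M)⟦X⟧) :
    formalLin T (formalConst _ c * F) = formalConst _ c * formalLin T F :=
  formalLin_formalConst_mul (R := DiagJets E M) (W := Module.End ℂ (Fn E M)) T c F

lemma IsOperatorMap.formalLin_mem (hC : IsStarProduct Ω C) (hnat : IsNatural C)
    (hS : IsOperatorMapFn C S) (hT : IsOperatorMap C T) (F : (DiagJets E M)⟦X⟧) :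
    formalLin T F ∈ NaturalOps 𝓘(ℝ, E) M := by
  intro n
  rw [isDiffOp_iff, formalLin, PowerSeries.coeff_mk]
  refine OrdLT.sum _ fun p hp => ?_
  have hp' := HasAntidiagonal.mem_antidiagonal.1 hp
  obtain ⟨G, hG⟩ := diagJetₗ_surjective (PowerSeries.coeff p.2 F)
  rw [← hG, diagJetₗ_apply, hS.eq_of_isOperatorMap hT]
  exact (hS.ordLT hC hnat p.1 G).mono (by omega)

variable [SigmaCompactSpace M]

lemma IsOperatorMap.eq_zero_of_formalLin (hC : IsStarProduct Ω C) (hnat : IsNatural C)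
    (hD : IsTensorOpp C D) (hS : IsOperatorMapFn C S) (hT : IsOperatorMap C T)
    {F : (DiagJets E M)⟦X⟧} (hF : formalLin T F = 0) : F = 0 := by
  ext1 q
  rw [map_zero]
  induction q using Nat.strong_induction_on with
  | _ q ih =>
  obtain ⟨G, hG⟩ := diagJetₗ_surjective (PowerSeries.coeff q F)
  have hJ : ∀ r, G ∈ diagVanish E M r := by
    intro r
    induction r with
    | zero => exact mem_diagVanish.2 fun x => by simp
    | succ r ihr =>
      refine hS.mem_diagVanish_succ hC hnat hD r ihr fun x f hf => ?_
      have h1 := congrArg (PowerSeries.coeff (r + q)) hF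
      rw [formalLin, PowerSeries.coeff_mk, map_zero] at h1
      have h2 := congrArg (fun A : Module.End ℂ (Fn E M) => (A f).1 x) h1
      simp only [LinearMap.sum_apply, AddSubmonoidClass.coe_finsetSum, Finset.sum_apply] at h2
      rw [Finset.sum_eq_single (r, q)] at h2
      · rw [← hG, diagJetₗ_apply, hS.eq_of_isOperatorMap hT] at h2
        exact h2
      · rintro ⟨a, b⟩ hp hne
        have hp' : a + b = r + q := HasAntidiagonal.mem_antidiagonal.1 hp
        rcases lt_trichotomy b q with hb | rfl | hb
        · rw [ih b hb]
          simp
        · obtain rfl : a = r := by omega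
          exact absurd rfl hne
        · obtain ⟨G', hG'⟩ := diagJetₗ_surjective (PowerSeries.coeff b F)
          simp only
          rw [← hG', diagJetₗ_apply, hS.eq_of_isOperatorMap hT]
          exact ((hS.ordLT hC hnat a G').mono (show a + 1 ≤ r by omega)) x f hf
      · simp
  rw [← hG, diagJetₗ_eq_zero]
  exact fun r => mem_diagIdeal_pow_of_flat hC hD hJ (r + 1)

/-- The leading symbols of a natural operator are those of the operator of a function. -/
lemma IsOperatorMapFn.exists_forall_ordLT_sub (hC : IsStarProduct Ω C) (hnat : IsNatural C)
    (hD : IsTensorOpp C D) (hS : IsOperatorMapFn C S) {Y : ℕ → Module.End ℂ (Fn E M)}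
    (hY : ∀ n, OrdLT (n + 1) (Y n)) : ∃ F : Fn₂ E M, ∀ n, OrdLT n (Y n - S n F) := by
  have step : ∀ (s : ℕ) (A : Fn₂ E M), ∃ G ∈ diagVanish E M s, OrdLT s (S s G - (Y s - S s A)) :=
    fun s A => hS.exists_ordLT_sub hC hnat hD s ((hY s).sub (hS.ordLT hC hnat s A))
  choose G hG hGY using step
  let A : ℕ → Fn₂ E M := fun s => Nat.rec 0 (fun s A => A + G s A) s
  have hA : ∀ r, A r = ∑ s ∈ range r, G s (A s) := by
    intro r
    induction r with
    | zero => rfl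
    | succ r ih =>
      rw [Finset.sum_range_succ, ← ih]
  obtain ⟨F, hF⟩ := exists_borel_diag hC hD fun s => hG s (A s)
  refine ⟨F, fun n x f hf => ?_⟩
  have h1 := hS.ordLT_of_mem_diagVanish hC hnat hD (hF (n + 1)) x f hf
  rw [← hA] at h1
  have h2 := hGY n (A n) x f hf
  have h3 : A (n + 1) = A n + G n (A n) := rfl
  simp only [h3, map_sub, map_add, LinearMap.sub_apply, LinearMap.add_apply,
    AddSubgroupClass.coe_sub, Subalgebra.coe_add, Pi.add_apply, Pi.sub_apply] at h1 h2 ⊢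
  linear_combination -h1 - h2

lemma IsOperatorMap.exists_formalLin_eq (hC : IsStarProduct Ω C) (hnat : IsNatural C)
    (hD : IsTensorOpp C D) (hS : IsOperatorMapFn C S) (hT : IsOperatorMap C T)
    {Y : (Module.End ℂ (Fn E M))⟦X⟧} (hY : Y ∈ NaturalOps 𝓘(ℝ, E) M) :
    ∃ F : (DiagJets E M)⟦X⟧, formalLin T F = Y := by
  choose! G hG using fun (Z : ℕ → Module.End ℂ (Fn E M)) (hZ : ∀ n, OrdLT (n + 1) (Z n)) =>
    hS.exists_forall_ordLT_sub hC hnat hD hZ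
  let Z : ℕ → ℕ → Module.End ℂ (Fn E M) := fun q => Nat.rec (fun n => PowerSeries.coeff n Y)
    (fun _ Z n => Z (n + 1) - S (n + 1) (G Z)) q
  have hZ : ∀ q n, OrdLT (n + 1) (Z q n) := by
    intro q
    induction q with
    | zero => exact hY
    | succ q ih => exact fun n => hG (Z q) ih (n + 1)
  have hZS : ∀ n q, Z q n = ∑ p ∈ antidiagonal n, S p.1 (G (Z (q + p.2))) := by
    intro n
    induction n with
    | zero =>
      intro q
      rw [HasAntidiagonal.antidiagonal_zero, sum_singleton]
      exact sub_eq_zero.1 (hG (Z q) (hZ q) 0).eq_zero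
    | succ n ih =>
      intro q
      have h1 : ∑ p ∈ antidiagonal n, S p.1 (G (Z (q + 1 + p.2))) =
          Z q (n + 1) - S (n + 1) (G (Z q)) := (ih (q + 1)).symm
      rw [Finset.Nat.sum_antidiagonal_succ']
      have h2 : Z q (n + 1) = S (n + 1) (G (Z q)) +
          ∑ p ∈ antidiagonal n, S p.1 (G (Z (q + 1 + p.2))) := by
        rw [h1]
        ext1 f
        simp only [LinearMap.add_apply, LinearMap.sub_apply]
        abel
      rw [h2]
      congr 1
      exact sum_congr rfl fun p _ => by rw [add_assoc, add_comm 1]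
  refine ⟨PowerSeries.mk fun q => diagJet (G (Z q)), ?_⟩
  ext1 n
  simp only [formalLin, PowerSeries.coeff_mk, hS.eq_of_isOperatorMap hT]
  have h1 := (hZS n 0).symm
  simp only [zero_add] at h1
  exact h1

end Isomorphism

end StarProduct

theorem mainTheorem4
    {E : Type*} [NormedAddCommGroup E] [NormedSpace ℝ E] [FiniteDimensional ℝ E]
    {M : Type*} [TopologicalSpace M] [ChartedSpace E M] [IsManifold 𝓘(ℝ, E) ∞ M]
    [T2Space M] [SigmaCompactSpace M]
    (Ω : SymplecticForm E M)
    (C : ℕ → SmoothFn 𝓘(ℝ, E) M →ₗ[ℂ] SmoothFn 𝓘(ℝ, E) M →ₗ[ℂ] SmoothFn 𝓘(ℝ, E) M)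
    (hC : IsStarProduct Ω C) (hnat : IsNatural C) :
    (∃! D, IsTensorOpp C D) ∧
    (∃! P, IsJetProduct C P) ∧
    (∃! T, IsOperatorMap C T) ∧
    ∀ P T, IsJetProduct C P → IsOperatorMap C T →
      ∃ N : (DiagJets E M)⟦X⟧ ≃ₗ[ℂ] NaturalOps 𝓘(ℝ, E) M,
        (∀ F, (N F : (Module.End ℂ (SmoothFn 𝓘(ℝ, E) M))⟦X⟧) = formalLin T F) ∧
        (∀ F G, N (formalBilin P F G) = N F * N G) ∧
        N 1 = 1 ∧
        (∀ (c : ℂ⟦X⟧) F, (N (formalConst _ c * F) : (Module.End ℂ (SmoothFn 𝓘(ℝ, E) M))⟦X⟧) =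
          formalConst _ c * (N F : (Module.End ℂ (SmoothFn 𝓘(ℝ, E) M))⟦X⟧)) ∧
        ∀ f g : (SmoothFn 𝓘(ℝ, E) M)⟦X⟧,
          (N (jetTensor f g) : (Module.End ℂ (SmoothFn 𝓘(ℝ, E) M))⟦X⟧) =
            opL C f * opR C g := by
  obtain ⟨D, hD⟩ := exists_isTensorOpp (hC.isBidiffOp hnat)
  obtain ⟨S, hS⟩ := exists_isOperatorMapFn hC hnat
  obtain ⟨P₀, hP₀⟩ := exists_isJetProduct hD
  obtain ⟨T₀, hT₀⟩ := exists_isOperatorMap hS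
  refine ⟨⟨D, hD, fun D' hD' => hD'.unique hD⟩, ⟨P₀, hP₀, fun P hP => hP.unique hP₀⟩,
    ⟨T₀, hT₀, fun T hT => hT.unique hS hT₀⟩, fun P T hP hT => ?_⟩
  let N₀ : (DiagJets E M)⟦X⟧ →ₗ[ℂ] NaturalOps 𝓘(ℝ, E) M :=
    { toFun := fun F => ⟨formalLin T F, hT.formalLin_mem hC hnat hS F⟩
      map_add' := fun F G => Subtype.ext (formalLin_add T F G)
      map_smul' := fun c F => Subtype.ext
        (formalLin_smul (R := DiagJets E M) (W := Module.End ℂ (Fn E M)) T c F) }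
  have hbij : Function.Bijective N₀ := by
    refine ⟨(injective_iff_map_eq_zero N₀).2 fun F hF =>
      hT.eq_zero_of_formalLin hC hnat hD hS (congrArg Subtype.val hF), fun Y => ?_⟩
    obtain ⟨F, hF⟩ := hT.exists_formalLin_eq hC hnat hD hS Y.2
    exact ⟨F, Subtype.ext hF⟩
  refine ⟨LinearEquiv.ofBijective N₀ hbij, fun F => rfl, fun F G => Subtype.ext ?_,
    Subtype.ext ?_, fun c F => formalLin_formalConst_mul_diagJets T c F,
    fun f g => ?_⟩
  · exact hT.formalLin_formalBilin hC hnat hS hP F G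
  · show formalLin T 1 = 1
    rw [← jetTensor_one_one, hT.formalLin_jetTensor hS, hC.opL_one, hC.opR_one, mul_one]
  · exact hT.formalLin_jetTensor hS f g
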